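/- Let $d\ge 1$, $\alpha\in(0,2]$, $m>1$, $R>0$, and put $$\lambda=\frac1{d(m-1)+\alpha},\qquad k=\frac{d}{d(m-1)+\alpha}\cdot\frac{\Gamma(d/2)}{2^{\alpha}\,\Gamma(1+\alpha/2)\,\Gamma((d+\alpha)/2)} .$$ Write $\nabla^{\alpha-1}=\nabla I_{2-\alpha}$, where $I_0=\mathrm{id}$ and, for $\beta\in(0,2)$, $I_\beta w(x)=\int_{\mathbb R^d}\kappa_\beta(z)\,w(x+z)\,dz$ is the Riesz potential, with $\kappa_\beta(z)=\dfrac{\Gamma((d-\beta)/2)}{2^{\beta}\pi^{d/2}\Gamma(\beta/2)}|z|^{\beta-d}$ if $\beta\ne d$ and $\kappa_1(z)=-\frac1\pi\log|z|$ if $\beta=d=1$. (1) The function $\Phi(y)=\bigl(k\,(R^2-|y|^2)_+^{\alpha/2}\bigr)^{1/(m-1)}$ is nonnegative and solves $$-\lambda\nabla\cdot(y\Phi)=\nabla\cdot\bigl(\Phi\,\nabla^{\alpha-1}\Phi^{m-1}\bigr)$$ in the sense of distributions on $\mathbb R^d$, where $\nabla^{\alpha-1}\Phi^{m-1}$ is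 the weak gradient of $I_{2-\alpha}(\Phi^{m-1})\in W^{1,1}_{\rm loc}(\mathbb R^d)$, and $y\Phi$ and $\Phi\,\nabla^{\alpha-1}\Phi^{m-1}$ are locally integrable. (2) For $t>0$ let $$u(t,x)=t^{-d\lambda}\Bigl(k\,\bigl(R^2-|x|^2t^{-2\lambda}\bigr)_+^{\alpha/2}\Bigr)^{1/(m-1)} .$$ Then $u(t,x)=t^{-d\lambda}\Phi(xt^{-\lambda})$, and $u(t,\cdot)$ has compact support for every $t>0$. Moreover, $u$ and, for every $x_0\in\mathbb R^d$, its translate $u(t,x-x_0)$ (with $|x|$ replaced by $|x-x_0|$ in (b) and (c)) have the following properties. (a) For all $0<t_0<T<\infty$, $u$ is a weak solution of $\partial_t u=\nabla\cdot(u\nabla^{\alpha-1}|u|^{m-1})$ in $Q=(t_0,T)\times\mathbb R^d$ with initial datum $u(t_0,\cdot)\in L^1_{\rm loc}(\mathbb R^d)$ at time $t_0$, that is: $u\in L^1(Q)$, $I_{2-\alpha}(|u|^{m-1})\in L^1(t_0,T;W^{1,1}_{\rm loc}(\mathbb R^d))$, $u\,\nabla I_{2-\alpha}(|u|^{m-1})\in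 L^1(Q)$, and $$\int_{t_0}^{T}\!\!\int_{\mathbb R^d}u\bigl(\varphi_t-\nabla I_{2-\alpha}(|u|^{m-1})\cdot\nabla\varphi\bigr)\,dx\,dt+\int_{\mathbb R^d}u(t_0,x)\,\varphi(t_0,x)\,dx=0$$ for every $\varphi\in C^1([t_0,T)\times\mathbb R^d)$ that has compact support in $x$ (uniformly in $t$) and vanishes near $t=T$. (b) At every $(t,x)$ with $t>0$ and $|x|\ne Rt^{\lambda}$ the equation holds pointwise, with all the derivatives in it existing in the classical sense. (c) Every point $(t,x)$ with $t>0$ and $|x|=Rt^{\lambda}$ has a neighbourhood in $(0,\infty)\times\mathbb R^d$ on which $u$ is Hölder continuous in $(t,x)$ with exponent $\min\{\frac{\alpha}{2(m-1)},1\}$. -/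

import Mathlib

open MeasureTheory Set Filter Topology
open scoped ContDiff NNReal

noncomputable section

/-- The convolution kernel of the Riesz potential of order `β ∈ (0, 2)` on `ℝ^d`, i.e. the
fundamental solution of `(-Δ)^{β/2}`: the function `C_β |z|^{β-d}`, with the usual logarithmic
kernel in the only exceptional case `β = d` (that is `β = d = 1`). For `d = 1 < β` the
constant `C_β` is negative. -/
def rieszKernel {d : ℕ} (β : ℝ) (z : EuclideanSpace ℝ (Fin d)) : ℝ :=
  if β = (d : ℝ) then
    -(2 / (2 ^ (d : ℝ) * Real.pi ^ ((d : ℝ) / 2) * Real.Gamma ((d : ℝ) / 2))) * Real.log ‖z‖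
  else
    Real.Gamma (((d : ℝ) - β) / 2) / (2 ^ β * Real.pi ^ ((d : ℝ) / 2) * Real.Gamma (β / 2))
      * ‖z‖ ^ (β - (d : ℝ))

/-- The integral that defines the Riesz potential `I_β w` converges absolutely at `x`
(no condition for `β = 0`, since `I_0` is the identity). -/
def RieszConvergesAt {d : ℕ} (β : ℝ) (w : EuclideanSpace ℝ (Fin d) → ℝ)
    (x : EuclideanSpace ℝ (Fin d)) : Prop :=
  β = 0 ∨ Integrable (fun z : EuclideanSpace ℝ (Fin d) => rieszKernel β z * w (x + z))

/-- The Riesz potential `I_β w`, `0 ≤ β < 2`, with `I_0 w = w`. -/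
def rieszPotential {d : ℕ} (β : ℝ) (w : EuclideanSpace ℝ (Fin d) → ℝ)
    (x : EuclideanSpace ℝ (Fin d)) : ℝ :=
  if β = 0 then w x
  else ∫ z : EuclideanSpace ℝ (Fin d), rieszKernel β z * w (x + z)

/-- `f` belongs to `W^{1,1}_loc(ℝ^d)` and `V` is its weak gradient. -/
def HasWeakGradient {d : ℕ} (f : EuclideanSpace ℝ (Fin d) → ℝ)
    (V : EuclideanSpace ℝ (Fin d) → EuclideanSpace ℝ (Fin d)) : Prop :=
  LocallyIntegrable f ∧ LocallyIntegrable V ∧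
    ∀ ψ : EuclideanSpace ℝ (Fin d) → ℝ, ContDiff ℝ ∞ ψ → HasCompactSupport ψ →
      ∫ x, f x • gradient ψ x = -∫ x, ψ x • V x

/-- `V` is `∇^{α-1} w = ∇ I_{2-α} w`, the gradient being taken in the weak sense on `ℝ^d`. -/
def IsFracGradient {d : ℕ} (α : ℝ) (w : EuclideanSpace ℝ (Fin d) → ℝ)
    (V : EuclideanSpace ℝ (Fin d) → EuclideanSpace ℝ (Fin d)) : Prop :=
  (∀ᵐ x, RieszConvergesAt (2 - α) w x) ∧ HasWeakGradient (rieszPotential (2 - α) w) V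

/-- `v` is the value at `x` of `∇^{α-1} w = ∇ I_{2-α} w`, the gradient being classical. -/
def HasFracGradientAt {d : ℕ} (α : ℝ) (w : EuclideanSpace ℝ (Fin d) → ℝ)
    (v x : EuclideanSpace ℝ (Fin d)) : Prop :=
  (∀ᶠ y in 𝓝 x, RieszConvergesAt (2 - α) w y) ∧ HasGradientAt (rieszPotential (2 - α) w) v x

/-- The exponent `λ = 1 / (d(m-1) + α)`. -/
def selfSimExponent (d : ℕ) (α m : ℝ) : ℝ := 1 / ((d : ℝ) * (m - 1) + α)

/-- `Φ ≥ 0` is a solution of `-λ ∇·(y Φ) = ∇·(Φ ∇^{α-1} Φ^{m-1})` in the sense of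
distributions on `ℝ^d`. -/
def IsProfileSolution {d : ℕ} (α m : ℝ) (Φ : EuclideanSpace ℝ (Fin d) → ℝ) : Prop :=
  (∀ y, 0 ≤ Φ y) ∧
  ∃ V : EuclideanSpace ℝ (Fin d) → EuclideanSpace ℝ (Fin d),
    IsFracGradient α (fun y => Φ y ^ (m - 1)) V ∧
    LocallyIntegrable (fun y => Φ y • y) ∧
    LocallyIntegrable (fun y => Φ y • V y) ∧
    ∀ ψ : EuclideanSpace ℝ (Fin d) → ℝ, ContDiff ℝ ∞ ψ → HasCompactSupport ψ →
      selfSimExponent d α m * ∫ y, Φ y * inner ℝ y (gradient ψ y) =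
        -∫ y, Φ y * inner ℝ (V y) (gradient ψ y)

/-- Test functions on the strip `(t₀, T) × ℝ^d`: functions that are `C¹` up to `t = t₀`, have
compact support in the space variable and vanish near `t = T`. -/
def IsTestFunction {d : ℕ} (t₀ T : ℝ) (φ : ℝ → EuclideanSpace ℝ (Fin d) → ℝ) : Prop :=
  ContDiffOn ℝ 1 (fun p : ℝ × EuclideanSpace ℝ (Fin d) => φ p.1 p.2) (Ico t₀ T ×ˢ univ) ∧
  (∃ K : Set (EuclideanSpace ℝ (Fin d)), IsCompact K ∧
    ∀ t ∈ Ico t₀ T, ∀ x, x ∉ K → φ t x = 0) ∧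
  (∃ δ > 0, ∀ t ∈ Ico t₀ T, T - δ < t → ∀ x, φ t x = 0)

/-- `u` is a weak solution of `∂_t u = ∇·(u ∇^{α-1} |u|^{m-1})` in the strip `(t₀, T) × ℝ^d` with
the initial condition `u(t₀, ·) = u₀`: `u ∈ L¹`, `I_{2-α}(|u|^{m-1}) ∈ L¹(t₀, T; W^{1,1}_loc)`
with spatial weak gradient `V`, `u V ∈ L¹`, and the integral identity holds. -/
def IsWeakSolution {d : ℕ} (α m t₀ T : ℝ) (u : ℝ → EuclideanSpace ℝ (Fin d) → ℝ)
    (u₀ : EuclideanSpace ℝ (Fin d) → ℝ) : Prop :=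
  IntegrableOn (fun p : ℝ × EuclideanSpace ℝ (Fin d) => u p.1 p.2) (Ioo t₀ T ×ˢ univ) ∧
  LocallyIntegrable u₀ ∧
  ∃ V : ℝ → EuclideanSpace ℝ (Fin d) → EuclideanSpace ℝ (Fin d),
    (∀ᵐ t ∂(volume.restrict (Ioo t₀ T)), IsFracGradient α (fun x => |u t x| ^ (m - 1)) (V t)) ∧
    (∀ K : Set (EuclideanSpace ℝ (Fin d)), IsCompact K →
      IntegrableOn (fun p : ℝ × EuclideanSpace ℝ (Fin d) =>
        rieszPotential (2 - α) (fun x => |u p.1 x| ^ (m - 1)) p.2) (Ioo t₀ T ×ˢ K) ∧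
      IntegrableOn (fun p : ℝ × EuclideanSpace ℝ (Fin d) => V p.1 p.2) (Ioo t₀ T ×ˢ K)) ∧
    IntegrableOn (fun p : ℝ × EuclideanSpace ℝ (Fin d) => u p.1 p.2 • V p.1 p.2)
      (Ioo t₀ T ×ˢ univ) ∧
    ∀ φ : ℝ → EuclideanSpace ℝ (Fin d) → ℝ, IsTestFunction t₀ T φ →
      (∫ p in Ioo t₀ T ×ˢ (univ : Set (EuclideanSpace ℝ (Fin d))),
        u p.1 p.2 * (deriv (fun s => φ s p.2) p.1
          - inner ℝ (V p.1 p.2) (gradient (φ p.1) p.2)))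
      + ∫ x, u₀ x * φ t₀ x = 0

/-- `∂_t u = ∇·(u ∇^{α-1} |u|^{m-1})` holds at the point `(t, x)`, all the derivatives existing in
the classical sense. -/
def SolvesPointwiseAt {d : ℕ} (α m : ℝ) (u : ℝ → EuclideanSpace ℝ (Fin d) → ℝ)
    (t : ℝ) (x : EuclideanSpace ℝ (Fin d)) : Prop :=
  ∃ V : EuclideanSpace ℝ (Fin d) → EuclideanSpace ℝ (Fin d),
    (∀ᶠ y in 𝓝 x, HasFracGradientAt α (fun z => |u t z| ^ (m - 1)) (V y) y) ∧
    ∃ A : EuclideanSpace ℝ (Fin d) →L[ℝ] EuclideanSpace ℝ (Fin d),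
      HasFDerivAt (fun y => u t y • V y) A x ∧
      HasDerivAt (fun s => u s x) (∑ i, A (EuclideanSpace.single i 1) i) t

/-- The constant `k`. -/
def barenblattConst (d : ℕ) (α m : ℝ) : ℝ :=
  ((d : ℝ) / ((d : ℝ) * (m - 1) + α)) *
    (Real.Gamma ((d : ℝ) / 2) /
      (2 ^ α * Real.Gamma (1 + α / 2) * Real.Gamma (((d : ℝ) + α) / 2)))

/-- The profile `Φ(y) = (k (R² - |y|²)_+^{α/2})^{1/(m-1)}`. -/
def barenblattProfile (d : ℕ) (α m R : ℝ) (y : EuclideanSpace ℝ (Fin d)) : ℝ :=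
  (barenblattConst d α m * (max (R ^ 2 - ‖y‖ ^ 2) 0) ^ (α / 2)) ^ (1 / (m - 1))

/-- The function
`u(t,x) = t^{-d/(d(m-1)+α)} (k (R² - |x|² t^{-2/(d(m-1)+α)})_+^{α/2})^{1/(m-1)}`, `t > 0`. -/
def barenblatt (d : ℕ) (α m R : ℝ) (t : ℝ) (x : EuclideanSpace ℝ (Fin d)) : ℝ :=
  t ^ (-((d : ℝ) / ((d : ℝ) * (m - 1) + α))) *
    (barenblattConst d α m *
      (max (R ^ 2 - ‖x‖ ^ 2 * t ^ (-(2 / ((d : ℝ) * (m - 1) + α)))) 0) ^ (α / 2)) ^ (1 / (m - 1))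

end

noncomputable section

variable {d : ℕ}

local notation "𝔼" => EuclideanSpace ℝ (Fin d)

/-! Everything rests on one fact (`rieszPotential_ballPower`): inside the ball of radius `ρ` the
potential `I_{2-α}` of `(ρ² - |x|²)_+^{α/2}` equals `A - (λ/2k)|x|²`. Hence `∇^{α-1}Φ^{m-1} = -λy`
wherever `Φ > 0`. Elsewhere the gradient is not explicit, but it is multiplied by `Φ = 0`; so `Φ
∇^{α-1}Φ^{m-1} = -λyΦ` holds before any divergence is taken.

The potential is computed as follows. With `q = α/2` and `D = ρ² - |x|²`, one has `ρ² - |x+z|² =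
|z|² g(z)` for `g = (D - 2⟨x,z⟩ - |z|²)/|z|²`, so the integrand `|z|^{2-2q-d}(ρ² - |x+z|²)_+^q`
becomes `|z|^{2-d} g_+^q`. The layer-cake formula reduces its integral to the `|z|^{2-d}`-measure of
the sets `{g > v}`. Each of these is a ball containing the origin, and its measure is the Newtonian
potential of a ball, a quadratic polynomial in `x` for fixed `D` (`lintegral_newton_ball`). Beta
integrals in `v` finish the computation. The logarithmic kernel, `d = α = 1`, is a limit of power
kernels.

The weak gradient commutes with the potential (`HasWeakGradient.rieszPotential`) and is local
(`HasWeakGradient.ae_eq_of_eqOn`), which makes the formula usable in the weak sense. The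
self-similar scaling gives `u V = -(λ/t)(x - x₀)u`, so the equation becomes a continuity equation
with velocity `λ(x - x₀)/t`. Its flow lines are `t ↦ x₀ + t^λ y`, and the weak identity is the
fundamental theorem of calculus along them (`integral_barenblatt_transport`). Near the free boundary
`u` is a constant times `g_+^γ` with a `C¹` function `g` and `γ = α/(2(m-1))`, whence the Hölder
exponent. -/

/-! ### Polar coordinates and second moments of the unit ball -/

lemma lintegral_comp_smul_euclidean (f : 𝔼 → ENNReal) (hf : Measurable f) {r : ℝ}
    (hr : 0 < r) :
    ∫⁻ z, f (r • z) = ENNReal.ofReal ((r ^ d)⁻¹) * ∫⁻ z, f z := by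
  have h1 := Measure.map_addHaar_smul (volume : Measure 𝔼) hr.ne'
  rw [← lintegral_map hf (measurable_const_smul r), h1, lintegral_smul_measure]
  simp [abs_of_pos hr]

lemma lintegral_tail_rpow {n : ℕ} {a : ℝ} (ha : 0 < a) :
    ∫⁻ r in Ioi (0 : ℝ), (Ioi a).indicator
      (fun r => ENNReal.ofReal (a ^ (n + 1) * (r ^ (n + 2))⁻¹)) r
      = ENNReal.ofReal (1 / (n + 1)) := by
  rw [lintegral_indicator measurableSet_Ioi, Measure.restrict_restrict measurableSet_Ioi,
    inter_eq_left.2 (Ioi_subset_Ioi ha.le)]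
  have h1 : ((-(n + 2 : ℝ))) < -1 := by
    have : (0 : ℝ) ≤ n := n.cast_nonneg
    linarith
  have hcongr : ∀ r ∈ Ioi a, a ^ (n + 1) * (r ^ (n + 2))⁻¹ = a ^ (n + 1) * r ^ (-(n + 2 : ℝ)) := by
    intro r hr
    have hr0 : 0 < r := ha.trans hr
    rw [Real.rpow_neg hr0.le]
    congr 2
    exact_mod_cast (Real.rpow_natCast r (n + 2)).symm
  rw [← ofReal_integral_eq_lintegral_ofReal]
  · rw [setIntegral_congr_fun measurableSet_Ioi hcongr, integral_const_mul,
      integral_Ioi_rpow_of_lt h1 ha]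
    congr 1
    have h2 : -(n + 2 : ℝ) + 1 = -((n + 1 : ℕ) : ℝ) := by push_cast; ring
    rw [h2, Real.rpow_neg ha.le, Real.rpow_natCast]
    have : (0 : ℝ) < n + 1 := by positivity
    push_cast
    field_simp
  · refine IntegrableOn.congr_fun ((integrableOn_Ioi_rpow_of_lt h1 ha).const_mul (a ^ (n + 1)))
      (fun r hr => (hcongr r hr).symm) measurableSet_Ioi
  · refine (ae_restrict_mem measurableSet_Ioi).mono fun r hr => ?_
    have hr0 : 0 < r := ha.trans hr
    simp only [Pi.zero_apply]
    positivity

/-- The substitution `y = r • z` turns the condition `‖y‖ < r` into `‖z‖ < 1`, and the powers of `r`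
collapse to `r^{d-1}`, the polar weight. -/
lemma lintegral_ray_eq (f : 𝔼 → ENNReal) (hf : Measurable f) (H : 𝔼 → ℝ → ENNReal)
    (hH : ∀ y r, H y r =
      (Ioi ‖y‖).indicator (fun r => ENNReal.ofReal (‖y‖ ^ (d + 2) * (r ^ (d + 3))⁻¹)) r * f y) :
    (∫⁻ z in Metric.ball (0 : 𝔼) 1, ENNReal.ofReal (‖z‖ ^ (d + 2)) *
        ∫⁻ r in Ioi (0 : ℝ), ENNReal.ofReal (r ^ d / r) * f (r • z)) =
      ∫⁻ z : 𝔼, ∫⁻ r in Ioi (0 : ℝ), ENNReal.ofReal (r ^ d) * H (r • z) r := by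
  rw [← lintegral_indicator Metric.isOpen_ball.measurableSet]
  refine lintegral_congr fun z => ?_
  by_cases hz : z ∈ Metric.ball (0 : 𝔼) 1
  · rw [indicator_of_mem hz, ← lintegral_const_mul _ (by fun_prop)]
    refine setLIntegral_congr_fun measurableSet_Ioi fun r (hr : 0 < r) => ?_
    have hz' : ‖r • z‖ < r := by
      rw [norm_smul, Real.norm_of_nonneg hr.le]
      simpa using mul_lt_mul_of_pos_left (by simpa using hz : ‖z‖ < 1) hr
    rw [hH, indicator_of_mem (show r ∈ Ioi ‖r • z‖ from hz')]
    rw [← mul_assoc, ← mul_assoc, ← ENNReal.ofReal_mul (by positivity),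
      ← ENNReal.ofReal_mul (by positivity), norm_smul, Real.norm_of_nonneg hr.le]
    congr 2
    field_simp
    ring
  · rw [indicator_of_notMem hz]
    symm
    rw [setLIntegral_congr_fun (g := fun _ => 0) measurableSet_Ioi, lintegral_zero]
    intro r (hr : 0 < r)
    have hz' : r ∉ Ioi ‖r • z‖ := by
      simp only [mem_Ioi, not_lt, norm_smul, Real.norm_of_nonneg hr.le]
      simpa using mul_le_mul_of_nonneg_left (by simpa using hz : 1 ≤ ‖z‖) hr.le
    simp only [hH, indicator_of_notMem hz', zero_mul, mul_zero]

lemma measurable_tail_weight (f : 𝔼 → ENNReal) (hf : Measurable f) (H : 𝔼 → ℝ → ENNReal)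
    (hH : ∀ y r, H y r =
      (Ioi ‖y‖).indicator (fun r => ENNReal.ofReal (‖y‖ ^ (d + 2) * (r ^ (d + 3))⁻¹)) r * f y) :
    Measurable (Function.uncurry H) := by
  have : Function.uncurry H = fun p : 𝔼 × ℝ => {p : 𝔼 × ℝ | ‖p.1‖ < p.2}.indicator
      (fun p => ENNReal.ofReal (‖p.1‖ ^ (d + 2) * (p.2 ^ (d + 3))⁻¹)) p * f p.1 := by
    ext ⟨y, r⟩; simp [hH, Function.uncurry, indicator]
  rw [this]
  refine Measurable.mul (Measurable.indicator (by fun_prop) ?_) (hf.comp measurable_fst)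
  exact measurableSet_lt (by fun_prop) (by fun_prop)

/-- Integration in polar coordinates, with the average over the unit sphere written as a weighted
average over the unit ball. -/
lemma lintegral_eq_lintegral_ball_lintegral_ray (hd : 0 < d) (f : 𝔼 → ENNReal)
    (hf : Measurable f) :
    ENNReal.ofReal (1 / (d + 2)) * ∫⁻ z, f z =
      ∫⁻ z in Metric.ball (0 : 𝔼) 1, ENNReal.ofReal (‖z‖ ^ (d + 2)) *
        ∫⁻ r in Ioi (0 : ℝ), ENNReal.ofReal (r ^ d / r) * f (r • z) := by
  have : Nonempty (Fin d) := ⟨⟨0, hd⟩⟩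
  -- Integrating `H y r` over `r` gives `f y / (d + 2)`, while substituting `y = r • z` for fixed
  -- `r` gives the ray integrals; Tonelli equates the two.
  obtain ⟨H, hH⟩ : ∃ H : 𝔼 → ℝ → ENNReal, ∀ y r, H y r =
      (Ioi ‖y‖).indicator (fun r => ENNReal.ofReal (‖y‖ ^ (d + 2) * (r ^ (d + 3))⁻¹)) r * f y :=
    ⟨_, fun _ _ => rfl⟩
  have hHm := measurable_tail_weight f hf H hH
  rw [lintegral_ray_eq f hf H hH, lintegral_lintegral_swap]
  · have h1 : ∀ r ∈ Ioi (0 : ℝ), ∫⁻ z : 𝔼, ENNReal.ofReal (r ^ d) * H (r • z) r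
        = ∫⁻ y : 𝔼, H y r := by
      intro r (hr : 0 < r)
      have hm : Measurable fun y => H y r :=
        hHm.comp (by fun_prop : Measurable fun y : 𝔼 => (y, r))
      have hm' : Measurable fun z => H (r • z) r := hm.comp (measurable_const_smul r)
      have h3 := lintegral_comp_smul_euclidean (fun y => H y r) hm hr
      rw [lintegral_const_mul _ hm', h3,
        ← mul_assoc, ← ENNReal.ofReal_mul (by positivity), mul_inv_cancel₀ (by positivity),
        ENNReal.ofReal_one, one_mul]
    rw [setLIntegral_congr_fun measurableSet_Ioi h1, lintegral_lintegral_swap,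
      ← lintegral_const_mul _ hf]
    · refine lintegral_congr_ae ?_
      have h0 : ∀ᵐ y : 𝔼, y ≠ 0 := by simp [ae_iff, measure_singleton]
      filter_upwards [h0] with y hy
      have h2 := lintegral_tail_rpow (n := d + 1) (norm_pos_iff.2 hy)
      simp_rw [hH]
      rw [lintegral_mul_const _ (Measurable.indicator (by fun_prop) measurableSet_Ioi), h2]
      congr 3
      push_cast; ring
    · exact (hHm.comp measurable_swap).aemeasurable
  · refine Measurable.aemeasurable ?_
    have : Measurable fun p : 𝔼 × ℝ => Function.uncurry H (p.2 • p.1, p.2) :=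
      hHm.comp (by fun_prop)
    exact Measurable.mul (by fun_prop) this

/-- The second moment of the unit ball. -/
lemma integral_ball_norm_sq (hd : 0 < d) :
    ∫ z in Metric.ball (0 : 𝔼) 1, ‖z‖ ^ 2 = d / (d + 2) * volume.real (Metric.ball (0 : 𝔼) 1) := by
  have : Nonempty (Fin d) := ⟨⟨0, hd⟩⟩
  have h1 := integral_fun_norm_addHaar (volume : Measure 𝔼) ((Iio (1 : ℝ)).indicator fun r => r ^ 2)
  rw [← integral_indicator Metric.isOpen_ball.measurableSet]
  have h2 : (fun x : 𝔼 => (Iio (1 : ℝ)).indicator (fun r => r ^ 2) ‖x‖) =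
      (Metric.ball (0 : 𝔼) 1).indicator fun z => ‖z‖ ^ 2 := by
    ext x; simp [indicator]
  rw [h2] at h1
  rw [h1, finrank_euclideanSpace_fin]
  have h3 : ∫ y in Ioi (0 : ℝ), y ^ (d - 1) • (Iio (1 : ℝ)).indicator (fun r => r ^ 2) y
      = 1 / (d + 2) := by
    have h4 : ∀ y, y ^ (d - 1) • (Iio (1 : ℝ)).indicator (fun r => r ^ 2) y
       = (Iio (1 : ℝ)).indicator (fun r => r ^ (d + 1)) y := by
      intro y
      by_cases hy : y ∈ Iio (1 : ℝ)
      · simp only [indicator_of_mem hy, smul_eq_mul, ← pow_add]; congr 1; omega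
      · simp [indicator_of_notMem hy]
    simp_rw [h4]
    rw [integral_indicator measurableSet_Iio, Measure.restrict_restrict measurableSet_Iio,
      Iio_inter_Ioi, ← integral_Ioc_eq_integral_Ioo, ← intervalIntegral.integral_of_le zero_le_one,
      integral_pow]
    push_cast
    norm_num
    ring
  rw [h3]
  simp only [nsmul_eq_mul, smul_eq_mul]
  ring

/-- By reflection invariance the integral depends on `‖x‖` alone, so `x` may be replaced by `‖x‖ eᵢ`
for every `i`; summing over `i` leaves the second moment of the ball. -/
lemma integral_ball_inner_sq (hd : 0 < d) (x : 𝔼) :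
    ∫ z in Metric.ball (0 : 𝔼) 1, (inner ℝ x z) ^ 2 =
      ‖x‖ ^ 2 / (d + 2) * volume.real (Metric.ball (0 : 𝔼) 1) := by
  have hrot : ∀ y : 𝔼, ‖x‖ = ‖y‖ → ∫ z in Metric.ball (0 : 𝔼) 1, (inner ℝ x z) ^ 2 =
      ∫ z in Metric.ball (0 : 𝔼) 1, (inner ℝ y z) ^ 2 := by
    intro y hxy
    -- Since `‖x‖ = ‖y‖`, the reflection in the hyperplane orthogonal to `x - y` carries `x` to `y`.
    set L := (ℝ ∙ (x - y))ᗮ.reflection with hL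
    have hLx : L x = y := Submodule.reflection_sub hxy
    have hmp : MeasurePreserving L volume volume := L.measurePreserving
    have hpre : L ⁻¹' Metric.ball (0 : 𝔼) 1 = Metric.ball 0 1 := by
      ext z; simp
    have := hmp.setIntegral_preimage_emb L.toHomeomorph.measurableEmbedding
      (fun z => (inner ℝ y z) ^ 2) (Metric.ball 0 1)
    rw [hpre] at this
    rw [← this]
    refine setIntegral_congr_fun Metric.isOpen_ball.measurableSet fun z _ => ?_
    rw [← hLx, LinearIsometryEquiv.inner_map_map]
  have hint : ∀ y : 𝔼, IntegrableOn (fun z : 𝔼 => (inner ℝ y z : ℝ) ^ 2) (Metric.ball 0 1) := by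
    intro y
    refine IntegrableOn.mono_set (t := Metric.closedBall 0 1) ?_ Metric.ball_subset_closedBall
    refine ContinuousOn.integrableOn_compact (isCompact_closedBall _ _) ?_
    fun_prop
  have hsum : (d : ℝ) * ∫ z in Metric.ball (0 : 𝔼) 1, (inner ℝ x z) ^ 2 =
      ‖x‖ ^ 2 * ∫ z in Metric.ball (0 : 𝔼) 1, ‖z‖ ^ 2 := by
    have : ∀ i : Fin d, ∫ z in Metric.ball (0 : 𝔼) 1, (inner ℝ x z) ^ 2 =
        ‖x‖ ^ 2 * ∫ z in Metric.ball (0 : 𝔼) 1, z i ^ 2 := by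
      intro i
      rw [hrot (EuclideanSpace.single i ‖x‖) (by simp), ← integral_const_mul]
      refine setIntegral_congr_fun Metric.isOpen_ball.measurableSet fun z _ => ?_
      simp only [EuclideanSpace.inner_single_left]
      simp [mul_pow]
    have h2 : ∑ _i : Fin d, ∫ z in Metric.ball (0 : 𝔼) 1, (inner ℝ x z) ^ 2 =
        (d : ℝ) * ∫ z in Metric.ball (0 : 𝔼) 1, (inner ℝ x z) ^ 2 := by simp
    rw [← h2, Finset.sum_congr rfl fun i _ => this i, ← Finset.mul_sum, ← integral_finsetSum]
    · congr 1
      refine setIntegral_congr_fun Metric.isOpen_ball.measurableSet fun z _ => ?_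
      simp [EuclideanSpace.norm_sq_eq]
    · intro i _
      have := hint (EuclideanSpace.single i 1)
      refine this.congr_fun (fun z _ => ?_) Metric.isOpen_ball.measurableSet
      simp [EuclideanSpace.inner_single_left]
  rw [integral_ball_norm_sq hd] at hsum
  have hd' : (0 : ℝ) < d := by exact_mod_cast hd
  field_simp at hsum ⊢
  linarith

/-! ### The Newtonian potential of a ball at an interior point -/

lemma lintegral_Ioo_ofReal_id {b : ℝ} (hb : 0 ≤ b) :
    ∫⁻ r in Ioo (0 : ℝ) b, ENNReal.ofReal r = ENNReal.ofReal (b ^ 2 / 2) := by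
  rw [← ofReal_integral_eq_lintegral_ofReal]
  · rw [← integral_Ioc_eq_integral_Ioo, ← intervalIntegral.integral_of_le hb, integral_id]
    simp
  · exact (continuous_id.integrableOn_Icc (a := 0) (b := b)).mono_set Ioo_subset_Icc_self
  · exact (ae_restrict_mem measurableSet_Ioo).mono fun r hr => hr.1.le

/-- The roots of `A r² + 2 B r = D` have opposite signs because `A D > 0`, so only the positive one
matters for `r > 0`. -/
lemma quadratic_lt_iff {A B D r : ℝ} (hA : 0 < A) (hD : 0 < D) (hr : 0 < r) :
    A * r ^ 2 + 2 * B * r < D ↔ r < (√(B ^ 2 + A * D) - B) / A := by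
  have hS : √(B ^ 2 + A * D) ^ 2 = B ^ 2 + A * D := Real.sq_sqrt (by positivity)
  have hS0 : |B| < √(B ^ 2 + A * D) := by
    rw [← Real.sqrt_sq_eq_abs]
    exact Real.sqrt_lt_sqrt (sq_nonneg _) (by nlinarith [mul_pos hA hD])
  set S := √(B ^ 2 + A * D)
  rw [lt_div_iff₀ hA]
  have h1 := abs_lt.1 hS0
  constructor
  · intro h
    by_contra hc
    nlinarith [mul_pos hA hr]
  · intro h
    have : (A * r + B) ^ 2 < S ^ 2 := by
      apply sq_lt_sq'
      · nlinarith [mul_pos hA hr]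
      · linarith
    nlinarith [mul_pos hA hr]

/-- The ray integral that occurs in the Newtonian potential of a ball. -/
lemma lintegral_ray_newton (x z : 𝔼) (hz : z ≠ 0) {a D : ℝ} (ha : 0 < a) (hD : 0 < D) :
    ENNReal.ofReal (‖z‖ ^ (d + 2)) * ∫⁻ r in Ioi (0 : ℝ), ENNReal.ofReal (r ^ d / r) *
      ({z : 𝔼 | a * ‖z‖ ^ 2 + 2 * inner ℝ x z < D}.indicator
        (fun z => ENNReal.ofReal (‖z‖ ^ (2 - d : ℝ)))) (r • z) =
    ENNReal.ofReal ((√(inner ℝ x z ^ 2 + a * ‖z‖ ^ 2 * D) - inner ℝ x z) ^ 2 / (2 * a ^ 2)) := by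
  have hn : 0 < ‖z‖ := norm_pos_iff.2 hz
  set A := a * ‖z‖ ^ 2 with hA
  set B : ℝ := inner ℝ x z with hB
  have hA0 : 0 < A := by positivity
  -- `b` is the parameter at which the ray `r • z` leaves the ball.
  set b := (√(B ^ 2 + A * D) - B) / A with hb
  have hb0 : 0 ≤ b := by
    refine div_nonneg (sub_nonneg.2 ((le_abs_self B).trans ?_)) hA0.le
    rw [← Real.sqrt_sq_eq_abs]
    exact Real.sqrt_le_sqrt (by nlinarith [mul_pos hA0 hD])
  -- The polar weight `r^{d-1}` times `(r‖z‖)^{2-d}` is `r ‖z‖^{2-d}`, so the ray contributes `∫₀ᵇ r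
  -- dr = b²/2`.
  have h1 : ∀ r ∈ Ioi (0 : ℝ), ENNReal.ofReal (r ^ d / r) *
      ({z : 𝔼 | a * ‖z‖ ^ 2 + 2 * inner ℝ x z < D}.indicator
        (fun z => ENNReal.ofReal (‖z‖ ^ (2 - d : ℝ)))) (r • z) =
      ENNReal.ofReal (‖z‖ ^ (2 - d : ℝ)) * (Iio b).indicator (fun r => ENNReal.ofReal r) r := by
    intro r (hr : 0 < r)
    have hiff : r • z ∈ {z : 𝔼 | a * ‖z‖ ^ 2 + 2 * inner ℝ x z < D} ↔ r ∈ Iio b := by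
      rw [mem_Iio, hb, ← quadratic_lt_iff hA0 hD hr, mem_ofPred_eq, norm_smul, inner_smul_right,
        Real.norm_of_nonneg hr.le, hA, hB]
      ring_nf
    by_cases hm : r ∈ Iio b
    · rw [indicator_of_mem hm, indicator_of_mem (hiff.2 hm), ← ENNReal.ofReal_mul (by positivity),
        ← ENNReal.ofReal_mul (by positivity), norm_smul, Real.norm_of_nonneg hr.le,
        Real.mul_rpow hr.le hn.le, Real.rpow_sub hr, Real.rpow_natCast]
      congr 1
      have : r ^ (2 : ℝ) = r ^ 2 := Real.rpow_natCast r 2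
      rw [this]
      field_simp
    · rw [indicator_of_notMem hm, indicator_of_notMem (fun h => hm (hiff.1 h))]
      simp
  rw [setLIntegral_congr_fun measurableSet_Ioi h1, lintegral_const_mul _
    (Measurable.indicator (by fun_prop) measurableSet_Iio), lintegral_indicator measurableSet_Iio,
    Measure.restrict_restrict measurableSet_Iio, Iio_inter_Ioi, lintegral_Ioo_ofReal_id hb0,
    ← ENNReal.ofReal_mul (by positivity), ← ENNReal.ofReal_mul (by positivity),
    Real.rpow_sub hn, Real.rpow_natCast]
  congr 1
  have : ‖z‖ ^ (2 : ℝ) = ‖z‖ ^ 2 := Real.rpow_natCast _ 2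
  -- The weight `‖z‖^{d+2}` is chosen for this cancellation: it absorbs `‖z‖^{2-d}` and the factor
  -- `‖z‖^{-4}` in `b²`.
  rw [this, hb, hA, pow_add]
  field_simp

/-- Averaging over `z` and `-z` cancels the cross term with the square root and leaves a quadratic
form in `z`, whose integral is known from the second moments. -/
lemma integral_ball_sqrt_sub_sq (hd : 0 < d) (x : 𝔼) {a D : ℝ} (ha : 0 < a) (hD : 0 < D) :
    IntegrableOn (fun z : 𝔼 =>
      (√(inner ℝ x z ^ 2 + a * ‖z‖ ^ 2 * D) - inner ℝ x z) ^ 2 / (2 * a ^ 2)) (Metric.ball 0 1) ∧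
    ∫ z in Metric.ball (0 : 𝔼) 1,
      (√(inner ℝ x z ^ 2 + a * ‖z‖ ^ 2 * D) - inner ℝ x z) ^ 2 / (2 * a ^ 2) =
      1 / (d + 2) * ((2 * ‖x‖ ^ 2 + a * D * d) / (2 * a ^ 2) *
        volume.real (Metric.ball (0 : 𝔼) 1)) := by
  have hint : ∀ f : 𝔼 → ℝ, Continuous f → IntegrableOn f (Metric.ball 0 1) := fun f hf =>
    (hf.continuousOn.integrableOn_compact (isCompact_closedBall 0 1)).mono_set
      Metric.ball_subset_closedBall
  refine ⟨hint _ (by fun_prop), ?_⟩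
  set F : 𝔼 → ℝ := fun z =>
    (√(inner ℝ x z ^ 2 + a * ‖z‖ ^ 2 * D) - inner ℝ x z) ^ 2 / (2 * a ^ 2) with hF
  have hneg : ∫ z in Metric.ball (0 : 𝔼) 1, F (-z) = ∫ z in Metric.ball (0 : 𝔼) 1, F z := by
    have hpre : (Neg.neg : 𝔼 → 𝔼) ⁻¹' Metric.ball (0 : 𝔼) 1 = Metric.ball 0 1 := by
      ext z; simp
    have := (Measure.measurePreserving_neg (volume : Measure 𝔼)).setIntegral_preimage_emb
      (Homeomorph.neg 𝔼).measurableEmbedding F (Metric.ball 0 1)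
    rwa [hpre] at this
  have hsum : ∀ z : 𝔼, F z + F (-z) =
      (2 * inner ℝ x z ^ 2 + a * D * ‖z‖ ^ 2) / a ^ 2 := by
    intro z
    have hS := Real.sq_sqrt (show 0 ≤ (inner ℝ x z : ℝ) ^ 2 + a * ‖z‖ ^ 2 * D by positivity)
    simp only [hF, inner_neg_right, norm_neg, neg_sq]
    field_simp
    linear_combination 2 * hS
  have h2 : ∫ z in Metric.ball (0 : 𝔼) 1, (F z + F (-z)) =
      2 * ∫ z in Metric.ball (0 : 𝔼) 1, F z := by
    rw [integral_add (hint _ (by fun_prop)) (hint _ (by fun_prop)), hneg]; ring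
  have h3 : ∫ z in Metric.ball (0 : 𝔼) 1, (F z + F (-z)) =
      (2 * (‖x‖ ^ 2 / (d + 2) * volume.real (Metric.ball (0 : 𝔼) 1)) +
        a * D * (d / (d + 2) * volume.real (Metric.ball (0 : 𝔼) 1))) / a ^ 2 := by
    simp_rw [hsum]
    rw [integral_div, integral_add (hint _ (by fun_prop)) (hint _ (by fun_prop)),
      integral_const_mul, integral_const_mul, integral_ball_inner_sq hd, integral_ball_norm_sq hd]
  have h4 := h2.symm.trans h3
  have : ∫ z in Metric.ball (0 : 𝔼) 1, F z = (2 * (‖x‖ ^ 2 / (d + 2) *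
    volume.real (Metric.ball (0 : 𝔼) 1)) +
        a * D * (d / (d + 2) * volume.real (Metric.ball (0 : 𝔼) 1))) / a ^ 2 / 2 := by linarith
  rw [this]
  field_simp

/-- The Newtonian potential of a ball (up to the constant), in the interior of the ball. -/
lemma lintegral_newton_ball (hd : 0 < d) (x : 𝔼) {a D : ℝ} (ha : 0 < a) (hD : 0 < D) :
    ∫⁻ z in {z : 𝔼 | a * ‖z‖ ^ 2 + 2 * inner ℝ x z < D}, ENNReal.ofReal (‖z‖ ^ (2 - d : ℝ)) =
      ENNReal.ofReal ((2 * ‖x‖ ^ 2 + a * D * d) / (2 * a ^ 2) *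
        volume.real (Metric.ball (0 : 𝔼) 1)) := by
  have : Nonempty (Fin d) := ⟨⟨0, hd⟩⟩
  have hms : MeasurableSet {z : 𝔼 | a * ‖z‖ ^ 2 + 2 * inner ℝ x z < D} :=
    measurableSet_lt (by fun_prop) (by fun_prop)
  have hpol := lintegral_eq_lintegral_ball_lintegral_ray hd
    ({z : 𝔼 | a * ‖z‖ ^ 2 + 2 * inner ℝ x z < D}.indicator
        (fun z => ENNReal.ofReal (‖z‖ ^ (2 - d : ℝ)))) (Measurable.indicator (by fun_prop) hms)
  have h0 : ∀ᵐ z : 𝔼, z ≠ 0 := by simp [ae_iff, measure_singleton]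
  obtain ⟨hi, hv⟩ := integral_ball_sqrt_sub_sq hd x ha hD
  rw [lintegral_indicator hms, lintegral_congr_ae ((ae_restrict_of_ae h0).mono
    fun z hz => lintegral_ray_newton x z hz ha hD), ← ofReal_integral_eq_lintegral_ofReal hi
      (ae_of_all _ fun z => by positivity), hv, ENNReal.ofReal_mul (by positivity)] at hpol
  exact (ENNReal.mul_right_inj (by simp; positivity) ENNReal.ofReal_ne_top).1 hpol

/-! ### The potential for power kernels: layers and beta integrals -/

/-- Euler's beta integral on the half-line. -/
lemma lintegral_beta {q s : ℝ} (hq : 0 < q) (hs : q < s) :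
    ∫⁻ v in Ioi (0 : ℝ), ENNReal.ofReal (v ^ (q - 1) * (1 + v) ^ (-s)) =
      ENNReal.ofReal (Real.Gamma q * Real.Gamma (s - q) / Real.Gamma s) := by
  have hs0 : 0 < s := hq.trans hs
  have hG {a r : ℝ} (ha : 0 < a) (hr : 0 < r) :
      ∫⁻ t in Ioi (0 : ℝ), ENNReal.ofReal (t ^ (a - 1) * Real.exp (-(r * t))) =
        ENNReal.ofReal ((1 / r) ^ a * Real.Gamma a) := by
    rw [← Real.integral_rpow_mul_exp_neg_mul_Ioi ha hr, ofReal_integral_eq_lintegral_ofReal]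
    -- Without integrability the Bochner integral would be `0`, against its positive value.
    · by_contra h
      have h1 := Real.integral_rpow_mul_exp_neg_mul_Ioi ha hr
      rw [integral_undef h] at h1
      have : 0 < (1 / r) ^ a * Real.Gamma a := mul_pos (by positivity) (Real.Gamma_pos_of_pos ha)
      linarith
    · exact (ae_restrict_mem measurableSet_Ioi).mono fun t (ht : 0 < t) => by
        simp only [Pi.zero_apply]; positivity
  have hGs := Real.Gamma_pos_of_pos hs0
  have hGq := Real.Gamma_pos_of_pos hq
  -- `Γ(s)(1+v)^{-s}` is written as `∫ t^{s-1} e^{-(1+v)t} dt`; after exchanging the integrals both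
  -- are Gamma integrals.
  have key : ENNReal.ofReal (Real.Gamma s) *
      ∫⁻ v in Ioi (0 : ℝ), ENNReal.ofReal (v ^ (q - 1) * (1 + v) ^ (-s)) =
      ENNReal.ofReal (Real.Gamma q) * ENNReal.ofReal (Real.Gamma (s - q)) := by
    rw [← lintegral_const_mul _ (by fun_prop)]
    calc _ = ∫⁻ v in Ioi (0 : ℝ), ∫⁻ t in Ioi (0 : ℝ),
          ENNReal.ofReal (v ^ (q - 1) * (t ^ (s - 1) * Real.exp (-((1 + v) * t)))) := by
          refine setLIntegral_congr_fun measurableSet_Ioi fun v (hv : 0 < v) => ?_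
          simp_rw [ENNReal.ofReal_mul (show 0 ≤ v ^ (q - 1) by positivity)]
          rw [lintegral_const_mul _ (by fun_prop), hG hs0 (by positivity),
            ENNReal.ofReal_mul (by positivity), one_div, Real.inv_rpow (by positivity),
            ← Real.rpow_neg (by positivity)]
          ring
      _ = ∫⁻ t in Ioi (0 : ℝ), ∫⁻ v in Ioi (0 : ℝ),
          ENNReal.ofReal (v ^ (q - 1) * (t ^ (s - 1) * Real.exp (-((1 + v) * t)))) :=
          lintegral_lintegral_swap (Measurable.aemeasurable (by fun_prop))
      _ = ∫⁻ t in Ioi (0 : ℝ), ENNReal.ofReal (Real.Gamma q) *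
            ENNReal.ofReal (t ^ (s - q - 1) * Real.exp (-(1 * t))) := by
          refine setLIntegral_congr_fun measurableSet_Ioi fun t (ht : 0 < t) => ?_
          have : ∀ v : ℝ, v ^ (q - 1) * (t ^ (s - 1) * Real.exp (-((1 + v) * t))) =
              (t ^ (s - 1) * Real.exp (-t)) * (v ^ (q - 1) * Real.exp (-(t * v))) := by
            intro v
            rw [show -((1 + v) * t) = -t + -(t * v) by ring, Real.exp_add]; ring
          simp_rw [this, ENNReal.ofReal_mul (show 0 ≤ t ^ (s - 1) * Real.exp (-t) by positivity)]
          rw [lintegral_const_mul _ (by fun_prop), hG hq ht, ← ENNReal.ofReal_mul (by positivity),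
            ← ENNReal.ofReal_mul hGq.le]
          congr 1
          rw [show s - q - 1 = s - 1 + -q by ring, Real.rpow_add ht, one_div, Real.inv_rpow ht.le,
            ← Real.rpow_neg ht.le, one_mul]
          ring
      _ = _ := by
          rw [lintegral_const_mul _ (by fun_prop), hG (sub_pos.2 hs) one_pos]
          simp
  rw [← ENNReal.ofReal_mul hGq.le] at key
  rw [ENNReal.ofReal_div_of_pos hGs, ← key, ENNReal.mul_div_right_comm, ENNReal.div_self]
  · simp
  · simpa using hGs
  · exact ENNReal.ofReal_ne_top

/-- The function `(ρ² - |x|²)_+^{α/2}`. -/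
def ballPower (α ρ : ℝ) (x : 𝔼) : ℝ := (max (ρ ^ 2 - ‖x‖ ^ 2) 0) ^ (α / 2)

lemma ballPower_nonneg (α ρ : ℝ) (x : 𝔼) : 0 ≤ ballPower α ρ x :=
  Real.rpow_nonneg (le_max_right _ _) _

/-- For `z ≠ 0` the inequality clears to `(1 + v)‖z‖² + 2⟨x, z⟩ < D`: a ball containing the origin,
so `lintegral_newton_ball` applies with `a = 1 + v`. -/
lemma lintegral_newton_superlevel (hd : 0 < d) {x : 𝔼} {D : ℝ} (hD : 0 < D) {v : ℝ} (hv : 0 < v) :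
    (volume.withDensity fun z : 𝔼 => ENNReal.ofReal (‖z‖ ^ (2 - d : ℝ)))
      {z | v < max ((D - 2 * inner ℝ x z - ‖z‖ ^ 2) / ‖z‖ ^ 2) 0} =
    ENNReal.ofReal ((2 * ‖x‖ ^ 2 + (1 + v) * D * d) / (2 * (1 + v) ^ 2) *
        volume.real (Metric.ball (0 : 𝔼) 1)) := by
  have : Nonempty (Fin d) := ⟨⟨0, hd⟩⟩
  rw [← lintegral_newton_ball hd x (by positivity : 0 < 1 + v) hD, withDensity_apply]
  · refine setLIntegral_congr ?_
    have h0 : ∀ᵐ z : 𝔼, z ≠ 0 := by simp [ae_iff, measure_singleton]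
    filter_upwards [h0] with z hz
    have hn : 0 < ‖z‖ ^ 2 := by have := norm_pos_iff.2 hz; positivity
    refine propext ?_
    change v < max ((D - 2 * inner ℝ x z - ‖z‖ ^ 2) / ‖z‖ ^ 2) 0 ↔
      (1 + v) * ‖z‖ ^ 2 + 2 * inner ℝ x z < D
    rw [lt_max_iff, or_iff_left hv.not_gt, lt_div_iff₀ hn]
    constructor <;> intro h <;> linarith
  · exact measurableSet_lt (by fun_prop) (by fun_prop)

/-- The layer measure splits into multiples of `(1+v)^{-2}` and `(1+v)^{-1}`, giving beta integrals
with `s = 2` and `s = 1`; the second converges because `q < 1`. -/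
lemma lintegral_newton_layers (hd : 0 < d) {q D : ℝ} (hq : 0 < q) (hq1 : q < 1) (x : 𝔼)
    (hD : 0 < D) :
    ENNReal.ofReal q * ∫⁻ v in Ioi (0 : ℝ), ENNReal.ofReal
      ((2 * ‖x‖ ^ 2 + (1 + v) * D * d) / (2 * (1 + v) ^ 2) *
        volume.real (Metric.ball (0 : 𝔼) 1)) * ENNReal.ofReal (v ^ (q - 1)) =
    ENNReal.ofReal (volume.real (Metric.ball (0 : 𝔼) 1) / 2 * Real.Gamma (1 + q) *
      Real.Gamma (1 - q) * (d * D + (2 - 2 * q) * ‖x‖ ^ 2)) := by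
  set vol := volume.real (Metric.ball (0 : 𝔼) 1)
  have hvol : 0 ≤ vol := measureReal_nonneg
  have h1 : ∀ v ∈ Ioi (0 : ℝ), ENNReal.ofReal
      ((2 * ‖x‖ ^ 2 + (1 + v) * D * d) / (2 * (1 + v) ^ 2) * vol) * ENNReal.ofReal (v ^ (q - 1)) =
      ENNReal.ofReal (vol * ‖x‖ ^ 2) * ENNReal.ofReal (v ^ (q - 1) * (1 + v) ^ (-2 : ℝ)) +
      ENNReal.ofReal (vol * D * d / 2) * ENNReal.ofReal (v ^ (q - 1) * (1 + v) ^ (-1 : ℝ)) := by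
    intro v (hv : 0 < v)
    have hv1 : 0 < 1 + v := by linarith
    have e2 : (1 + v) ^ (-2 : ℝ) = ((1 + v) ^ 2)⁻¹ := by
      rw [Real.rpow_neg hv1.le]; congr 1; exact Real.rpow_natCast _ 2
    rw [← ENNReal.ofReal_mul (by positivity), ← ENNReal.ofReal_mul (by positivity),
      ← ENNReal.ofReal_mul (by positivity), ← ENNReal.ofReal_add (by positivity) (by positivity),
      e2, Real.rpow_neg_one]
    congr 1
    field_simp
  have g1 : 0 < Real.Gamma q := Real.Gamma_pos_of_pos hq
  have g2 : 0 < Real.Gamma (1 - q) := Real.Gamma_pos_of_pos (by linarith)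
  have e3 : Real.Gamma (2 - q) = (1 - q) * Real.Gamma (1 - q) := by
    rw [← Real.Gamma_add_one (by linarith)]; congr 1; ring
  have e4 : Real.Gamma (1 + q) = q * Real.Gamma q := by
    rw [← Real.Gamma_add_one hq.ne', add_comm]
  have hq' : 0 < 1 - q := by linarith
  rw [setLIntegral_congr_fun measurableSet_Ioi h1, lintegral_add_left (by fun_prop),
    lintegral_const_mul _ (by fun_prop), lintegral_const_mul _ (by fun_prop),
    lintegral_beta hq (by linarith), lintegral_beta hq hq1, e3, e4, Real.Gamma_two, Real.Gamma_one,
    ← ENNReal.ofReal_mul (by positivity), ← ENNReal.ofReal_mul (by positivity),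
    ← ENNReal.ofReal_add (by positivity) (by positivity), ← ENNReal.ofReal_mul (by positivity)]
  congr 1
  ring

/-- The Riesz potential of `(ρ² - |x|²)_+^q` of order `2 - 2q` in the interior of the ball. -/
lemma lintegral_norm_rpow_mul_ballPower (hd : 0 < d) {q ρ : ℝ} (hq : 0 < q) (hq1 : q < 1)
    {x : 𝔼} (hx : ‖x‖ < ρ) :
    ∫⁻ z : 𝔼, ENNReal.ofReal (‖z‖ ^ (2 - 2 * q - d) * ballPower (2 * q) ρ (x + z)) =
      ENNReal.ofReal (volume.real (Metric.ball (0 : 𝔼) 1) / 2 * Real.Gamma (1 + q) *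
        Real.Gamma (1 - q) * (d * ρ ^ 2 - (d - 2 + 2 * q) * ‖x‖ ^ 2)) := by
  have : Nonempty (Fin d) := ⟨⟨0, hd⟩⟩
  have hρ : 0 < ρ := (norm_nonneg x).trans_lt hx
  set D := ρ ^ 2 - ‖x‖ ^ 2 with hDdef
  have hD : 0 < D := by have := norm_nonneg x; nlinarith
  -- Extracting `‖z‖²` from `ρ² - ‖x + z‖²` leaves the weight `‖z‖^{2-2q-d} ‖z‖^{2q} = ‖z‖^{2-d}`,
  -- which no longer depends on `q`.
  set μ := (volume.withDensity fun z : 𝔼 => ENNReal.ofReal (‖z‖ ^ (2 - d : ℝ)))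
  set g : 𝔼 → ℝ := fun z => max ((D - 2 * inner ℝ x z - ‖z‖ ^ 2) / ‖z‖ ^ 2) 0 with hg
  have hgm : Measurable g := by fun_prop
  have h0 : ∀ᵐ z : 𝔼, z ≠ 0 := by simp [ae_iff, measure_singleton]
  have h1 : ∫⁻ z : 𝔼, ENNReal.ofReal (‖z‖ ^ (2 - 2 * q - d) * ballPower (2 * q) ρ (x + z)) =
      ∫⁻ z, ENNReal.ofReal (g z ^ q) ∂μ := by
    rw [lintegral_withDensity_eq_lintegral_mul _ (by fun_prop) (by fun_prop)]
    refine lintegral_congr_ae (h0.mono fun z hz => ?_)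
    have hn : 0 < ‖z‖ := norm_pos_iff.2 hz
    simp only [Pi.mul_apply]
    rw [← ENNReal.ofReal_mul (by positivity)]
    congr 1
    have e1 : max (ρ ^ 2 - ‖x + z‖ ^ 2) 0 = ‖z‖ ^ 2 * g z := by
      rw [hg, mul_max_of_nonneg _ _ (by positivity), mul_zero, mul_div_cancel₀ _ (by positivity),
        hDdef, norm_add_sq_real]
      congr 1; ring
    have e2 : (‖z‖ ^ 2) ^ q = ‖z‖ ^ (2 * q) := by
      rw [Real.rpow_mul hn.le]; congr 1; exact (Real.rpow_natCast _ 2).symm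
    rw [ballPower, show 2 * q / 2 = q by ring, e1, Real.mul_rpow (by positivity)
      (le_max_right _ _), e2, ← mul_assoc, ← Real.rpow_add hn]
    congr 2
    ring
  have hg0 : 0 ≤ᵐ[μ] g := ae_of_all _ fun z => le_max_right _ _
  rw [h1, lintegral_rpow_eq_lintegral_meas_lt_mul μ hg0 hgm.aemeasurable hq, setLIntegral_congr_fun measurableSet_Ioi fun v hv => by
      simp only [hg]; rw [lintegral_newton_superlevel hd hD hv]]
  rw [lintegral_newton_layers hd hq hq1 x hD]
  congr 2
  rw [hDdef]; ring

lemma measurable_ballPower (α ρ : ℝ) : Measurable (ballPower α ρ : 𝔼 → ℝ) := by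
  unfold ballPower; fun_prop

lemma integrable_integral_norm_rpow_mul_ballPower (hd : 0 < d) {α ρ : ℝ} (hα : 0 < α) (hα2 : α < 2)
    {x : 𝔼} (hx : ‖x‖ < ρ) :
    Integrable (fun z : 𝔼 => ‖z‖ ^ (2 - α - d) * ballPower α ρ (x + z)) ∧
    ∫ z : 𝔼, ‖z‖ ^ (2 - α - d) * ballPower α ρ (x + z) =
      volume.real (Metric.ball (0 : 𝔼) 1) / 2 * Real.Gamma (1 + α / 2) *
        Real.Gamma (1 - α / 2) * (d * ρ ^ 2 - (d - 2 + α) * ‖x‖ ^ 2) := by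
  have h := lintegral_norm_rpow_mul_ballPower hd (q := α / 2) (by linarith) (by linarith) hx
  rw [show 2 * (α / 2) = α by ring] at h
  have hm : Measurable fun z : 𝔼 => ‖z‖ ^ (2 - α - d) * ballPower α ρ (x + z) :=
    Measurable.mul (by fun_prop) ((measurable_ballPower α ρ).comp (by fun_prop))
  have hnn : ∀ z : 𝔼, 0 ≤ ‖z‖ ^ (2 - α - d) * ballPower α ρ (x + z) := fun z =>
    mul_nonneg (by positivity) (ballPower_nonneg _ _ _)
  have hρ : 0 < ρ := (norm_nonneg x).trans_lt hx
  have hpos : 0 ≤ volume.real (Metric.ball (0 : 𝔼) 1) / 2 * Real.Gamma (1 + α / 2) *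
        Real.Gamma (1 - α / 2) * (d * ρ ^ 2 - (d - 2 + α) * ‖x‖ ^ 2) := by
    have h1 := (Real.Gamma_pos_of_pos (show 0 < 1 + α / 2 by linarith)).le
    have h2 := (Real.Gamma_pos_of_pos (show 0 < 1 - α / 2 by linarith)).le
    have h3 : 0 ≤ d * ρ ^ 2 - (d - 2 + α) * ‖x‖ ^ 2 := by
      have : ‖x‖ ^ 2 ≤ ρ ^ 2 := by gcongr
      have hd' : (0 : ℝ) ≤ d := d.cast_nonneg
      nlinarith [sq_nonneg ‖x‖]
    exact mul_nonneg (mul_nonneg (mul_nonneg (by positivity) h1) h2) h3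
  refine ⟨⟨hm.aestronglyMeasurable, ?_⟩, ?_⟩
  · rw [hasFiniteIntegral_iff_ofReal (ae_of_all _ hnn), h]
    exact ENNReal.ofReal_lt_top
  · rw [integral_eq_lintegral_of_nonneg_ae (ae_of_all _ hnn) hm.aestronglyMeasurable, h,
      ENNReal.toReal_ofReal hpos]

lemma volume_real_unit_ball (hd : 0 < d) : volume.real (Metric.ball (0 : 𝔼) 1) =
    Real.pi ^ ((d : ℝ) / 2) / Real.Gamma ((d : ℝ) / 2 + 1) := by
  have : Nonempty (Fin d) := ⟨⟨0, hd⟩⟩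
  rw [Measure.real, EuclideanSpace.volume_ball, ENNReal.ofReal_one, one_pow, one_mul,
    ENNReal.toReal_ofReal (by positivity), Fintype.card_fin, Real.sqrt_eq_rpow, ← Real.rpow_natCast,
    ← Real.rpow_mul Real.pi_pos.le]
  congr 2
  ring

/-- In the nonlogarithmic case the potential is quadratic in the ball. -/
lemma rieszPotential_ballPower_of_ne (hd : 0 < d) {α m ρ : ℝ} (hα : 0 < α) (hα2 : α < 2)
    (hm : 1 < m) (hne : 2 - α ≠ d) : ∃ A : ℝ, ∀ x : 𝔼, ‖x‖ < ρ →
      rieszPotential (2 - α) (ballPower α ρ) x =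
        A - selfSimExponent d α m / (2 * barenblattConst d α m) * ‖x‖ ^ 2 := by
  refine ⟨Real.Gamma (((d : ℝ) - (2 - α)) / 2) / (2 ^ (2 - α) * Real.pi ^ ((d : ℝ) / 2) *
    Real.Gamma ((2 - α) / 2)) * (volume.real (Metric.ball (0 : 𝔼) 1) / 2 * Real.Gamma (1 + α / 2) *
        Real.Gamma (1 - α / 2) * (d * ρ ^ 2)), fun x hx => ?_⟩
  have h := (integrable_integral_norm_rpow_mul_ballPower hd hα hα2 hx).2
  rw [rieszPotential, if_neg (by linarith)]
  simp only [rieszKernel, if_neg hne]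
  rw [integral_congr_ae (ae_of_all _ fun z => mul_assoc _ _ _), integral_const_mul, h, volume_real_unit_ball hd]
  have hd' : (0 : ℝ) < d := by exact_mod_cast hd
  -- The factor `d - 2 + α` of the quadratic term is absorbed into the kernel constant. The
  -- functional equation needs only a nonzero argument, so the negative constant for `d = 1 < 2 - α`
  -- is covered.
  have e1 : Real.Gamma (((d : ℝ) - (2 - α)) / 2 + 1) =
      ((d : ℝ) - (2 - α)) / 2 * Real.Gamma (((d : ℝ) - (2 - α)) / 2) :=
    Real.Gamma_add_one (by intro h; apply hne; linarith)
  have e2 : Real.Gamma ((d : ℝ) / 2 + 1) = (d : ℝ) / 2 * Real.Gamma ((d : ℝ) / 2) :=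
    Real.Gamma_add_one (by positivity)
  have e3 : ((d : ℝ) - (2 - α)) / 2 + 1 = ((d : ℝ) + α) / 2 := by ring
  rw [e3] at e1
  have p1 := Real.Gamma_pos_of_pos (show 0 < (d : ℝ) / 2 by positivity)
  have p2 := Real.Gamma_pos_of_pos (show 0 < 1 + α / 2 by linarith)
  have p3 := Real.Gamma_pos_of_pos (show 0 < 1 - α / 2 by linarith)
  have p4 := Real.Gamma_pos_of_pos (show 0 < ((d : ℝ) + α) / 2 by positivity)
  have e5 : (2 - α) / 2 = 1 - α / 2 := by ring
  have e6 : (2 : ℝ) ^ (2 - α) = 4 / 2 ^ α := by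
    rw [Real.rpow_sub two_pos]; norm_num
  have hden : 0 < (d : ℝ) * (m - 1) + α := by
    have : 0 < (d : ℝ) * (m - 1) := mul_pos hd' (by linarith)
    linarith
  rw [selfSimExponent, barenblattConst, e2, e5, e6, e1]
  have hnz : ((d : ℝ) - (2 - α)) ≠ 0 := fun h => hne (by linarith)
  have hG : Real.Gamma (((d : ℝ) - (2 - α)) / 2) ≠ 0 := by
    intro h0; rw [h0, mul_zero] at e1; exact p4.ne' e1
  have hpi : 0 < Real.pi ^ ((d : ℝ) / 2) := by positivity
  have h2a : (0 : ℝ) < 2 ^ α := by positivity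
  generalize Real.Gamma (((d : ℝ) - (2 - α)) / 2) = G at *
  generalize Real.Gamma ((d : ℝ) / 2) = G1 at *
  generalize Real.Gamma (1 + α / 2) = G2 at *
  generalize Real.Gamma (1 - α / 2) = G3 at *
  generalize Real.pi ^ ((d : ℝ) / 2) = P at *
  generalize (2 : ℝ) ^ α = T at *
  field_simp
  ring

/-! ### Local integrability of the kernels and the logarithmic case -/

lemma abs_log_le_rpow {t : ℝ} (ht : 0 < t) :
    |Real.log t| ≤ 2 * t ^ (1 / 2 : ℝ) + 2 * t ^ (-(1 / 2) : ℝ) := by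
  have h1 := Real.log_le_rpow_div ht.le (ε := 1 / 2) (by norm_num)
  have h2 := Real.log_le_rpow_div (inv_pos.2 ht).le (ε := 1 / 2) (by norm_num)
  rw [Real.log_inv, Real.inv_rpow ht.le, ← Real.rpow_neg ht.le] at h2
  have p1 : 0 ≤ t ^ (1 / 2 : ℝ) := by positivity
  have p2 : 0 ≤ t ^ (-(1 / 2) : ℝ) := by positivity
  rw [abs_le]
  constructor <;> linarith

lemma locallyIntegrable_log_norm (hd : 0 < d) :
    LocallyIntegrable fun z : 𝔼 => Real.log ‖z‖ := by
  rw [locallyIntegrable_iff]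
  intro K hK
  obtain ⟨r, hr0, hr⟩ := hK.isBounded.exists_pos_norm_lt
  have : Nonempty (Fin d) := ⟨⟨0, hd⟩⟩
  have h0 : ∀ᵐ z : 𝔼, z ≠ 0 := by simp [ae_iff, measure_singleton]
  refine (integrableOn_ball_of_norm_le_rpow (C := 2 * r + 2) (α := 1 / 2) (r := r) ?_ ?_ ?_
    (Real.measurable_log.comp measurable_norm).aestronglyMeasurable).mono_set fun z hz => mem_ball_zero_iff.2 (hr z hz)
  · rw [finrank_euclideanSpace_fin]; exact hd
  · rw [finrank_euclideanSpace_fin]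
    have : (1 : ℝ) ≤ d := by exact_mod_cast hd
    linarith
  · filter_upwards [ae_restrict_mem Metric.isOpen_ball.measurableSet, ae_restrict_of_ae h0]
      with z hz hz0
    have hn : 0 < ‖z‖ := norm_pos_iff.2 hz0
    have hzr : ‖z‖ < r := mem_ball_zero_iff.1 hz
    refine (abs_log_le_rpow hn).trans ?_
    have : ‖z‖ ^ (1 / 2 : ℝ) = ‖z‖ * ‖z‖ ^ (-(1 / 2) : ℝ) := by
      rw [← Real.rpow_one_add' hn.le (by norm_num)]; norm_num
    have p2 : 0 ≤ ‖z‖ ^ (-(1 / 2) : ℝ) := by positivity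
    rw [this]
    nlinarith [mul_le_mul_of_nonneg_right hzr.le p2]

lemma locallyIntegrable_rieszKernel (hd : 0 < d) {β : ℝ} (hβ : 0 < β) :
    LocallyIntegrable (rieszKernel β : 𝔼 → ℝ) := by
  by_cases h : β = d
  · rw [locallyIntegrable_iff]
    intro K hK
    have hk : (rieszKernel β : 𝔼 → ℝ) = fun z =>
        -(2 / (2 ^ (d : ℝ) * Real.pi ^ ((d : ℝ) / 2) * Real.Gamma ((d : ℝ) / 2))) *
          Real.log ‖z‖ := by
      funext z; simp only [rieszKernel, if_pos h]
    rw [hk]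
    exact ((locallyIntegrable_log_norm hd).integrableOn_isCompact hK).const_mul _
  · refine locallyIntegrable_of_norm_le_rpow
      (C := |Real.Gamma (((d : ℝ) - β) / 2) /
        (2 ^ β * Real.pi ^ ((d : ℝ) / 2) * Real.Gamma (β / 2))|) (α := d - β) ?_ ?_ ?_ ?_
    · rw [finrank_euclideanSpace_fin]; exact hd
    · rw [finrank_euclideanSpace_fin]; linarith
    · refine ae_of_all _ fun z => le_of_eq ?_
      rw [rieszKernel, if_neg h, norm_mul, Real.norm_eq_abs, Real.norm_of_nonneg (by positivity),
        neg_sub]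
    · have : (rieszKernel β : 𝔼 → ℝ) = fun z => Real.Gamma (((d : ℝ) - β) / 2) /
          (2 ^ β * Real.pi ^ ((d : ℝ) / 2) * Real.Gamma (β / 2)) * ‖z‖ ^ (β - (d : ℝ)) := by
        ext z; simp [rieszKernel, h]
      rw [this]
      exact Measurable.aestronglyMeasurable (by fun_prop)

lemma integrable_mul_comp_add {κ w : 𝔼 → ℝ} (hκ : LocallyIntegrable κ) (hw : Measurable w)
    {C r : ℝ} (hb : ∀ y, |w y| ≤ C) (hs : ∀ y, r < ‖y‖ → w y = 0) (x : 𝔼) :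
    Integrable fun z => κ z * w (x + z) := by
  have h1 : IntegrableOn (fun z => κ z * w (x + z)) (Metric.closedBall 0 (r + ‖x‖)) :=
    (hκ.integrableOn_isCompact (isCompact_closedBall _ _)).mul_bdd (c := C)
      (hw.comp (measurable_const_add x)).aestronglyMeasurable (ae_of_all _ fun z => hb _)
  refine (integrableOn_iff_integrable_of_support_subset fun z hz => ?_).1 h1
  rw [mem_closedBall_zero_iff]
  by_contra hc
  refine hz ?_
  have : r < ‖x + z‖ := by
    have := norm_sub_le (x + z) x
    rw [add_sub_cancel_left] at this
    linarith
  simp [hs _ this]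

/-- A bound uniform in `γ`, for dominated convergence as `γ → 0`: Bernoulli bounds the quotient
above by `t - 1`, and `1 + s ≤ e^s` bounds it below by `log t`. -/
lemma abs_rpow_sub_one_div_le {t γ : ℝ} (ht : 0 < t) (hγ : 0 < γ) (hγ1 : γ ≤ 1) :
    |(t ^ γ - 1) / γ| ≤ |Real.log t| + t := by
  have h1 : t ^ γ ≤ 1 + γ * (t - 1) := by
    have := rpow_one_add_le_one_add_mul_self (s := t - 1) (by linarith) hγ.le hγ1
    simpa using this
  have h2 : 1 + γ * Real.log t ≤ t ^ γ := by
    rw [Real.rpow_def_of_pos ht]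
    have := Real.add_one_le_exp (Real.log t * γ)
    linarith
  rw [abs_le]
  constructor
  · rw [le_div_iff₀ hγ]
    have := neg_abs_le (Real.log t)
    nlinarith
  · rw [div_le_iff₀ hγ]
    have := abs_nonneg (Real.log t)
    nlinarith

lemma tendsto_rpow_sub_one_div {t : ℝ} (ht : 0 < t) {γ : ℕ → ℝ} (hγ0 : ∀ n, 0 < γ n)
    (hγ : Tendsto γ atTop (𝓝 0)) :
    Tendsto (fun n => (t ^ γ n - 1) / γ n) atTop (𝓝 (Real.log t)) := by
  have h := (Real.hasStrictDerivAt_const_rpow ht 0).hasDerivAt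
  rw [hasDerivAt_iff_tendsto_slope] at h
  have h2 : Tendsto γ atTop (𝓝[≠] 0) :=
    tendsto_nhdsWithin_iff.2 ⟨hγ, Eventually.of_forall fun n => (hγ0 n).ne'⟩
  have h3 := h.comp h2
  simp only [Real.rpow_zero, one_mul] at h3
  refine h3.congr fun n => ?_
  simp [slope_def_field]

lemma ballPower_eq_zero {α ρ : ℝ} (hα : 0 < α) (hρ : 0 < ρ) {y : 𝔼} (hy : ρ ≤ ‖y‖) :
    ballPower α ρ y = 0 := by
  have : ρ ^ 2 - ‖y‖ ^ 2 ≤ 0 := by nlinarith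
  rw [ballPower, max_eq_right this, Real.zero_rpow (by linarith)]

lemma ballPower_le {α ρ : ℝ} (hα : 0 < α) (hα2 : α ≤ 2) (y : 𝔼) :
    ballPower α ρ y ≤ ρ ^ 2 + 1 := by
  have h1 : max (ρ ^ 2 - ‖y‖ ^ 2) 0 ≤ ρ ^ 2 + 1 :=
    max_le (by nlinarith [sq_nonneg ‖y‖]) (by positivity)
  calc ballPower α ρ y ≤ (ρ ^ 2 + 1) ^ (α / 2) :=
        Real.rpow_le_rpow (le_max_right _ _) h1 (by linarith)
    _ ≤ (ρ ^ 2 + 1) ^ (1 : ℝ) :=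
        Real.rpow_le_rpow_of_exponent_le (by nlinarith [sq_nonneg ρ]) (by linarith)
    _ = _ := Real.rpow_one _

lemma tendsto_ballPower {ρ : ℝ} {α : ℕ → ℝ} {a : ℝ} (ha : 0 < a)
    (hα : Tendsto α atTop (𝓝 a)) (y : 𝔼) :
    Tendsto (fun n => ballPower (α n) ρ y) atTop (𝓝 (ballPower a ρ y)) := by
  have hc := (Real.continuousAt_const_rpow' (a := max (ρ ^ 2 - ‖y‖ ^ 2) 0) (b := a / 2)
    (by positivity)).tendsto
  exact hc.comp (hα.div_const 2)

/-- The logarithmic potential of `(ρ² - |x|²)_+^{1/2}` in the interior of the interval. -/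
lemma integral_log_mul_ballPower (hd1 : d = 1) {ρ : ℝ} {x : 𝔼} (hx : ‖x‖ < ρ) :
    ∫ y : 𝔼, (Real.log ‖y - x‖ - Real.log ‖y‖) * ballPower 1 ρ y = Real.pi / 2 * ‖x‖ ^ 2 := by
  have hd : 0 < d := by omega
  have hdR : (d : ℝ) = 1 := by exact_mod_cast hd1
  have : Nonempty (Fin d) := ⟨⟨0, hd⟩⟩
  have hρ : 0 < ρ := (norm_nonneg x).trans_lt hx
  -- The shift by `2` keeps `γ n < 1`, so that `1 - γ n` is an admissible order with kernel exponent
  -- `γ n`.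
  set γ : ℕ → ℝ := fun n => 1 / ((n : ℝ) + 2) with hγdef
  have hγ0 : ∀ n, 0 < γ n := fun n => by positivity
  have hγ1 : ∀ n, γ n < 1 := fun n => by
    rw [hγdef, div_lt_one (by positivity)]
    have : (0 : ℝ) ≤ n := n.cast_nonneg
    linarith
  have hγ : Tendsto γ atTop (𝓝 0) :=
    tendsto_const_nhds.div_atTop (tendsto_atTop_add_const_right _ _ tendsto_natCast_atTop_atTop)
  have hJ : ∀ n (x : 𝔼), ‖x‖ < ρ →
      Integrable (fun y : 𝔼 => ‖y - x‖ ^ γ n * ballPower (1 - γ n) ρ y) ∧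
      ∫ y : 𝔼, ‖y - x‖ ^ γ n * ballPower (1 - γ n) ρ y =
        volume.real (Metric.ball (0 : 𝔼) 1) / 2 * Real.Gamma (1 + (1 - γ n) / 2) *
        Real.Gamma (1 - (1 - γ n) / 2) * (ρ ^ 2 + γ n * ‖x‖ ^ 2) := by
    intro n x hx
    obtain ⟨h1, h2⟩ := integrable_integral_norm_rpow_mul_ballPower hd (α := 1 - γ n)
      (by linarith [hγ1 n]) (by linarith [hγ0 n]) hx
    have e1 : 2 - (1 - γ n) - (d : ℝ) = γ n := by rw [hdR]; ring
    rw [e1] at h1 h2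
    have e2 : (fun y : 𝔼 => ‖y - x‖ ^ γ n * ballPower (1 - γ n) ρ y) =
        fun y => (fun z => ‖z‖ ^ γ n * ballPower (1 - γ n) ρ (x + z)) (y - x) := by
      ext y; simp
    refine ⟨by rw [e2]; exact h1.comp_sub_right x, ?_⟩
    rw [e2, integral_sub_right_eq_self (fun z => ‖z‖ ^ γ n * ballPower (1 - γ n) ρ (x + z)), h2,
      hdR]
    ring
  -- Subtracting the value at the origin cancels the `-1/γ` and the `ρ²/γ` terms; only the
  -- coefficient of `γ‖x‖²` survives division by `γ`.
  have hseq : ∀ n, ∫ y : 𝔼, ((‖y - x‖ ^ γ n - 1) / γ n - (‖y‖ ^ γ n - 1) / γ n) *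
      ballPower (1 - γ n) ρ y = volume.real (Metric.ball (0 : 𝔼) 1) / 2 *
        Real.Gamma (1 + (1 - γ n) / 2) * Real.Gamma (1 - (1 - γ n) / 2) * ‖x‖ ^ 2 := by
    intro n
    have e : ∀ y : 𝔼, ((‖y - x‖ ^ γ n - 1) / γ n - (‖y‖ ^ γ n - 1) / γ n) *
        ballPower (1 - γ n) ρ y = (‖y - x‖ ^ γ n * ballPower (1 - γ n) ρ y -
          ‖y - 0‖ ^ γ n * ballPower (1 - γ n) ρ y) / γ n := by
      intro y; rw [sub_zero]; ring
    have h0 := hJ n 0 (by simpa using hρ)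
    simp_rw [e]
    rw [integral_div, integral_sub (hJ n x hx).1 h0.1, (hJ n x hx).2, h0.2, norm_zero]
    have := (hγ0 n).ne'
    field_simp
    ring
  have hlogx : LocallyIntegrable fun y : 𝔼 => Real.log ‖y - x‖ := by
    rw [locallyIntegrable_iff]
    intro K hK
    have hK' : IsCompact ((fun y => y - x) '' K) := hK.image (by fun_prop)
    have h := (locallyIntegrable_iff.1 (locallyIntegrable_log_norm hd)) _ hK'
    have hmp : MeasurePreserving (fun y : 𝔼 => y - x) volume volume :=
      measurePreserving_sub_right volume x
    exact (hmp.integrableOn_image (MeasurableEquiv.subRight x).measurableEmbedding).1 h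
  have hlim : Tendsto (fun n => ∫ y : 𝔼, ((‖y - x‖ ^ γ n - 1) / γ n - (‖y‖ ^ γ n - 1) / γ n) *
      ballPower (1 - γ n) ρ y) atTop
      (𝓝 (∫ y : 𝔼, (Real.log ‖y - x‖ - Real.log ‖y‖) * ballPower 1 ρ y)) := by
    refine tendsto_integral_of_dominated_convergence ((Metric.closedBall 0 ρ).indicator fun y : 𝔼 =>
      (|Real.log ‖y - x‖| + ‖y - x‖ + (|Real.log ‖y‖| + ‖y‖)) * (ρ ^ 2 + 1)) ?_ ?_ ?_ ?_
    · intro n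
      refine Measurable.aestronglyMeasurable (Measurable.mul (by fun_prop) (measurable_ballPower _ _))
    · rw [integrable_indicator_iff Metric.isClosed_closedBall.measurableSet]
      have hK := isCompact_closedBall (0 : 𝔼) ρ
      refine Integrable.mul_const ?_ _
      refine Integrable.add (Integrable.add ?_ ?_) (Integrable.add ?_ ?_)
      · exact (hlogx.integrableOn_isCompact hK).abs
      · exact ContinuousOn.integrableOn_compact hK (by fun_prop)
      · exact ((locallyIntegrable_log_norm hd).integrableOn_isCompact hK).abs
      · exact ContinuousOn.integrableOn_compact hK (by fun_prop)
    · intro n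
      have h0 : ∀ᵐ z : 𝔼, z ≠ 0 := by simp [ae_iff, measure_singleton]
      have h0' : ∀ᵐ z : 𝔼, z ≠ x := by simp [ae_iff, measure_singleton]
      filter_upwards [h0, h0'] with y hy hyx
      have hα : 0 < 1 - γ n := by linarith [hγ1 n]
      by_cases hyb : y ∈ Metric.closedBall (0 : 𝔼) ρ
      · rw [indicator_of_mem hyb, norm_mul, Real.norm_eq_abs,
          Real.norm_of_nonneg (ballPower_nonneg _ _ _)]
        refine mul_le_mul ?_ (ballPower_le hα (by linarith [hγ0 n]) y) (ballPower_nonneg _ _ _)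
          (by positivity)
        refine (abs_sub _ _).trans (add_le_add ?_ ?_)
        · exact abs_rpow_sub_one_div_le (norm_pos_iff.2 (sub_ne_zero.2 hyx)) (hγ0 n) (hγ1 n).le
        · exact abs_rpow_sub_one_div_le (norm_pos_iff.2 hy) (hγ0 n) (hγ1 n).le
      · rw [indicator_of_notMem hyb, ballPower_eq_zero hα hρ (by simpa using
          (not_le.1 fun h => hyb (mem_closedBall_zero_iff.2 h)).le)]
        simp
    · have h0 : ∀ᵐ z : 𝔼, z ≠ 0 := by simp [ae_iff, measure_singleton]
      have h0' : ∀ᵐ z : 𝔼, z ≠ x := by simp [ae_iff, measure_singleton]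
      filter_upwards [h0, h0'] with y hy hyx
      have t1 := tendsto_rpow_sub_one_div (norm_pos_iff.2 (sub_ne_zero.2 hyx)) hγ0 hγ
      have t2 := tendsto_rpow_sub_one_div (norm_pos_iff.2 hy) hγ0 hγ
      have t3 := tendsto_ballPower (ρ := ρ) one_pos
        (by simpa using (tendsto_const_nhds (x := (1 : ℝ))).sub hγ :
          Tendsto (fun n => 1 - γ n) atTop (𝓝 1)) y
      exact (t1.sub t2).mul t3
  have hlim2 : Tendsto (fun n => volume.real (Metric.ball (0 : 𝔼) 1) / 2 *
        Real.Gamma (1 + (1 - γ n) / 2) * Real.Gamma (1 - (1 - γ n) / 2) * ‖x‖ ^ 2) atTop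
      (𝓝 (volume.real (Metric.ball (0 : 𝔼) 1) / 2 *
        Real.Gamma (1 + (1 - 0) / 2) * Real.Gamma (1 - (1 - 0) / 2) * ‖x‖ ^ 2)) := by
    have hc : ∀ s : ℝ, 0 < s → ContinuousAt Real.Gamma s := fun s hs =>
      (Real.differentiableAt_Gamma fun k => by
        have : (0 : ℝ) ≤ k := k.cast_nonneg
        linarith).continuousAt
    have t1 : Tendsto (fun n => 1 + (1 - γ n) / 2) atTop (𝓝 (1 + (1 - 0) / 2)) :=
      ((hγ.const_sub 1).div_const 2).const_add 1
    have t2 : Tendsto (fun n => 1 - (1 - γ n) / 2) atTop (𝓝 (1 - (1 - 0) / 2)) :=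
      ((hγ.const_sub 1).div_const 2).const_sub 1
    exact (((hc _ (by norm_num)).tendsto.comp t1).const_mul _ |>.mul
      ((hc _ (by norm_num)).tendsto.comp t2)).mul_const _
  rw [tendsto_nhds_unique hlim (hlim2.congr fun n => (hseq n).symm), volume_real_unit_ball hd, hdR]
  have e1 : (1 : ℝ) + (1 - 0) / 2 = 1 / 2 + 1 := by norm_num
  have e2 : (1 : ℝ) - (1 - 0) / 2 = 1 / 2 := by norm_num
  have e3 : 0 < Real.Gamma (1 / 2 + 1) := Real.Gamma_pos_of_pos (by norm_num)
  have e4 : Real.pi ^ (1 / 2 : ℝ) * √Real.pi = Real.pi := by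
    rw [← Real.sqrt_eq_rpow, Real.mul_self_sqrt Real.pi_pos.le]
  rw [e1, e2, Real.Gamma_one_half_eq]
  field_simp
  linear_combination ‖x‖ ^ 2 * e4

/-- Here `d = α = 1`, and `A` is the value of the potential at the origin. -/
lemma rieszPotential_ballPower_of_eq (hd : 0 < d) {α m ρ : ℝ} (hα : 0 < α) (hα2 : α < 2)
    (hm : 1 < m) (heq : 2 - α = d) : ∃ A : ℝ, ∀ x : 𝔼, ‖x‖ < ρ →
      rieszPotential (2 - α) (ballPower α ρ) x =
        A - selfSimExponent d α m / (2 * barenblattConst d α m) * ‖x‖ ^ 2 := by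
  have hd1 : d = 1 := by
    have : (d : ℝ) < 2 := by linarith
    have : d < 2 := by exact_mod_cast this
    omega
  have hdR : (d : ℝ) = 1 := by exact_mod_cast hd1
  obtain rfl : α = 1 := by linarith
  have hlog := locallyIntegrable_log_norm hd
  have hint : 0 < ρ → ∀ x : 𝔼,
      Integrable fun y : 𝔼 => Real.log ‖y - x‖ * ballPower 1 ρ y := by
    intro hρ x
    have h1 := integrable_mul_comp_add hlog (measurable_ballPower 1 ρ) (C := ρ ^ 2 + 1) (r := ρ)
      (fun y => by
        rw [abs_of_nonneg (ballPower_nonneg _ _ _)]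
        exact ballPower_le one_pos one_le_two y)
      (fun y hy => ballPower_eq_zero one_pos hρ hy.le) x
    have h2 := h1.comp_sub_right x
    simpa using h2
  set c : ℝ := -(2 / (2 ^ (d : ℝ) * Real.pi ^ ((d : ℝ) / 2) * Real.Gamma ((d : ℝ) / 2))) with hc
  refine ⟨c * ∫ y : 𝔼, Real.log ‖y‖ * ballPower 1 ρ y, fun x hx => ?_⟩
  have hρ : 0 < ρ := (norm_nonneg x).trans_lt hx
  have h := integral_log_mul_ballPower hd1 hx
  simp_rw [sub_mul] at h
  rw [integral_sub (hint hρ x) (by simpa using hint hρ 0)] at h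
  rw [rieszPotential, if_neg (by norm_num)]
  simp only [rieszKernel, if_pos heq]
  rw [integral_congr_ae (ae_of_all _ fun z => mul_assoc _ _ _), integral_const_mul,
    ← integral_sub_right_eq_self (fun z : 𝔼 => Real.log ‖z‖ * ballPower 1 ρ (x + z)) x]
  simp only [add_sub_cancel]
  rw [sub_eq_iff_eq_add.1 h]
  have hm0 : m ≠ 0 := by linarith
  -- Both sides equal `-1/2`: the kernel constant is `-1/π`, and `λ` and `k` are both `1/m`.
  have hval : c * (Real.pi / 2) =
      -(selfSimExponent d 1 m / (2 * barenblattConst d 1 m)) := by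
    rw [hc, selfSimExponent, barenblattConst, hdR, Real.Gamma_one_half_eq,
      show (1 : ℝ) + 1 / 2 = 1 / 2 + 1 by norm_num, Real.Gamma_add_one (by norm_num),
      Real.Gamma_one_half_eq, show ((1 : ℝ) + 1) / 2 = 1 by norm_num, Real.Gamma_one,
      ← Real.sqrt_eq_rpow, Real.rpow_one, one_mul, sub_add_cancel]
    have h1 : √Real.pi * √Real.pi = Real.pi := Real.mul_self_sqrt Real.pi_pos.le
    have h2 : 0 < √Real.pi := Real.sqrt_pos.2 Real.pi_pos
    field_simp
    nlinarith
  linear_combination ‖x‖ ^ 2 * hval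

/-- The Riesz potential `I_{2-α}` of `(ρ² - |x|²)_+^{α/2}` is quadratic in the ball. -/
lemma rieszPotential_ballPower (hd : 0 < d) {α m : ℝ} (ρ : ℝ) (hα : 0 < α) (hα2 : α ≤ 2)
    (hm : 1 < m) : ∃ A : ℝ, ∀ x : 𝔼, ‖x‖ < ρ →
      rieszPotential (2 - α) (ballPower α ρ) x =
        A - selfSimExponent d α m / (2 * barenblattConst d α m) * ‖x‖ ^ 2 := by
  rcases hα2.lt_or_eq with h2 | rfl
  · by_cases h : 2 - α = d
    · exact rieszPotential_ballPower_of_eq hd hα h2 hm h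
    · exact rieszPotential_ballPower_of_ne hd hα h2 hm h
  -- For `α = 2` the potential is the identity and `λ/(2k) = 1`.
  · refine ⟨ρ ^ 2, fun x hx => ?_⟩
    have hd' : (0 : ℝ) < d := by exact_mod_cast hd
    have hpos : 0 ≤ ρ ^ 2 - ‖x‖ ^ 2 := by have := norm_nonneg x; nlinarith
    have hden : (0 : ℝ) < d * (m - 1) + 2 := by
      have : 0 < (d : ℝ) * (m - 1) := mul_pos hd' (by linarith)
      linarith
    have e1 : Real.Gamma (((d : ℝ) + 2) / 2) = (d : ℝ) / 2 * Real.Gamma ((d : ℝ) / 2) := by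
      rw [← Real.Gamma_add_one (by positivity)]; congr 1; ring
    have p1 := Real.Gamma_pos_of_pos (show 0 < (d : ℝ) / 2 by positivity)
    have e2 : (2 : ℝ) ^ (2 : ℝ) = 4 := by norm_num
    rw [rieszPotential, if_pos (by norm_num), ballPower, max_eq_left hpos, selfSimExponent,
      barenblattConst, e1, e2, show (1 : ℝ) + 2 / 2 = 2 by norm_num, Real.Gamma_two,
      show (2 : ℝ) / 2 = 1 by norm_num, Real.rpow_one]
    field_simp
    ring

/-! ### The weak gradient of the truncated power -/

/-- The (weak) gradient of `(ρ² - |x|²)_+^{α/2}`. -/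
def ballPowerGrad (α ρ : ℝ) (x : 𝔼) : 𝔼 :=
  (if ‖x‖ < ρ then -α * (ρ ^ 2 - ‖x‖ ^ 2) ^ (α / 2 - 1) else 0) • x

lemma measurable_ballPowerGrad (α ρ : ℝ) : Measurable (ballPowerGrad α ρ : 𝔼 → 𝔼) := by
  unfold ballPowerGrad
  have h : Measurable fun x : 𝔼 => -α * (ρ ^ 2 - ‖x‖ ^ 2) ^ (α / 2 - 1) := by fun_prop
  exact (Measurable.ite (measurableSet_lt measurable_norm measurable_const) h
    measurable_const).smul measurable_id

/-- In polar coordinates the only singular factor is `(ρ - r)^{α/2-1}`, integrable because the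
exponent exceeds `-1`; the factor `(ρ + r)^{α/2-1}` is bounded as `α ≤ 2`. -/
lemma integrable_ballPowerGrad (hd : 0 < d) {α ρ : ℝ} (hα : 0 < α) (hα2 : α ≤ 2) (hρ : 0 < ρ) :
    Integrable (ballPowerGrad α ρ : 𝔼 → 𝔼) := by
  have : Nonempty (Fin d) := ⟨⟨0, hd⟩⟩
  have h1 : Integrable fun x : 𝔼 => (fun r : ℝ => if r < ρ then
      α * (ρ ^ 2 - r ^ 2) ^ (α / 2 - 1) * r else 0) ‖x‖ := by
    rw [integrable_fun_norm_addHaar (volume : Measure 𝔼) (f := fun r : ℝ => if r < ρ then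
      α * (ρ ^ 2 - r ^ 2) ^ (α / 2 - 1) * r else 0), finrank_euclideanSpace_fin]
    have hb : IntegrableOn (fun r => α * ρ ^ d * ρ ^ (α / 2 - 1) * (ρ - r) ^ (α / 2 - 1))
        (Ioo 0 ρ) := by
      refine Integrable.const_mul ?_ _
      have h2 := (intervalIntegral.intervalIntegrable_rpow' (a := 0) (b := ρ) (r := α / 2 - 1)
        (by linarith)).comp_sub_left ρ
      simp only [sub_self, sub_zero] at h2
      exact ((intervalIntegrable_iff_integrableOn_Ioo_of_le hρ.le).1 h2.symm)
    have hm : Measurable fun y : ℝ => y ^ (d - 1) • if y < ρ then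
        α * (ρ ^ 2 - y ^ 2) ^ (α / 2 - 1) * y else 0 :=
      (by fun_prop : Measurable fun y : ℝ => y ^ (d - 1)).smul
        (Measurable.ite measurableSet_Iio (by fun_prop) measurable_const)
    have h3 : IntegrableOn (fun y : ℝ => y ^ (d - 1) • if y < ρ then
        α * (ρ ^ 2 - y ^ 2) ^ (α / 2 - 1) * y else 0) (Ioo 0 ρ) := by
      refine Integrable.mono' hb hm.aestronglyMeasurable ?_
      refine (ae_restrict_mem measurableSet_Ioo).mono fun r hr => ?_
      have hr0 := hr.1
      have hr1 : 0 < ρ - r := sub_pos.2 hr.2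
      rw [if_pos hr.2, smul_eq_mul, show ρ ^ 2 - r ^ 2 = (ρ - r) * (ρ + r) by ring,
        Real.mul_rpow hr1.le (by positivity), Real.norm_of_nonneg (by positivity)]
      have e1 : (ρ + r) ^ (α / 2 - 1) ≤ ρ ^ (α / 2 - 1) :=
        Real.rpow_le_rpow_of_nonpos hρ (by linarith) (by linarith)
      have e2 : r ^ (d - 1) * r ≤ ρ ^ d := by
        rw [← pow_succ, Nat.sub_add_cancel hd]
        exact pow_le_pow_left₀ hr0.le hr.2.le _
      calc r ^ (d - 1) * (α * ((ρ - r) ^ (α / 2 - 1) * (ρ + r) ^ (α / 2 - 1)) * r)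
          = α * (r ^ (d - 1) * r) * (ρ + r) ^ (α / 2 - 1) * (ρ - r) ^ (α / 2 - 1) := by ring
        _ ≤ _ := by gcongr
    have h4 : IntegrableOn (fun y : ℝ => y ^ (d - 1) • if y < ρ then
        α * (ρ ^ 2 - y ^ 2) ^ (α / 2 - 1) * y else 0) (Ici ρ) := by
      refine (integrableOn_zero (μ := volume) (s := Ici ρ) : IntegrableOn (fun _ => (0 : ℝ)) _
        _).congr_fun (fun y hy => ?_) measurableSet_Ici
      simp [not_lt.2 (show ρ ≤ y from hy)]
    rw [← Ioo_union_Ici_eq_Ioi hρ]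
    exact h3.union h4
  refine h1.mono' (measurable_ballPowerGrad α ρ).aestronglyMeasurable (ae_of_all _ fun x => ?_)
  rw [ballPowerGrad, norm_smul]
  split_ifs with h
  · have : 0 ≤ ρ ^ 2 - ‖x‖ ^ 2 := by have := norm_nonneg x; nlinarith
    rw [norm_mul, norm_neg, Real.norm_of_nonneg hα.le, Real.norm_of_nonneg (by positivity)]
    simp [h]
  · simp [h]

/-- Together with `hasWeakGradient_of_forall_inner` this trades the vector identity for its
components along each `v`, the form in which integration by parts is done. -/
lemma integral_mul_fderiv_eq_of_hasWeakGradient {f : 𝔼 → ℝ} {V : 𝔼 → 𝔼} (h : HasWeakGradient f V)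
    {ψ : 𝔼 → ℝ} (hψ : ContDiff ℝ ∞ ψ) (hψc : HasCompactSupport ψ) (v : 𝔼) :
    ∫ x, f x * fderiv ℝ ψ x v = -∫ x, ψ x * inner ℝ (V x) v := by
  have hg : Continuous (gradient ψ) := by
    have := (InnerProductSpace.toDual ℝ 𝔼).symm.continuous.comp
      (hψ.continuous_fderiv (by simp))
    exact this
  have hgc : HasCompactSupport (gradient ψ) := by
    have := (hψc.fderiv ℝ).comp_left (g := (InnerProductSpace.toDual ℝ 𝔼).symm) (map_zero _)
    exact this
  have i1 : Integrable fun x => f x • gradient ψ x :=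
    h.1.integrable_smul_right_of_hasCompactSupport hg hgc
  have i2 : Integrable fun x => ψ x • V x :=
    h.2.1.integrable_smul_left_of_hasCompactSupport hψ.continuous hψc
  have h1 := congrArg (fun y => inner ℝ v y) (h.2.2 ψ hψ hψc)
  simp only [inner_neg_right] at h1
  rw [← integral_inner i1, ← integral_inner i2] at h1
  simp only [inner_smul_right] at h1
  rw [integral_congr_ae (ae_of_all _ fun x => ?_), h1, integral_congr_ae (ae_of_all _ fun x => ?_)]
  · simp [real_inner_comm]
  · rw [real_inner_comm, gradient, InnerProductSpace.toDual_symm_apply]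

lemma hasWeakGradient_of_forall_inner {f : 𝔼 → ℝ} {V : 𝔼 → 𝔼} (hf : LocallyIntegrable f)
    (hV : LocallyIntegrable V) (h : ∀ ψ : 𝔼 → ℝ, ContDiff ℝ ∞ ψ → HasCompactSupport ψ → ∀ v : 𝔼,
      ∫ x, f x * fderiv ℝ ψ x v = -∫ x, ψ x * inner ℝ (V x) v) : HasWeakGradient f V := by
  refine ⟨hf, hV, fun ψ hψ hψc => ?_⟩
  have hg : Continuous (gradient ψ) := by
    have := (InnerProductSpace.toDual ℝ 𝔼).symm.continuous.comp
      (hψ.continuous_fderiv (by simp))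
    exact this
  have hgc : HasCompactSupport (gradient ψ) := by
    have := (hψc.fderiv ℝ).comp_left (g := (InnerProductSpace.toDual ℝ 𝔼).symm) (map_zero _)
    exact this
  have i1 : Integrable fun x => f x • gradient ψ x :=
    hf.integrable_smul_right_of_hasCompactSupport hg hgc
  have i2 : Integrable fun x => ψ x • V x :=
    hV.integrable_smul_left_of_hasCompactSupport hψ.continuous hψc
  refine ext_inner_left ℝ fun v => ?_
  rw [inner_neg_right, ← integral_inner i1, ← integral_inner i2]
  simp only [inner_smul_right]
  have h1 := h ψ hψ hψc v
  rw [integral_congr_ae (ae_of_all _ fun x => ?_), h1, integral_congr_ae (ae_of_all _ fun x => ?_)]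
  · simp [real_inner_comm]
  · rw [real_inner_comm, gradient, InnerProductSpace.toDual_symm_apply]

/-- A `C¹` approximation of `s_+^q`. -/
def powApprox (q ε s : ℝ) : ℝ := (max s 0) ^ 2 * (max s 0 + ε) ^ (q - 2)

/-- The derivative of `powApprox`. -/
def powApproxDeriv (q ε s : ℝ) : ℝ :=
  if s ≤ 0 then 0 else 2 * s * (s + ε) ^ (q - 2) + s ^ 2 * ((q - 2) * (s + ε) ^ (q - 3))

lemma hasDerivAt_powApprox (q : ℝ) {ε : ℝ} (hε : 0 < ε) (hq : q ≤ 2) (s : ℝ) :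
    HasDerivAt (powApprox q ε) (powApproxDeriv q ε s) s := by
  rcases lt_trichotomy s 0 with hs | rfl | hs
  · rw [powApproxDeriv, if_pos hs.le]
    refine (hasDerivAt_const s (0 : ℝ)).congr_of_eventuallyEq ?_
    filter_upwards [eventually_lt_nhds hs] with t ht
    simp [powApprox, max_eq_right ht.le]
  · rw [powApproxDeriv, if_pos le_rfl]
    -- At the junction the square dominates, so the derivative is `0` from both sides.
    have hO : powApprox q ε =O[𝓝 0] fun t => ‖t - 0‖ ^ 2 := by
      refine Asymptotics.IsBigO.of_bound (ε ^ (q - 2)) (Eventually.of_forall fun t => ?_)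
      have hm : 0 ≤ max t 0 := le_max_right _ _
      have hm2 : max t 0 ≤ |t| := max_le (le_abs_self t) (abs_nonneg t)
      rw [powApprox, Real.norm_of_nonneg (by positivity), Real.norm_of_nonneg (by positivity),
        sub_zero, mul_comm]
      refine mul_le_mul (Real.rpow_le_rpow_of_nonpos hε (by linarith) (by linarith)) ?_
        (by positivity) (by positivity)
      exact pow_le_pow_left₀ hm hm2 2
    have := hO.hasFDerivAt (𝕜 := ℝ) one_lt_two
    simpa using this.hasDerivAt
  · rw [powApproxDeriv, if_neg hs.not_ge]
    have h1 : HasDerivAt (fun t : ℝ => t ^ 2 * (t + ε) ^ (q - 2))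
        (2 * s * (s + ε) ^ (q - 2) + s ^ 2 * ((q - 2) * (s + ε) ^ (q - 3))) s := by
      have h2 : HasDerivAt (fun t : ℝ => (t + ε) ^ (q - 2)) ((q - 2) * (s + ε) ^ (q - 3)) s := by
        have := ((hasDerivAt_id s).add_const ε).rpow_const (p := q - 2)
          (Or.inl (by simp; positivity))
        refine this.congr_deriv ?_
        rw [one_mul, show q - 2 - 1 = q - 3 by ring]
        rfl
      have h3 := (hasDerivAt_pow 2 s).mul h2
      refine h3.congr_deriv ?_
      norm_num
    refine h1.congr_of_eventuallyEq ?_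
    filter_upwards [eventually_gt_nhds hs] with t ht
    simp [powApprox, max_eq_left ht.le]

/-- Domination independent of `ε`: each of the two terms is at most `2 s^{q-1}`, since `s ≤ s + ε`
and `(s + ε)^{q-1} ≤ s^{q-1}`. -/
lemma abs_powApproxDeriv_le {q ε s : ℝ} (hq0 : 0 < q) (hq : q ≤ 1) (hε : 0 < ε) (hs : 0 < s) :
    |powApproxDeriv q ε s| ≤ 4 * s ^ (q - 1) := by
  rw [powApproxDeriv, if_neg hs.not_ge]
  have hse : 0 < s + ε := by linarith
  have e1 : (s + ε) ^ (q - 1) ≤ s ^ (q - 1) :=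
    Real.rpow_le_rpow_of_nonpos hs (by linarith) (by linarith)
  have e2 : (s + ε) ^ (q - 1) = (s + ε) * (s + ε) ^ (q - 2) := by
    rw [mul_comm, ← Real.rpow_add_one hse.ne']; congr 1; ring
  have e3 : (s + ε) ^ (q - 1) = (s + ε) ^ 2 * (s + ε) ^ (q - 3) := by
    rw [← Real.rpow_natCast, ← Real.rpow_add hse]; congr 1; push_cast; ring
  have p1 : 0 < (s + ε) ^ (q - 2) := by positivity
  have p2 : 0 < (s + ε) ^ (q - 3) := by positivity
  have b1 : s * (s + ε) ^ (q - 2) ≤ s ^ (q - 1) := by nlinarith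
  have b2 : s ^ 2 * (s + ε) ^ (q - 3) ≤ s ^ (q - 1) := by
    refine le_trans ?_ (e3 ▸ e1)
    gcongr
    linarith
  have p3 : 0 ≤ s * (s + ε) ^ (q - 2) := by positivity
  have p4 : 0 ≤ s ^ 2 * (s + ε) ^ (q - 3) := by positivity
  rw [abs_le]
  constructor <;> nlinarith

lemma powApprox_le {q ε s : ℝ} (hq0 : 0 < q) (hq : q ≤ 1) (hε : 0 < ε) :
    0 ≤ powApprox q ε s ∧ powApprox q ε s ≤ (max s 0) ^ q := by
  have hm : 0 ≤ max s 0 := le_max_right _ _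
  refine ⟨by rw [powApprox]; positivity, ?_⟩
  rcases hm.eq_or_lt with h | h
  · rw [powApprox, ← h, Real.zero_rpow hq0.ne']; simp
  · rw [powApprox, show (max s 0) ^ q = (max s 0) ^ 2 * (max s 0) ^ (q - 2) by
      rw [← Real.rpow_natCast, ← Real.rpow_add h]; congr 1; push_cast; ring]
    exact mul_le_mul_of_nonneg_left
      (Real.rpow_le_rpow_of_nonpos h (by linarith) (by linarith)) (by positivity)

lemma tendsto_powApprox {q s : ℝ} (hq0 : 0 < q) {ε : ℕ → ℝ} (hε : Tendsto ε atTop (𝓝 0)) :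
    Tendsto (fun n => powApprox q (ε n) s) atTop (𝓝 ((max s 0) ^ q)) := by
  have hm : 0 ≤ max s 0 := le_max_right _ _
  rcases hm.eq_or_lt with h | h
  · simp [powApprox, ← h, Real.zero_rpow hq0.ne']
  · have h1 : Tendsto (fun n => (max s 0 + ε n) ^ (q - 2)) atTop (𝓝 ((max s 0 + 0) ^ (q - 2))) :=
      (hε.const_add _).rpow_const (Or.inl (by linarith))
    have h2 := h1.const_mul ((max s 0) ^ 2)
    rw [add_zero] at h2
    rw [show (max s 0) ^ q = (max s 0) ^ 2 * (max s 0) ^ (q - 2) by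
      rw [← Real.rpow_natCast, ← Real.rpow_add h]; congr 1; push_cast; ring]
    exact h2

lemma tendsto_powApproxDeriv {q s : ℝ} (hs : 0 < s) {ε : ℕ → ℝ}
    (hε : Tendsto ε atTop (𝓝 0)) :
    Tendsto (fun n => powApproxDeriv q (ε n) s) atTop (𝓝 (q * s ^ (q - 1))) := by
  have h1 (p : ℝ) : Tendsto (fun n => (s + ε n) ^ p) atTop (𝓝 ((s + 0) ^ p)) :=
    (hε.const_add _).rpow_const (Or.inl (by linarith))
  have h2 := ((h1 (q - 2)).const_mul (2 * s)).add
    (((h1 (q - 3)).const_mul (q - 2)).const_mul (s ^ 2))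
  rw [add_zero] at h2
  simp only [powApproxDeriv, if_neg hs.not_ge]
  convert h2 using 2
  have e2 : s ^ (q - 1) = s * s ^ (q - 2) := by
    rw [mul_comm, ← Real.rpow_add_one hs.ne']; congr 1; ring
  have e3 : s ^ (q - 1) = s ^ 2 * s ^ (q - 3) := by
    rw [← Real.rpow_natCast, ← Real.rpow_add hs]; congr 1; push_cast; ring
  linear_combination (q - 2) * e3 + 2 * e2

lemma measurable_powApproxDeriv (q ε : ℝ) : Measurable (powApproxDeriv q ε) := by
  unfold powApproxDeriv
  exact Measurable.ite measurableSet_Iic measurable_const (by fun_prop)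

lemma integral_powApprox_mul_fderiv {q ρ ε : ℝ} (hq : q ≤ 1)
    (hε : 0 < ε) {ψ : 𝔼 → ℝ} (hψ : ContDiff ℝ ∞ ψ) (hψc : HasCompactSupport ψ) (v : 𝔼)
    (hint : Integrable fun x : 𝔼 => powApproxDeriv q ε (ρ ^ 2 - ‖x‖ ^ 2) *
      (-(2 * inner ℝ x v)) * ψ x) :
    ∫ x : 𝔼, powApprox q ε (ρ ^ 2 - ‖x‖ ^ 2) * fderiv ℝ ψ x v =
      -∫ x : 𝔼, powApproxDeriv q ε (ρ ^ 2 - ‖x‖ ^ 2) * (-(2 * inner ℝ x v)) * ψ x := by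
  have hline : ∀ x : 𝔼, HasLineDerivAt ℝ (fun x : 𝔼 => powApprox q ε (ρ ^ 2 - ‖x‖ ^ 2))
      (powApproxDeriv q ε (ρ ^ 2 - ‖x‖ ^ 2) * (-(2 * inner ℝ x v))) x v := by
    intro x
    have h1 : HasFDerivAt (fun x : 𝔼 => ρ ^ 2 - ‖x‖ ^ 2) (-(2 • innerSL ℝ x)) x :=
      ((hasStrictFDerivAt_norm_sq x).hasFDerivAt).const_sub _
    have h2 := ((hasDerivAt_powApprox q hε (by linarith)
      (ρ ^ 2 - ‖x‖ ^ 2)).comp_hasFDerivAt x h1).hasLineDerivAt v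
    simp only [Function.comp_def] at h2
    simpa using h2
  have hcont : Continuous fun x : 𝔼 => powApprox q ε (ρ ^ 2 - ‖x‖ ^ 2) := by
    have : Continuous (powApprox q ε) := continuous_iff_continuousAt.2 fun s =>
      (hasDerivAt_powApprox q hε (by linarith) s).continuousAt
    exact this.comp (by fun_prop)
  have hψ' : Continuous fun x => fderiv ℝ ψ x v :=
    (hψ.continuous_fderiv (by simp)).clm_apply continuous_const
  refine integral_bilinear_hasLineDerivAt_right_eq_neg_left_of_integrable
    (B := ContinuousLinearMap.mul ℝ ℝ) (v := v) (by simpa using hint) ?_ ?_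
    (fun x _ => hline x)
    fun x _ => ((hψ.differentiable (by simp)) x).hasFDerivAt.hasLineDerivAt v
  · have hc : HasCompactSupport fun x => fderiv ℝ ψ x v :=
      (hψc.fderiv ℝ).comp_left (g := fun L : 𝔼 →L[ℝ] ℝ => L v) rfl
    exact (hcont.mul hψ').integrable_of_hasCompactSupport hc.mul_left
  · exact (hcont.mul hψ.continuous).integrable_of_hasCompactSupport hψc.mul_left

lemma continuous_ballPower {α : ℝ} (hα : 0 < α) (ρ : ℝ) : Continuous (ballPower α ρ : 𝔼 → ℝ) := by
  unfold ballPower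
  exact Continuous.rpow_const (by fun_prop) fun _ => Or.inr (by linarith)

/-- `ballPowerGrad` is the weak gradient of `ballPower`. -/
lemma hasWeakGradient_ballPower (hd : 0 < d) {α ρ : ℝ} (hα : 0 < α) (hα2 : α ≤ 2) (hρ : 0 < ρ) :
    HasWeakGradient (ballPower α ρ : 𝔼 → ℝ) (ballPowerGrad α ρ) := by
  have hgi := integrable_ballPowerGrad hd hα hα2 hρ
  refine hasWeakGradient_of_forall_inner (continuous_ballPower hα ρ).locallyIntegrable
    hgi.locallyIntegrable fun ψ hψ hψc v => ?_
  obtain ⟨C, hC⟩ := hψ.continuous.bounded_above_of_compact_support hψc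
  have hC0 : 0 ≤ C := (norm_nonneg _).trans (hC 0)
  set q := α / 2 with hq
  have hq0 : 0 < q := by positivity
  have hq1 : q ≤ 1 := by linarith
  have hψ' : Continuous fun x => fderiv ℝ ψ x v :=
    (hψ.continuous_fderiv (by simp)).clm_apply continuous_const
  have hψ'c : HasCompactSupport fun x => fderiv ℝ ψ x v :=
    (hψc.fderiv ℝ).comp_left (g := fun L : 𝔼 →L[ℝ] ℝ => L v) rfl
  have hεpos : ∀ n : ℕ, (0 : ℝ) < 1 / ((n : ℝ) + 1) := fun n => by positivity
  have hlim : Tendsto (fun n : ℕ => 1 / ((n : ℝ) + 1)) atTop (𝓝 0) :=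
    tendsto_one_div_add_atTop_nhds_zero_nat
  have hmeas : ∀ n : ℕ, AEStronglyMeasurable (fun x : 𝔼 =>
      powApproxDeriv q (1 / ((n : ℝ) + 1)) (ρ ^ 2 - ‖x‖ ^ 2) * (-(2 * inner ℝ x v)) * ψ x)
      volume := by
    intro n
    refine (((measurable_powApproxDeriv _ _).comp ?_).mul ?_).mul
      hψ.continuous.measurable |>.aestronglyMeasurable <;> fun_prop
  -- The `8` is `4` from `abs_powApproxDeriv_le` times `2` from the derivative of `‖x‖²`; the `α` is
  -- the one in `ballPowerGrad`.
  have hbound : ∀ n : ℕ, ∀ x : 𝔼, ‖powApproxDeriv q (1 / ((n : ℝ) + 1)) (ρ ^ 2 - ‖x‖ ^ 2) *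
      (-(2 * inner ℝ x v)) * ψ x‖ ≤ ‖ballPowerGrad α ρ x‖ * (8 / α * ‖v‖ * C) := by
    intro n x
    by_cases hx : ‖x‖ < ρ
    · have hs : 0 < ρ ^ 2 - ‖x‖ ^ 2 := by have := norm_nonneg x; nlinarith
      have h1 := abs_powApproxDeriv_le hq0 hq1 (hεpos n) hs
      have h2 : |inner ℝ x v| ≤ ‖x‖ * ‖v‖ := abs_real_inner_le_norm x v
      rw [ballPowerGrad, if_pos hx, norm_smul, norm_mul, norm_mul, norm_mul, norm_neg, norm_neg,
        norm_mul, Real.norm_of_nonneg hα.le, Real.norm_of_nonneg (by positivity : (0 : ℝ) ≤ 2),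
        Real.norm_eq_abs (powApproxDeriv _ _ _), Real.norm_eq_abs (inner ℝ x v),
        Real.norm_of_nonneg (by positivity : 0 ≤ (ρ ^ 2 - ‖x‖ ^ 2) ^ (α / 2 - 1))]
      calc _ ≤ 4 * (ρ ^ 2 - ‖x‖ ^ 2) ^ (q - 1) * (2 * (‖x‖ * ‖v‖)) * C := by
            gcongr
            exact hC x
        _ = _ := by rw [← hq]; field_simp; ring
    · have hs : ρ ^ 2 - ‖x‖ ^ 2 ≤ 0 := by nlinarith
      rw [powApproxDeriv, if_pos hs]
      simp only [zero_mul, norm_zero]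
      positivity
  have hbi : Integrable fun x : 𝔼 => ‖ballPowerGrad α ρ x‖ * (8 / α * ‖v‖ * C) :=
    hgi.norm.mul_const _
  have hid : ∀ n : ℕ, _ := fun n : ℕ => integral_powApprox_mul_fderiv hq1 (hεpos n) hψ hψc
    v (hbi.mono' (hmeas n) (ae_of_all _ (hbound n)))
  have t1 : Tendsto (fun n : ℕ => ∫ x : 𝔼,
      powApprox q (1 / ((n : ℝ) + 1)) (ρ ^ 2 - ‖x‖ ^ 2) * fderiv ℝ ψ x v) atTop
      (𝓝 (∫ x : 𝔼, ballPower α ρ x * fderiv ℝ ψ x v)) := by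
    refine tendsto_integral_of_dominated_convergence
      (fun x => ballPower α ρ x * ‖fderiv ℝ ψ x v‖) ?_ ?_ ?_ ?_
    · intro n
      refine Measurable.aestronglyMeasurable (Measurable.mul ?_ hψ'.measurable)
      unfold powApprox; fun_prop
    · exact ((continuous_ballPower hα ρ).mul hψ'.norm).integrable_of_hasCompactSupport
        hψ'c.norm.mul_left
    · intro n
      refine ae_of_all _ fun x => ?_
      have h := powApprox_le (s := ρ ^ 2 - ‖x‖ ^ 2) hq0 hq1 (hεpos n)
      rw [norm_mul, Real.norm_of_nonneg h.1]
      exact mul_le_mul_of_nonneg_right h.2 (norm_nonneg _)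
    · exact ae_of_all _ fun x => (tendsto_powApprox hq0 hlim).mul_const _
  have t2 : Tendsto (fun n : ℕ => ∫ x : 𝔼,
      powApproxDeriv q (1 / ((n : ℝ) + 1)) (ρ ^ 2 - ‖x‖ ^ 2) * (-(2 * inner ℝ x v)) * ψ x) atTop
      (𝓝 (∫ x : 𝔼, ψ x * inner ℝ (ballPowerGrad α ρ x) v)) := by
    refine tendsto_integral_of_dominated_convergence _ hmeas hbi
      (fun n => ae_of_all _ (hbound n)) (ae_of_all _ fun x => ?_)
    by_cases hx : ‖x‖ < ρ
    · have hs : 0 < ρ ^ 2 - ‖x‖ ^ 2 := by have := norm_nonneg x; nlinarith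
      have h := ((tendsto_powApproxDeriv (q := q) hs hlim).mul_const
        (-(2 * inner ℝ x v))).mul_const (ψ x)
      convert h using 2
      rw [ballPowerGrad, if_pos hx, real_inner_smul_left, ← hq, hq]
      ring
    · have hs : ρ ^ 2 - ‖x‖ ^ 2 ≤ 0 := by nlinarith
      simp only [powApproxDeriv, if_pos hs, ballPowerGrad, if_neg hx]
      simp
  refine tendsto_nhds_unique t1 ?_
  simp_rw [hid]
  exact t2.neg

/-! ### Weak gradients of Riesz potentials and their locality -/

/-- The Riesz potential of a vector field. -/
def rieszPotentialVec (β : ℝ) (G : 𝔼 → 𝔼) (x : 𝔼) : 𝔼 :=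
  if β = 0 then G x else ∫ z : 𝔼, rieszKernel β z • G (x + z)

/-- The shear `(z, p) ↦ (z, S z p)` preserves the product measure, so the integrability of `κ(z)
G(p)` is transported. The general `X` serves both space and space-time. -/
lemma integrable_smul_skew {X F : Type*} [MeasurableSpace X] {ν : Measure X} [SFinite ν]
    [NormedAddCommGroup F] [NormedSpace ℝ F] {κ : 𝔼 → ℝ} (hκ : Integrable κ) {G : X → F}
    (hG : Integrable G ν) {S : 𝔼 → X → X} (hS : Measurable (Function.uncurry S))
    (hSm : ∀ z, Measure.map (S z) ν = ν) :
    Integrable (fun p : 𝔼 × X => κ p.1 • G (S p.1 p.2)) (volume.prod ν) := by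
  have hmp : MeasurePreserving (fun p : 𝔼 × X => (p.1, S p.1 p.2)) (volume.prod ν)
      (volume.prod ν) :=
    (MeasurePreserving.id volume).skew_product hS (ae_of_all _ hSm)
  exact hmp.integrable_comp_of_integrable (hκ.smul_prod hG)

lemma map_add_right_euclidean (z : 𝔼) : Measure.map (fun x => x + z) (volume : Measure 𝔼) = volume :=
  (measurePreserving_add_right volume z).map_eq

lemma norm_le_of_add_mem {M N : ℝ} {x z : 𝔼} (hx : ‖x‖ ≤ N) (hxz : ‖x + z‖ ≤ M) : ‖z‖ ≤ M + N := by
  have := norm_sub_le (x + z) x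
  rw [add_sub_cancel_left] at this
  linarith

/-- For `x` in the compact `K` only bounded `z` reach the support of `g`, so the locally integrable
kernel may be cut off and treated as integrable. -/
lemma integrable_smul_comp_add {F : Type*} [NormedAddCommGroup F] [NormedSpace ℝ F]
    {κ : 𝔼 → ℝ} (hκ : LocallyIntegrable κ) {g : 𝔼 → F} (hg : Integrable g) {M : ℝ}
    (hs : ∀ y, M < ‖y‖ → g y = 0) {K : Set 𝔼} (hK : IsCompact K) :
    Integrable (fun p : 𝔼 × 𝔼 => κ p.1 • g (p.2 + p.1)) (volume.prod (volume.restrict K)) := by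
  obtain ⟨N, hN⟩ := hK.isBounded.exists_norm_le
  have hB := (hκ.integrableOn_isCompact (isCompact_closedBall (0 : 𝔼) (M + N))).integrable_indicator
    Metric.isClosed_closedBall.measurableSet
  have h := integrable_smul_skew hB hg (S := fun z x => x + z) (by
    unfold Function.uncurry; fun_prop) map_add_right_euclidean
  have hm : (volume : Measure 𝔼).prod (volume.restrict K) =
      (volume.prod volume).restrict (univ ×ˢ K) := by
    rw [← Measure.prod_restrict, Measure.restrict_univ]
  rw [hm]
  refine (h.restrict (s := univ ×ˢ K)).congr ?_
  filter_upwards [ae_restrict_mem (MeasurableSet.univ.prod hK.measurableSet)] with p hp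
  by_cases hz : p.1 ∈ Metric.closedBall (0 : 𝔼) (M + N)
  · rw [indicator_of_mem hz]
  · have : M < ‖p.2 + p.1‖ := by
      by_contra hc
      exact hz (mem_closedBall_zero_iff.2 (norm_le_of_add_mem (hN _ hp.2) (not_lt.1 hc)))
    simp [hs _ this]

lemma integrable_smul_comp_add_time {F : Type*} [NormedAddCommGroup F] [NormedSpace ℝ F]
    {κ : 𝔼 → ℝ} (hκ : LocallyIntegrable κ) {τ : Measure ℝ} [SFinite τ] {g : ℝ × 𝔼 → F}
    (hg : Integrable g (τ.prod volume)) {M : ℝ}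
    (hs : ∀ t y, M < ‖y‖ → g (t, y) = 0) {K : Set 𝔼} (hK : IsCompact K) :
    Integrable (fun p : 𝔼 × (ℝ × 𝔼) => κ p.1 • g (p.2.1, p.2.2 + p.1))
      (volume.prod (τ.prod (volume.restrict K))) := by
  obtain ⟨N, hN⟩ := hK.isBounded.exists_norm_le
  have hB := (hκ.integrableOn_isCompact (isCompact_closedBall (0 : 𝔼) (M + N))).integrable_indicator
    Metric.isClosed_closedBall.measurableSet
  have h := integrable_smul_skew hB hg (S := fun z p => (p.1, p.2 + z)) (by
      unfold Function.uncurry; fun_prop) fun z => by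
    have := ((MeasurePreserving.id τ).prod (measurePreserving_add_right (volume : Measure 𝔼) z))
    exact this.map_eq
  have hm : (volume : Measure 𝔼).prod (τ.prod (volume.restrict K)) =
      (volume.prod (τ.prod volume)).restrict (univ ×ˢ (univ ×ˢ K)) := by
    rw [← Measure.prod_restrict, ← Measure.prod_restrict, Measure.restrict_univ,
      Measure.restrict_univ]
  rw [hm]
  refine (h.restrict (s := univ ×ˢ (univ ×ˢ K))).congr ?_
  filter_upwards [ae_restrict_mem
    (MeasurableSet.univ.prod (MeasurableSet.univ.prod hK.measurableSet))] with p hp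
  by_cases hz : p.1 ∈ Metric.closedBall (0 : 𝔼) (M + N)
  · rw [indicator_of_mem hz]
  · have : M < ‖p.2.2 + p.1‖ := by
      by_contra hc
      exact hz (mem_closedBall_zero_iff.2 (norm_le_of_add_mem (hN _ hp.2.2) (not_lt.1 hc)))
    simp [hs _ _ this]

lemma locallyIntegrable_integral_smul {F : Type*} [NormedAddCommGroup F] [NormedSpace ℝ F]
    {κ : 𝔼 → ℝ} (hκ : LocallyIntegrable κ) {g : 𝔼 → F} (hg : Integrable g) {M : ℝ}
    (hs : ∀ y, M < ‖y‖ → g y = 0) : LocallyIntegrable fun x => ∫ z, κ z • g (x + z) := by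
  rw [locallyIntegrable_iff]
  intro K hK
  exact (integrable_smul_comp_add hκ hg hs hK).integral_prod_right

/-- Fubini for the pairing of a potential with a bounded function of compact support. -/
lemma integral_integral_smul_mul {κ : 𝔼 → ℝ} (hκ : LocallyIntegrable κ) {g : 𝔼 → ℝ}
    (hg : Integrable g) {M : ℝ} (hs : ∀ y, M < ‖y‖ → g y = 0) {ψ : 𝔼 → ℝ} (hψ : Continuous ψ)
    (hψc : HasCompactSupport ψ) :
    ∫ x, (∫ z, κ z * g (x + z)) * ψ x = ∫ z, κ z * ∫ x, g (x + z) * ψ x := by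
  obtain ⟨C, hC⟩ := hψ.bounded_above_of_compact_support hψc
  have hK : IsCompact (tsupport ψ) := hψc
  have h1 := integrable_smul_comp_add hκ hg hs hK
  have h2 : Integrable (fun p : 𝔼 × 𝔼 => (κ p.1 • g (p.2 + p.1)) * ψ p.2)
      (volume.prod (volume.restrict (tsupport ψ))) :=
    h1.mul_bdd (c := C) (by fun_prop) (ae_of_all _ fun p => hC _)
  have h3 := integral_integral_swap (f := fun z x => κ z • g (x + z) * ψ x) h2
  have hz : ∀ x, x ∉ tsupport ψ → ψ x = 0 := fun x hx => image_eq_zero_of_notMem_tsupport hx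
  rw [← setIntegral_eq_integral_of_forall_compl_eq_zero (s := tsupport ψ)
    fun x hx => by rw [hz x hx, mul_zero]]
  simp_rw [← integral_mul_const]
  simp only [smul_eq_mul] at h3 ⊢
  rw [← h3]
  refine integral_congr_ae (ae_of_all _ fun z => ?_)
  simp only
  rw [← integral_const_mul, ← setIntegral_eq_integral_of_forall_compl_eq_zero (s := tsupport ψ)
    (f := fun x => κ z * (g (x + z) * ψ x)) fun x hx => by rw [hz x hx, mul_zero, mul_zero]]
  simp only [mul_assoc]

/-- The weak gradient commutes with the Riesz potential. -/
lemma HasWeakGradient.rieszPotential (hd : 0 < d) {β : ℝ} (hβ : 0 ≤ β) {w : 𝔼 → ℝ} {G : 𝔼 → 𝔼}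
    (h : HasWeakGradient w G) (hw : Integrable w) (hG : Integrable G) {M : ℝ}
    (hws : ∀ y, M < ‖y‖ → w y = 0) (hGs : ∀ y, M < ‖y‖ → G y = 0) :
    HasWeakGradient (rieszPotential β w) (rieszPotentialVec β G) := by
  rcases hβ.eq_or_lt with rfl | hβ
  · have e1 : _root_.rieszPotential 0 w = w := by ext x; simp [_root_.rieszPotential]
    have e2 : rieszPotentialVec 0 G = G := by ext1 x; simp [rieszPotentialVec]
    rwa [e1, e2]
  have hκ := locallyIntegrable_rieszKernel (d := d) hd hβ
  have e1 : _root_.rieszPotential β w = fun x => ∫ z, rieszKernel β z * w (x + z) := by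
    ext x; simp [_root_.rieszPotential, hβ.ne']
  have e2 : rieszPotentialVec β G = fun x => ∫ z, rieszKernel β z • G (x + z) := by
    ext1 x; simp [rieszPotentialVec, hβ.ne']
  rw [e1, e2]
  refine hasWeakGradient_of_forall_inner (locallyIntegrable_integral_smul hκ hw hws)
    (locallyIntegrable_integral_smul hκ hG hGs) fun ψ hψ hψc v => ?_
  have hψ' : Continuous fun x => fderiv ℝ ψ x v :=
    (hψ.continuous_fderiv (by simp)).clm_apply continuous_const
  have hψ'c : HasCompactSupport fun x => fderiv ℝ ψ x v :=
    (hψc.fderiv ℝ).comp_left (g := fun L : 𝔼 →L[ℝ] ℝ => L v) rfl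
  have hGv : Integrable fun x => (inner ℝ (G x) v : ℝ) := hG.inner_const v
  rw [integral_integral_smul_mul hκ hw hws hψ' hψ'c]
  have hK : IsCompact (tsupport ψ) := hψc
  have hR : ∫ x, ψ x * inner ℝ (∫ z, rieszKernel β z • G (x + z)) v =
      ∫ x, (∫ z, rieszKernel β z * inner ℝ (G (x + z)) v) * ψ x := by
    have h1 := (integrable_smul_comp_add hκ hG hGs hK).prod_left_ae
    rw [ae_restrict_iff' hK.measurableSet] at h1
    refine integral_congr_ae ?_
    filter_upwards [h1] with x hx
    by_cases hxs : x ∈ tsupport ψ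
    swap
    · rw [image_eq_zero_of_notMem_tsupport hxs, zero_mul, mul_zero]
    specialize hx hxs
    rw [mul_comm, real_inner_comm, ← integral_inner hx]
    simp only [inner_smul_right, real_inner_comm]
  rw [hR, integral_integral_smul_mul hκ hGv (M := M) (fun y hy => by simp [hGs y hy]) hψ.continuous hψc,
    ← integral_neg]
  refine integral_congr_ae (ae_of_all _ fun z => ?_)
  simp only
  rw [← mul_neg]
  congr 1
  -- For fixed `z` the translation is moved onto the test function, and the weak gradient of `w` is
  -- tested against `ψ(· - z)`.
  have hsm : ContDiff ℝ ∞ fun y => ψ (y - z) := hψ.comp (contDiff_id.sub contDiff_const)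
  have hsc : HasCompactSupport fun y => ψ (y - z) :=
    hψc.comp_homeomorph (Homeomorph.subRight z)
  have key := integral_mul_fderiv_eq_of_hasWeakGradient h hsm hsc v
  rw [← integral_add_right_eq_self (fun x => w x * fderiv ℝ (fun y => ψ (y - z)) x v) z,
    ← integral_add_right_eq_self (fun x => ψ (x - z) * inner ℝ (G x) v) z] at key
  simp only [add_sub_cancel_right, fderiv_comp_sub] at key
  rw [key]
  simp only [mul_comm]

/-- Locality, by the fundamental lemma of the calculus of variations with test functions supported
in `O`. It identifies the convolved gradient inside the ball. -/
lemma HasWeakGradient.ae_eq_of_eqOn {f g : 𝔼 → ℝ} {V U : 𝔼 → 𝔼} (hf : HasWeakGradient f V)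
    (hg : HasWeakGradient g U) {O : Set 𝔼} (hO : IsOpen O) (hfg : EqOn f g O) :
    ∀ᵐ x, x ∈ O → V x = U x := by
  have hloc : LocallyIntegrable (fun x => V x - U x) := hf.2.1.sub hg.2.1
  have h := hO.ae_eq_zero_of_integral_contDiff_smul_eq_zero (hloc.locallyIntegrableOn O)
    fun ψ hψ hψc hs => ?_
  · exact h.mono fun x hx hxO => sub_eq_zero.1 (hx hxO)
  · have i1 := hf.2.1.integrable_smul_left_of_hasCompactSupport hψ.continuous hψc
    have i2 := hg.2.1.integrable_smul_left_of_hasCompactSupport hψ.continuous hψc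
    simp only [smul_sub]
    rw [integral_sub i1 i2, sub_eq_zero, ← neg_inj, ← hf.2.2 ψ hψ hψc, ← hg.2.2 ψ hψ hψc]
    refine integral_congr_ae (ae_of_all _ fun x => ?_)
    by_cases hx : x ∈ tsupport ψ
    · simp only [hfg (hs hx)]
    · have h0 : fderiv ℝ ψ x = 0 :=
        image_eq_zero_of_notMem_tsupport fun hc => hx (tsupport_fderiv_subset ℝ hc)
      simp [gradient, h0]

lemma hasWeakGradient_quadratic (A B : ℝ) :
    HasWeakGradient (fun x : 𝔼 => A - B * ‖x‖ ^ 2) fun x => (-(2 * B)) • x := by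
  have hc1 : Continuous fun x : 𝔼 => A - B * ‖x‖ ^ 2 := by fun_prop
  have hc2 : Continuous fun x : 𝔼 => (-(2 * B)) • x := by fun_prop
  refine hasWeakGradient_of_forall_inner hc1.locallyIntegrable hc2.locallyIntegrable
    fun ψ hψ hψc v => ?_
  have hfd : ∀ x : 𝔼, HasFDerivAt (fun x : 𝔼 => A - B * ‖x‖ ^ 2)
      (-(B • (2 • innerSL ℝ x))) x := fun x =>
    (((hasStrictFDerivAt_norm_sq x).hasFDerivAt).const_mul B).const_sub A
  have hψ' : Continuous fun x => fderiv ℝ ψ x v :=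
    (hψ.continuous_fderiv (by simp)).clm_apply continuous_const
  have hψ'c : HasCompactSupport fun x => fderiv ℝ ψ x v :=
    (hψc.fderiv ℝ).comp_left (g := fun L : 𝔼 →L[ℝ] ℝ => L v) rfl
  have hfv : ∀ x, fderiv ℝ (fun x : 𝔼 => A - B * ‖x‖ ^ 2) x v = inner ℝ ((-(2 * B)) • x) v := by
    intro x
    rw [(hfd x).fderiv, real_inner_smul_left]
    simp
    ring
  have hc3 : Continuous fun x : 𝔼 => (inner ℝ ((-(2 * B)) • x) v : ℝ) := by fun_prop
  rw [integral_mul_fderiv_eq_neg_fderiv_mul_of_integrable]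
  · simp only [hfv, mul_comm]
  · simp only [hfv]
    exact (hc3.mul hψ.continuous).integrable_of_hasCompactSupport hψc.mul_left
  · exact (hc1.mul hψ').integrable_of_hasCompactSupport hψ'c.mul_left
  · exact (hc1.mul hψ.continuous).integrable_of_hasCompactSupport hψc.mul_left
  · exact fun x _ => (hfd x).differentiableAt
  · exact fun x _ => (hψ.differentiable (by simp)) x

/-! ### Gradients of the potential inside and outside the ball -/

lemma contDiffAt_rieszKernel (β : ℝ) {z : 𝔼} (hz : z ≠ 0) : ContDiffAt ℝ 1 (rieszKernel β) z := by
  have hn : ContDiffAt ℝ 1 (fun z : 𝔼 => ‖z‖) z := contDiffAt_norm ℝ hz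
  have hn0 : ‖z‖ ≠ 0 := norm_ne_zero_iff.2 hz
  by_cases h : β = d
  · have hk : (rieszKernel β : 𝔼 → ℝ) = fun z =>
        -(2 / (2 ^ (d : ℝ) * Real.pi ^ ((d : ℝ) / 2) * Real.Gamma ((d : ℝ) / 2))) *
          Real.log ‖z‖ := by
      funext z; simp only [rieszKernel, if_pos h]
    rw [hk]
    exact contDiffAt_const.mul (hn.log hn0)
  · have hk : (rieszKernel β : 𝔼 → ℝ) = fun z => Real.Gamma (((d : ℝ) - β) / 2) /
          (2 ^ β * Real.pi ^ ((d : ℝ) / 2) * Real.Gamma (β / 2)) * ‖z‖ ^ (β - (d : ℝ)) := by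
      funext z; simp only [rieszKernel, if_neg h]
    rw [hk]
    exact contDiffAt_const.mul (hn.rpow_const_of_ne hn0)

lemma exists_norm_fderiv_rieszKernel_le (β : ℝ) {ε N : ℝ} (hε : 0 < ε) :
    ∃ C, ∀ z : 𝔼, ε ≤ ‖z‖ → ‖z‖ ≤ N → ‖fderiv ℝ (rieszKernel β) z‖ ≤ C := by
  have hcd : ContDiffOn ℝ 1 (rieszKernel β : 𝔼 → ℝ) {0}ᶜ := fun z hz =>
    (contDiffAt_rieszKernel β hz).contDiffWithinAt
  have hcont := hcd.continuousOn_fderiv_of_isOpen isOpen_compl_singleton (by norm_num)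
  have hK : IsCompact (Metric.closedBall (0 : 𝔼) N ∩ {z | ε ≤ ‖z‖}) :=
    (isCompact_closedBall _ _).inter_right (isClosed_le continuous_const continuous_norm)
  obtain ⟨C, hC⟩ := hK.exists_bound_of_continuousOn (hcont.mono fun z hz => by
    have : ε ≤ ‖z‖ := hz.2
    exact fun h0 => by
      rw [mem_singleton_iff.1 h0, norm_zero] at this
      linarith)
  exact ⟨C, fun z h1 h2 => hC z ⟨mem_closedBall_zero_iff.2 h2, h1⟩⟩

/-- A Riesz potential is differentiable away from the support. -/
lemma differentiableAt_rieszPotential (hd : 0 < d) {β : ℝ} (hβ : 0 < β) {w : 𝔼 → ℝ}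
    (hw : Measurable w) {C ρ : ℝ} (hb : ∀ y, |w y| ≤ C) (hs : ∀ y, ρ ≤ ‖y‖ → w y = 0)
    {x : 𝔼} (hx : ρ < ‖x‖) : DifferentiableAt ℝ (rieszPotential β w) x := by
  have hκ := locallyIntegrable_rieszKernel (d := d) hd hβ
  have hconv : ∀ x, Integrable fun y => rieszKernel β (y - x) * w y := fun x => by
    have := (integrable_mul_comp_add hκ hw hb (fun y hy => hs y hy.le) x).comp_sub_right x
    simpa using this
  have e1 : rieszPotential β w = fun x => ∫ y, rieszKernel β (y - x) * w y := by
    ext x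
    rw [rieszPotential, if_neg hβ.ne',
      ← integral_sub_right_eq_self (fun z => rieszKernel β z * w (x + z)) x]
    simp
  -- Half the gap to the ball: points within `ε` of `x` stay at distance at least `ε` from every `y`
  -- with `‖y‖ < ρ`, away from the singularity.
  set ε := (‖x‖ - ρ) / 2 with hεdef
  have hε : 0 < ε := by rw [hεdef]; linarith
  obtain ⟨M, hM⟩ := exists_norm_fderiv_rieszKernel_le (d := d) β (N := ρ + ‖x‖ + ε) hε
  have hdist : ∀ x' ∈ Metric.ball x ε, ∀ y : 𝔼, ‖y‖ < ρ →
      ε ≤ ‖y - x'‖ ∧ ‖y - x'‖ ≤ ρ + ‖x‖ + ε := by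
    intro x' hx' y hy
    have h1 : ‖x' - x‖ < ε := by simpa [dist_eq_norm] using hx'
    have h2 : ‖x‖ ≤ ‖x'‖ + ‖x' - x‖ := by
      have := norm_sub_le x' (x' - x); rwa [sub_sub_cancel] at this
    have h3 : ‖x'‖ ≤ ‖x‖ + ‖x' - x‖ := by
      have := norm_add_le x (x' - x); rwa [add_sub_cancel] at this
    have h4 : ‖x'‖ ≤ ‖y‖ + ‖y - x'‖ := by
      have := norm_sub_le y (y - x'); rwa [sub_sub_cancel] at this
    have h5 := norm_sub_le y x'
    constructor <;> linarith
  rw [e1]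
  refine (hasFDerivAt_integral_of_dominated_of_fderiv_le (𝕜 := ℝ) (s := Metric.ball x ε)
    (F := fun x y => rieszKernel β (y - x) * w y)
    (F' := fun x y => w y • -(fderiv ℝ (rieszKernel β) (y - x)))
    (bound := fun y => |w y| * M) (Metric.ball_mem_nhds x hε) ?_ (hconv x) ?_ ?_ ?_ ?_).differentiableAt
  · exact Eventually.of_forall fun x => (hconv x).aestronglyMeasurable
  · refine Measurable.aestronglyMeasurable ?_
    exact hw.smul ((measurable_fderiv ℝ (rieszKernel β : 𝔼 → ℝ)).comp
      (measurable_id.sub_const x)).neg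
  · refine ae_of_all _ fun y x' hx' => ?_
    by_cases hy : ‖y‖ < ρ
    · obtain ⟨h1, h2⟩ := hdist x' hx' y hy
      rw [norm_smul, norm_neg, Real.norm_eq_abs]
      exact mul_le_mul_of_nonneg_left (hM _ h1 h2) (abs_nonneg _)
    · simp [hs y (not_lt.1 hy)]
  · refine Integrable.mul_const (Integrable.abs ?_) _
    refine (integrableOn_iff_integrable_of_support_subset (s := Metric.closedBall 0 ρ)
      fun y hy => ?_).1 ?_
    · rw [mem_closedBall_zero_iff]
      by_contra hc
      exact hy (hs y (not_le.1 hc).le)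
    · exact Measure.integrableOn_of_bounded (isCompact_closedBall _ _).measure_lt_top.ne
        hw.aestronglyMeasurable (ae_of_all _ hb)
  · refine ae_of_all _ fun y x' hx' => ?_
    by_cases hy : ‖y‖ < ρ
    · obtain ⟨h1, h2⟩ := hdist x' hx' y hy
      have hne : y - x' ≠ 0 := norm_pos_iff.1 (hε.trans_le h1)
      have hf := ((contDiffAt_rieszKernel β hne).differentiableAt (by norm_num)).hasFDerivAt
      have h6 : HasFDerivAt (fun x : 𝔼 => y - x) (-(ContinuousLinearMap.id ℝ 𝔼)) x' :=
        (hasFDerivAt_id x').const_sub y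
      have h7 := (hf.comp x' h6).mul_const (w y)
      refine h7.congr_fderiv ?_
      ext v; simp
    · simp only [hs y (not_lt.1 hy), mul_zero, zero_smul]
      exact hasFDerivAt_const _ _

lemma HasWeakGradient.congr_ae {f : 𝔼 → ℝ} {V U : 𝔼 → 𝔼} (h : HasWeakGradient f V)
    (hVU : V =ᵐ[volume] U) : HasWeakGradient f U := by
  refine ⟨h.1, ?_, fun ψ hψ hψc => ?_⟩
  · rw [locallyIntegrable_iff]
    exact fun K hK => (h.2.1.integrableOn_isCompact hK).congr (ae_restrict_of_ae hVU)
  · rw [h.2.2 ψ hψ hψc]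
    congr 1
    refine integral_congr_ae ?_
    filter_upwards [hVU] with x hx
    rw [hx]

lemma LocallyIntegrable.comp_sub_const {F : Type*} [NormedAddCommGroup F] {f : 𝔼 → F}
    (hf : LocallyIntegrable f) (a : 𝔼) : LocallyIntegrable fun x => f (x - a) := by
  rw [locallyIntegrable_iff]
  intro K hK
  have hK' : IsCompact ((fun y => y - a) '' K) := hK.image (by fun_prop)
  have hmp : MeasurePreserving (fun y : 𝔼 => y - a) volume volume :=
    measurePreserving_sub_right volume a
  exact (hmp.integrableOn_image (MeasurableEquiv.subRight a).measurableEmbedding).1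
    (hf.integrableOn_isCompact hK')

lemma HasWeakGradient.const_mul_comp_sub {f : 𝔼 → ℝ} {V : 𝔼 → 𝔼} (h : HasWeakGradient f V)
    (c : ℝ) (a : 𝔼) : HasWeakGradient (fun x => c * f (x - a)) fun x => c • V (x - a) := by
  refine ⟨?_, ?_, fun ψ hψ hψc => ?_⟩
  · rw [locallyIntegrable_iff]
    exact fun K hK => ((LocallyIntegrable.comp_sub_const h.1 a).integrableOn_isCompact
      hK).const_mul c
  · rw [locallyIntegrable_iff]
    exact fun K hK => ((LocallyIntegrable.comp_sub_const h.2.1 a).integrableOn_isCompact hK).smul c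
  · have hsm : ContDiff ℝ ∞ fun y => ψ (y + a) := hψ.comp (contDiff_id.add contDiff_const)
    have hsc : HasCompactSupport fun y => ψ (y + a) :=
      hψc.comp_homeomorph (Homeomorph.addRight a)
    have key := h.2.2 _ hsm hsc
    rw [← integral_sub_right_eq_self (fun x => f x • gradient (fun y => ψ (y + a)) x) a,
      ← integral_sub_right_eq_self (fun x => ψ (x + a) • V x) a] at key
    simp only [gradient, fderiv_comp_add_right, sub_add_cancel] at key
    simp only [mul_smul, integral_smul, smul_comm _ c]
    rw [← smul_neg, ← key]
    rfl

lemma rieszPotential_const_mul_comp_sub (β c : ℝ) (w : 𝔼 → ℝ) (a : 𝔼) :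
    rieszPotential β (fun x => c * w (x - a)) = fun x => c * rieszPotential β w (x - a) := by
  ext x
  unfold rieszPotential
  split_ifs
  · rfl
  · rw [← integral_const_mul]
    congr 1
    ext z
    simp only
    rw [show x + z - a = x - a + z by abel]
    ring

lemma integrable_ballPower {α ρ : ℝ} (hα : 0 < α) (hρ : 0 < ρ) :
    Integrable (ballPower α ρ : 𝔼 → ℝ) := by
  refine (continuous_ballPower hα ρ).integrable_of_hasCompactSupport ?_
  refine HasCompactSupport.intro (isCompact_closedBall (0 : 𝔼) ρ) fun x hx => ?_
  exact ballPower_eq_zero hα hρ (not_le.1 fun h => hx (mem_closedBall_zero_iff.2 h)).le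

lemma rieszConvergesAt_ballPower (hd : 0 < d) {α ρ : ℝ} (hα : 0 < α) (hα2 : α ≤ 2) (hρ : 0 < ρ)
    (c : ℝ) (a x : 𝔼) : RieszConvergesAt (2 - α) (fun x => c * ballPower α ρ (x - a)) x := by
  rcases hα2.eq_or_lt with rfl | h2
  · exact Or.inl (sub_self 2)
  right
  have h := (integrable_mul_comp_add (locallyIntegrable_rieszKernel (d := d) hd (sub_pos.2 h2))
    (measurable_ballPower α ρ) (C := ρ ^ 2 + 1) (r := ρ)
    (fun y => by rw [abs_of_nonneg (ballPower_nonneg _ _ _)]; exact ballPower_le hα hα2 y)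
    (fun y hy => ballPower_eq_zero hα hρ hy.le) (x - a)).const_mul c
  refine h.congr (ae_of_all _ fun z => ?_)
  simp only
  rw [show x + z - a = x - a + z by abel]
  ring

/-- A representative of the gradient of the potential `I_{2-α} (ρ² - |x|²)_+^{α/2}`. -/
def ballPotentialGrad (α m ρ : ℝ) (x : 𝔼) : 𝔼 :=
  if ‖x‖ < ρ then (-(selfSimExponent d α m / barenblattConst d α m)) • x
  else rieszPotentialVec (2 - α) (ballPowerGrad α ρ) x

lemma ballPowerGrad_eq_zero (α : ℝ) {ρ : ℝ} {y : 𝔼} (hy : ρ ≤ ‖y‖) : ballPowerGrad α ρ y = 0 := by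
  rw [ballPowerGrad, if_neg hy.not_gt, zero_smul]

/-- The convolved gradient agrees almost everywhere in the open ball with that of the quadratic, so
it may be overwritten there by the explicit field. -/
lemma hasWeakGradient_rieszPotential_ballPower (hd : 0 < d) {α m ρ : ℝ} (hα : 0 < α) (hα2 : α ≤ 2)
    (hm : 1 < m) (hρ : 0 < ρ) :
    HasWeakGradient (rieszPotential (2 - α) (ballPower α ρ : 𝔼 → ℝ)) (ballPotentialGrad α m ρ) := by
  have h := (hasWeakGradient_ballPower hd hα hα2 hρ).rieszPotential hd (sub_nonneg.2 hα2)
    (integrable_ballPower hα hρ) (integrable_ballPowerGrad hd hα hα2 hρ) (M := ρ)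
    (fun y hy => ballPower_eq_zero hα hρ hy.le) (fun y hy => ballPowerGrad_eq_zero α hy.le)
  refine h.congr_ae ?_
  obtain ⟨A, hA⟩ := rieszPotential_ballPower (m := m) hd ρ hα hα2 hm
  have h2 := h.ae_eq_of_eqOn (hasWeakGradient_quadratic A
    (selfSimExponent d α m / (2 * barenblattConst d α m))) (Metric.isOpen_ball (x := 0) (ε := ρ))
    fun x hx => hA x (mem_ball_zero_iff.1 hx)
  filter_upwards [h2] with x hx
  rw [ballPotentialGrad]
  split_ifs with hxρ
  · rw [hx (mem_ball_zero_iff.2 hxρ)]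
    congr 2
    rw [mul_div_assoc', mul_div_mul_left _ _ two_ne_zero]
  · rfl

/-- The classical gradient of the potential. -/
lemma hasGradientAt_rieszPotential_ballPower (hd : 0 < d) {α m ρ : ℝ} (hα : 0 < α) (hα2 : α ≤ 2)
    (hm : 1 < m) {x : 𝔼} (hx : ‖x‖ < ρ) :
    HasGradientAt (rieszPotential (2 - α) (ballPower α ρ : 𝔼 → ℝ))
      ((-(selfSimExponent d α m / barenblattConst d α m)) • x) x := by
  obtain ⟨A, hA⟩ := rieszPotential_ballPower (d := d) (m := m) hd ρ hα hα2 hm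
  have h1 : HasFDerivAt (fun x : 𝔼 => A - selfSimExponent d α m / (2 * barenblattConst d α m) *
      ‖x‖ ^ 2) (-((selfSimExponent d α m / (2 * barenblattConst d α m)) • (2 • innerSL ℝ x))) x :=
    (((hasStrictFDerivAt_norm_sq x).hasFDerivAt).const_mul _).const_sub A
  have h2 : rieszPotential (2 - α) (ballPower α ρ : 𝔼 → ℝ) =ᶠ[𝓝 x]
      fun x : 𝔼 => A - selfSimExponent d α m / (2 * barenblattConst d α m) * ‖x‖ ^ 2 := by
    filter_upwards [Metric.isOpen_ball.mem_nhds (mem_ball_zero_iff.2 hx)] with y hy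
    exact hA y (mem_ball_zero_iff.1 hy)
  rw [hasGradientAt_iff_hasFDerivAt]
  refine (h1.congr_of_eventuallyEq h2).congr_fderiv ?_
  ext v
  simp only [neg_apply, smul_apply, innerSL_apply_apply,
    InnerProductSpace.toDual_apply_apply, real_inner_smul_left, smul_eq_mul, nsmul_eq_mul]
  rw [← div_div]
  push_cast
  ring

lemma differentiableAt_rieszPotential_ballPower (hd : 0 < d) {α ρ : ℝ} (hα : 0 < α) (hα2 : α ≤ 2)
    (hρ : 0 < ρ) {x : 𝔼} (hx : ρ < ‖x‖) :
    DifferentiableAt ℝ (rieszPotential (2 - α) (ballPower α ρ : 𝔼 → ℝ)) x := by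
  rcases hα2.eq_or_lt with rfl | h2
  · have : rieszPotential (2 - 2) (ballPower 2 ρ : 𝔼 → ℝ) =ᶠ[𝓝 x] fun _ => 0 := by
      filter_upwards [(isOpen_lt continuous_const continuous_norm).mem_nhds hx] with y hy
      rw [rieszPotential, if_pos (sub_self 2), ballPower_eq_zero hα hρ (le_of_lt hy)]
    exact this.differentiableAt_iff.2 (differentiableAt_const 0)
  · exact differentiableAt_rieszPotential hd (sub_pos.2 h2) (measurable_ballPower α ρ)
      (C := ρ ^ 2 + 1)
      (fun y => by rw [abs_of_nonneg (ballPower_nonneg _ _ _)]; exact ballPower_le hα hα2 y)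
      (fun y hy => ballPower_eq_zero hα hρ hy) hx

/-! ### The profile and its self-similar scaling -/

lemma selfSim_denom_pos (hd : 0 < d) {α m : ℝ} (hα : 0 < α) (hm : 1 < m) :
    0 < (d : ℝ) * (m - 1) + α := by
  have : (0 : ℝ) < (d : ℝ) := by exact_mod_cast hd
  have : 0 < (d : ℝ) * (m - 1) := mul_pos this (by linarith)
  linarith

lemma selfSimExponent_pos (hd : 0 < d) {α m : ℝ} (hα : 0 < α) (hm : 1 < m) :
    0 < selfSimExponent d α m :=
  one_div_pos.2 (selfSim_denom_pos hd hα hm)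

lemma barenblattConst_pos (hd : 0 < d) {α m : ℝ} (hα : 0 < α) (hm : 1 < m) :
    0 < barenblattConst d α m := by
  have h0 := selfSim_denom_pos hd hα hm
  have : (0 : ℝ) < (d : ℝ) := by exact_mod_cast hd
  have h1 := Real.Gamma_pos_of_pos (show 0 < (d : ℝ) / 2 by positivity)
  have h2 := Real.Gamma_pos_of_pos (show 0 < 1 + α / 2 by positivity)
  have h3 := Real.Gamma_pos_of_pos (show 0 < ((d : ℝ) + α) / 2 by positivity)
  rw [barenblattConst]
  positivity

lemma barenblattProfile_eq (d : ℕ) (α m R : ℝ) (y : EuclideanSpace ℝ (Fin d)) :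
    barenblattProfile d α m R y = (barenblattConst d α m * ballPower α R y) ^ (1 / (m - 1)) := rfl

lemma barenblattProfile_nonneg (hd : 0 < d) {α m : ℝ} (hα : 0 < α) (hm : 1 < m) (R : ℝ) (y : 𝔼) :
    0 ≤ barenblattProfile d α m R y :=
  Real.rpow_nonneg (mul_nonneg (barenblattConst_pos hd hα hm).le (ballPower_nonneg _ _ _)) _

lemma barenblattProfile_rpow (hd : 0 < d) {α m : ℝ} (hα : 0 < α) (hm : 1 < m) (R : ℝ) (y : 𝔼) :
    barenblattProfile d α m R y ^ (m - 1) = barenblattConst d α m * ballPower α R y := by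
  rw [barenblattProfile_eq, one_div, Real.rpow_inv_rpow
    (mul_nonneg (barenblattConst_pos hd hα hm).le (ballPower_nonneg _ _ _)) (by linarith)]

lemma barenblattProfile_eq_zero {α m R : ℝ} (hα : 0 < α) (hm : 1 < m) (hR : 0 < R) {y : 𝔼}
    (hy : R ≤ ‖y‖) : barenblattProfile d α m R y = 0 := by
  have : 0 < 1 / (m - 1) := one_div_pos.2 (by linarith)
  rw [barenblattProfile_eq, ballPower_eq_zero hα hR hy, mul_zero, Real.zero_rpow this.ne']

lemma continuous_barenblattProfile {α m : ℝ} (hα : 0 < α) (hm : 1 < m) (R : ℝ) :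
    Continuous (barenblattProfile d α m R) := by
  have : 0 < 1 / (m - 1) := one_div_pos.2 (by linarith)
  exact (continuous_const.mul (continuous_ballPower hα R)).rpow_const fun _ => Or.inr this.le

lemma barenblatt_eq (d : ℕ) (α m R : ℝ) {t : ℝ} (ht : 0 < t) (x : EuclideanSpace ℝ (Fin d)) :
    barenblatt d α m R t x = t ^ (-((d : ℝ) * selfSimExponent d α m)) *
      barenblattProfile d α m R (t ^ (-selfSimExponent d α m) • x) := by
  have h1 : ‖t ^ (-selfSimExponent d α m) • x‖ ^ 2 =
      ‖x‖ ^ 2 * t ^ (-(2 / ((d : ℝ) * (m - 1) + α))) := by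
    rw [norm_smul, Real.norm_of_nonneg (by positivity), mul_pow, mul_comm, ← Real.rpow_natCast
      (t ^ _), ← Real.rpow_mul ht.le, selfSimExponent]
    congr 2
    push_cast
    ring
  rw [barenblatt, barenblattProfile, h1, selfSimExponent, mul_one_div]

lemma ballPower_smul {α R : ℝ} {s : ℝ} (hs : 0 < s) (x : 𝔼) :
    ballPower α R (s • x) = s ^ α * ballPower α (R / s) x := by
  have h1 : max (R ^ 2 - ‖s • x‖ ^ 2) 0 = s ^ 2 * max ((R / s) ^ 2 - ‖x‖ ^ 2) 0 := by
    rw [mul_max_of_nonneg _ _ (by positivity), mul_zero, norm_smul, Real.norm_of_nonneg hs.le]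
    congr 1
    field_simp
  rw [ballPower, h1, Real.mul_rpow (by positivity) (le_max_right _ _), ballPower,
    ← Real.rpow_natCast, ← Real.rpow_mul hs.le]
  congr 2
  push_cast
  ring

lemma barenblatt_nonneg (hd : 0 < d) {α m : ℝ} (hα : 0 < α) (hm : 1 < m) (R : ℝ) {t : ℝ}
    (ht : 0 < t) (x : 𝔼) : 0 ≤ barenblatt d α m R t x := by
  rw [barenblatt_eq d α m R ht]
  exact mul_nonneg (by positivity) (barenblattProfile_nonneg hd hα hm R _)

/-- The choice of `λ` enters here: `-dλ(m-1) - λα = -1`, so the powers of `t` combine to `1/t` on a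
ball of radius `R t^λ`. -/
lemma abs_barenblatt_rpow (hd : 0 < d) {α m : ℝ} (hα : 0 < α) (hm : 1 < m) (R : ℝ) {t : ℝ}
    (ht : 0 < t) (x : 𝔼) : |barenblatt d α m R t x| ^ (m - 1) =
      barenblattConst d α m / t * ballPower α (R * t ^ selfSimExponent d α m) x := by
  have h0 := selfSim_denom_pos hd hα hm
  rw [abs_of_nonneg (barenblatt_nonneg hd hα hm R ht x), barenblatt_eq d α m R ht,
    Real.mul_rpow (by positivity) (barenblattProfile_nonneg hd hα hm R _),
    barenblattProfile_rpow hd hα hm, ballPower_smul (by positivity), ← Real.rpow_mul ht.le,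
    ← Real.rpow_mul ht.le, Real.rpow_neg ht.le (selfSimExponent d α m), div_inv_eq_mul]
  have h1 : t ^ (-((d : ℝ) * selfSimExponent d α m) * (m - 1)) *
      t ^ (-selfSimExponent d α m * α) = t⁻¹ := by
    rw [← Real.rpow_add ht, ← Real.rpow_neg_one]
    congr 1
    rw [selfSimExponent]
    field_simp
    ring
  rw [div_eq_mul_inv, ← h1]
  ring

lemma barenblatt_eq_zero {α m R : ℝ} (hα : 0 < α) (hm : 1 < m) (hR : 0 < R) {t : ℝ} (ht : 0 < t)
    {x : 𝔼} (hx : R * t ^ selfSimExponent d α m ≤ ‖x‖) : barenblatt d α m R t x = 0 := by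
  rw [barenblatt_eq d α m R ht, barenblattProfile_eq_zero hα hm hR, mul_zero]
  rw [norm_smul, Real.norm_of_nonneg (by positivity), Real.rpow_neg ht.le, ← div_eq_inv_mul,
    le_div_iff₀ (by positivity)]
  exact hx

lemma hasCompactSupport_barenblatt {α m R : ℝ} (hα : 0 < α) (hm : 1 < m) (hR : 0 < R)
    {t : ℝ} (ht : 0 < t) : HasCompactSupport (barenblatt d α m R t) :=
  HasCompactSupport.intro (isCompact_closedBall (0 : 𝔼) (R * t ^ selfSimExponent d α m))
    fun _ hx => barenblatt_eq_zero hα hm hR ht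
      (not_le.1 fun h => hx (mem_closedBall_zero_iff.2 h)).le

/-- The gradient field in the equation is explicit where the solution is positive. -/
lemma smul_ballPotentialGrad (hd : 0 < d) {α m ρ : ℝ} (hα : 0 < α) (hm : 1 < m) (t a : ℝ) {x : 𝔼}
    (ha : ρ ≤ ‖x‖ → a = 0) :
    a • ((barenblattConst d α m / t) • ballPotentialGrad α m ρ x) =
      a • (-(selfSimExponent d α m / t)) • x := by
  by_cases hx : ‖x‖ < ρ
  · have := (barenblattConst_pos hd hα hm).ne'
    rw [ballPotentialGrad, if_pos hx, smul_smul (barenblattConst d α m / t)]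
    congr 2
    field_simp
  · rw [ha (not_lt.1 hx), zero_smul, zero_smul]

lemma isFracGradient_ballPower (hd : 0 < d) {α m ρ : ℝ} (hα : 0 < α) (hα2 : α ≤ 2)
    (hm : 1 < m) (hρ : 0 < ρ) (c : ℝ) (a : 𝔼) :
    IsFracGradient α (fun x => c * ballPower α ρ (x - a))
      fun x => c • ballPotentialGrad α m ρ (x - a) := by
  refine ⟨ae_of_all _ fun x => rieszConvergesAt_ballPower hd hα hα2 hρ c a x, ?_⟩
  rw [rieszPotential_const_mul_comp_sub]
  exact (hasWeakGradient_rieszPotential_ballPower hd hα hα2 hm hρ).const_mul_comp_sub c a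

/-- The two fluxes agree at every point by `hV`, so the integrands coincide for every test function.
-/
lemma isProfileSolution_barenblattProfile (hd : 0 < d) {α m R : ℝ} (hα : 0 < α) (hα2 : α ≤ 2)
    (hm : 1 < m) (hR : 0 < R) : IsProfileSolution α m (barenblattProfile d α m R) := by
  have hV : ∀ y : 𝔼, barenblattProfile d α m R y •
      (barenblattConst d α m • ballPotentialGrad α m R y) =
        barenblattProfile d α m R y • (-(selfSimExponent d α m)) • y := by
    intro y
    have := smul_ballPotentialGrad hd hα hm 1 (barenblattProfile d α m R y) (x := y)
      (fun h => barenblattProfile_eq_zero hα hm hR h)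
    simpa using this
  have hc := continuous_barenblattProfile (d := d) hα hm R
  refine ⟨barenblattProfile_nonneg hd hα hm R,
    fun y => barenblattConst d α m • ballPotentialGrad α m R y, ?_, ?_, ?_, ?_⟩
  · have := isFracGradient_ballPower hd hα hα2 hm hR (barenblattConst d α m) (0 : 𝔼)
    simp only [sub_zero] at this
    simpa only [barenblattProfile_rpow hd hα hm] using this
  · exact (hc.smul continuous_id).locallyIntegrable
  · simp only [hV]
    exact Continuous.locallyIntegrable (by fun_prop)
  · intro ψ _ _
    rw [← integral_const_mul, ← integral_neg]
    refine integral_congr_ae (ae_of_all _ fun y => ?_)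
    simp only
    rw [← real_inner_smul_left (barenblattConst d α m • _), hV, real_inner_smul_left,
      real_inner_smul_left]
    ring

/-! ### Space-time integrability on strips -/

/-- The intermediate time `t₁` is there because test functions are controlled only on `[t₀, T)`:
continuity up to `t₁` and vanishing afterwards suffice. -/
lemma integrableOn_strip_of_continuousOn {F : Type*} [NormedAddCommGroup F] {t₀ t₁ T : ℝ}
    {f : ℝ × 𝔼 → F} (hf : ContinuousOn f (Icc t₀ t₁ ×ˢ univ)) {N : ℝ} {K : Set 𝔼}
    (hK : MeasurableSet K)
    (h0 : ∀ t ∈ Ioo t₀ T, ∀ x ∈ K, t₁ < t ∨ N < ‖x‖ → f (t, x) = 0) :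
    IntegrableOn f (Ioo t₀ T ×ˢ K) := by
  have h1 : IntegrableOn f (Icc t₀ t₁ ×ˢ Metric.closedBall 0 N) :=
    (hf.mono (prod_mono_right (subset_univ _))).integrableOn_compact
      (isCompact_Icc.prod (isCompact_closedBall _ _))
  refine h1.of_forall_sdiff_eq_zero (measurableSet_Ioo.prod hK) fun p hp => ?_
  refine h0 p.1 hp.1.1 p.2 hp.1.2 ?_
  by_contra hc
  push Not at hc
  exact hp.2 ⟨⟨hp.1.1.1.le, hc.1⟩, mem_closedBall_zero_iff.2 hc.2⟩

lemma continuousOn_rpow_fst (a : ℝ) {s : Set ℝ} (hs : ∀ t ∈ s, 0 < t) (K : Set 𝔼) :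
    ContinuousOn (fun p : ℝ × 𝔼 => p.1 ^ a) (s ×ˢ K) :=
  continuousOn_fst.rpow_const fun p hp => Or.inl (hs p.1 hp.1).ne'

lemma continuousOn_barenblatt {α m : ℝ} (hα : 0 < α) (hm : 1 < m) (R : ℝ) (x₀ : 𝔼) {s : Set ℝ}
    (hs : ∀ t ∈ s, 0 < t) :
    ContinuousOn (fun p : ℝ × 𝔼 => barenblatt d α m R p.1 (p.2 - x₀)) (s ×ˢ univ) := by
  have h : ContinuousOn (fun p : ℝ × 𝔼 => p.1 ^ (-((d : ℝ) * selfSimExponent d α m)) *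
      barenblattProfile d α m R (p.1 ^ (-selfSimExponent d α m) • (p.2 - x₀))) (s ×ˢ univ) := by
    refine (continuousOn_rpow_fst _ hs univ).mul
      ((continuous_barenblattProfile hα hm R).comp_continuousOn ?_)
    exact (continuousOn_rpow_fst _ hs univ).smul (by fun_prop)
  exact h.congr fun p hp => barenblatt_eq d α m R (hs p.1 hp.1) _

lemma barenblatt_eq_zero_of_lt_norm (hd : 0 < d) {α m R : ℝ} (hα : 0 < α) (hm : 1 < m) (hR : 0 < R)
    {t T : ℝ} (ht : 0 < t) (htT : t ≤ T) {x x₀ : 𝔼}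
    (hx : R * T ^ selfSimExponent d α m + ‖x₀‖ < ‖x‖) : barenblatt d α m R t (x - x₀) = 0 := by
  refine barenblatt_eq_zero hα hm hR ht ?_
  have h1 : ‖x‖ ≤ ‖x - x₀‖ + ‖x₀‖ := by
    have := norm_add_le (x - x₀) x₀; rwa [sub_add_cancel] at this
  have h2 : t ^ selfSimExponent d α m ≤ T ^ selfSimExponent d α m :=
    Real.rpow_le_rpow ht.le htT (selfSimExponent_pos hd hα hm).le
  nlinarith

lemma ballPowerGrad_eq_smul {α ρ : ℝ} (hρ : 0 < ρ) (x : 𝔼) :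
    ballPowerGrad α ρ x = ρ ^ (α - 1) • ballPowerGrad α 1 (ρ⁻¹ • x) := by
  have h1 : ‖ρ⁻¹ • x‖ = ‖x‖ / ρ := by
    rw [norm_smul, norm_inv, Real.norm_of_nonneg hρ.le, ← div_eq_inv_mul]
  rw [ballPowerGrad, ballPowerGrad, h1, smul_smul, smul_smul]
  simp only [div_lt_one hρ]
  split_ifs with h
  · have h2 : ρ ^ 2 - ‖x‖ ^ 2 = ρ ^ 2 * (1 ^ 2 - (‖x‖ / ρ) ^ 2) := by field_simp
    have h3 : 0 ≤ 1 ^ 2 - (‖x‖ / ρ) ^ 2 := by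
      have : ‖x‖ / ρ < 1 := (div_lt_one hρ).2 h
      have : 0 ≤ ‖x‖ / ρ := by positivity
      nlinarith
    rw [h2, Real.mul_rpow (by positivity) h3, ← Real.rpow_natCast ρ 2, ← Real.rpow_mul hρ.le]
    have h4 : ρ ^ (((2 : ℕ) : ℝ) * (α / 2 - 1)) = ρ ^ (α - 1) * ρ⁻¹ := by
      rw [← Real.rpow_neg_one, ← Real.rpow_add hρ]; congr 1; push_cast; ring
    rw [h4]
    congr 1
    ring
  · simp

/-- Scaling to the unit ball makes the `L¹` norm an explicit power of `ρ`, hence continuous in time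
along `ρ = R t^λ`. -/
lemma integral_norm_ballPowerGrad {α ρ : ℝ} (hρ : 0 < ρ) :
    ∫ x : 𝔼, ‖ballPowerGrad α ρ x‖ =
      ρ ^ (α - 1) * (ρ ^ d * ∫ x : 𝔼, ‖ballPowerGrad α 1 x‖) := by
  have h := Measure.integral_comp_inv_smul_of_nonneg (volume : Measure 𝔼)
    (fun x => ‖ballPowerGrad α 1 x‖) hρ.le
  rw [finrank_euclideanSpace_fin, smul_eq_mul] at h
  rw [← h, ← integral_const_mul]
  refine integral_congr_ae (ae_of_all _ fun x => ?_)
  simp only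
  rw [ballPowerGrad_eq_smul hρ, norm_smul, Real.norm_of_nonneg (by positivity)]

lemma integrableOn_strip_ballPowerGrad (hd : 0 < d) {α m R : ℝ} (hα : 0 < α) (hα2 : α ≤ 2)
    (hR : 0 < R) {t₀ T : ℝ} (ht₀ : 0 < t₀) (x₀ : 𝔼) :
    IntegrableOn (fun p : ℝ × 𝔼 => (barenblattConst d α m / p.1) •
      ballPowerGrad α (R * p.1 ^ selfSimExponent d α m) (p.2 - x₀)) (Ioo t₀ T ×ˢ univ) := by
  have hρ : ∀ t ∈ Ioo t₀ T, 0 < R * t ^ selfSimExponent d α m := fun t ht => by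
    have := ht₀.trans ht.1; positivity
  have hmeas : Measurable fun p : ℝ × 𝔼 => (barenblattConst d α m / p.1) •
      ballPowerGrad α (R * p.1 ^ selfSimExponent d α m) (p.2 - x₀) := by
    unfold ballPowerGrad
    have hc : Measurable fun p : ℝ × 𝔼 => barenblattConst d α m / p.1 := by fun_prop
    have hx : Measurable fun p : ℝ × 𝔼 => p.2 - x₀ := by fun_prop
    have h : Measurable fun p : ℝ × 𝔼 => -α * ((R * p.1 ^ selfSimExponent d α m) ^ 2 -
      ‖p.2 - x₀‖ ^ 2) ^ (α / 2 - 1) := by fun_prop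
    exact hc.smul ((Measurable.ite (measurableSet_lt (by fun_prop) (by fun_prop)) h
      measurable_const).smul hx)
  have hm : (volume : Measure (ℝ × 𝔼)).restrict (Ioo t₀ T ×ˢ univ) =
      (volume.restrict (Ioo t₀ T)).prod volume := by
    rw [Measure.volume_eq_prod, ← Measure.prod_restrict, Measure.restrict_univ]
  rw [IntegrableOn, hm, integrable_prod_iff hmeas.aestronglyMeasurable]
  constructor
  · refine (ae_restrict_mem measurableSet_Ioo).mono fun t ht => ?_
    exact ((integrable_ballPowerGrad hd hα hα2 (hρ t ht)).comp_sub_right x₀).smul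
      (barenblattConst d α m / t)
  · have hcont : ContinuousOn (fun t : ℝ => |barenblattConst d α m / t| *
        ((R * t ^ selfSimExponent d α m) ^ (α - 1) * ((R * t ^ selfSimExponent d α m) ^ d *
          ∫ x : 𝔼, ‖ballPowerGrad α 1 x‖))) (Icc t₀ T) := by
      have hpos : ∀ t ∈ Icc t₀ T, 0 < t := fun t ht => ht₀.trans_le ht.1
      have h1 : ContinuousOn (fun t : ℝ => R * t ^ selfSimExponent d α m) (Icc t₀ T) :=
        continuousOn_const.mul
          (continuousOn_id.rpow_const fun t ht => Or.inl (hpos t ht).ne')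
      refine ContinuousOn.mul (continuousOn_const.div continuousOn_id
        fun t ht => (hpos t ht).ne').abs (ContinuousOn.mul (h1.rpow_const fun t ht => Or.inl ?_)
          ((h1.pow d).mul continuousOn_const))
      have := hpos t ht
      positivity
    refine ((hcont.integrableOn_compact isCompact_Icc).mono_set Ioo_subset_Icc_self).congr_fun
      (fun t ht => ?_) measurableSet_Ioo
    simp only [norm_smul, Real.norm_eq_abs]
    rw [integral_const_mul, integral_sub_right_eq_self
      (fun x => ‖ballPowerGrad α (R * t ^ selfSimExponent d α m) x‖) x₀,
      integral_norm_ballPowerGrad (hρ t ht)]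

/-- Space-time integrability of the potential of a field on a strip. -/
lemma integrableOn_strip_integral_smul {F : Type*} [NormedAddCommGroup F] [NormedSpace ℝ F]
    {κ : 𝔼 → ℝ} (hκ : LocallyIntegrable κ) {t₀ T : ℝ} {g : ℝ × 𝔼 → F}
    (hg : IntegrableOn g (Ioo t₀ T ×ˢ univ)) {M : ℝ}
    (hs : ∀ t ∈ Ioo t₀ T, ∀ y, M < ‖y‖ → g (t, y) = 0) {K : Set 𝔼} (hK : IsCompact K) :
    IntegrableOn (fun p : ℝ × 𝔼 => ∫ z, κ z • g (p.1, p.2 + z)) (Ioo t₀ T ×ˢ K) := by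
  have hm (s : Set 𝔼) : (volume : Measure (ℝ × 𝔼)).restrict (Ioo t₀ T ×ˢ s) =
      (volume.restrict (Ioo t₀ T)).prod (volume.restrict s) := by
    rw [Measure.volume_eq_prod, ← Measure.prod_restrict]
  have hms : MeasurableSet (Ioo t₀ T ×ˢ (univ : Set 𝔼)) := measurableSet_Ioo.prod .univ
  have hg' : Integrable ((Ioo t₀ T ×ˢ (univ : Set 𝔼)).indicator g)
      ((volume.restrict (Ioo t₀ T)).prod volume) := by
    have h2 := hm univ
    rw [Measure.restrict_univ] at h2
    rw [← h2]
    exact (hg.integrable_indicator hms).restrict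
  have h := integrable_smul_comp_add_time hκ hg' (M := M) (fun t y hy => by
    by_cases ht : t ∈ Ioo t₀ T
    · rw [indicator_of_mem (show (t, y) ∈ Ioo t₀ T ×ˢ (univ : Set 𝔼) from ⟨ht, mem_univ _⟩)]
      exact hs t ht y hy
    · exact indicator_of_notMem (fun hc => ht hc.1) _) hK
  have h2 := h.integral_prod_right
  rw [← hm] at h2
  refine IntegrableOn.congr_fun h2 (fun p hp => ?_) (measurableSet_Ioo.prod hK.measurableSet)
  simp only
  congr 1
  ext1 z
  rw [indicator_of_mem (show (p.1, p.2 + z) ∈ Ioo t₀ T ×ˢ (univ : Set 𝔼) from ⟨hp.1, mem_univ _⟩)]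

lemma continuousOn_abs_barenblatt_rpow {α m : ℝ} (hα : 0 < α) (hm : 1 < m) (R : ℝ) (x₀ : 𝔼)
    {s : Set ℝ} (hs : ∀ t ∈ s, 0 < t) :
    ContinuousOn (fun p : ℝ × 𝔼 => |barenblatt d α m R p.1 (p.2 - x₀)| ^ (m - 1)) (s ×ˢ univ) :=
  (continuousOn_barenblatt hα hm R x₀ hs).abs.rpow_const fun _ _ => Or.inr (by linarith)

lemma integrableOn_strip_rieszPotential (hd : 0 < d) {α m R : ℝ} (hα : 0 < α) (hα2 : α ≤ 2)
    (hm : 1 < m) (hR : 0 < R) {t₀ T : ℝ} (ht₀ : 0 < t₀) (x₀ : 𝔼) {K : Set 𝔼} (hK : IsCompact K) :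
    IntegrableOn (fun p : ℝ × 𝔼 => rieszPotential (2 - α)
      (fun x => |barenblatt d α m R p.1 (x - x₀)| ^ (m - 1)) p.2) (Ioo t₀ T ×ˢ K) := by
  have hpos : ∀ t ∈ Icc t₀ T, 0 < t := fun t ht => ht₀.trans_le ht.1
  have hc := continuousOn_abs_barenblatt_rpow (d := d) hα hm R x₀ hpos
  have h0 : ∀ t ∈ Ioo t₀ T, ∀ x : 𝔼, R * T ^ selfSimExponent d α m + ‖x₀‖ < ‖x‖ →
      |barenblatt d α m R t (x - x₀)| ^ (m - 1) = 0 := fun t ht x hx => by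
    rw [barenblatt_eq_zero_of_lt_norm hd hα hm hR (ht₀.trans ht.1) ht.2.le hx, abs_zero,
      Real.zero_rpow (by linarith)]
  have hint : IntegrableOn (fun p : ℝ × 𝔼 => |barenblatt d α m R p.1 (p.2 - x₀)| ^ (m - 1))
      (Ioo t₀ T ×ˢ univ) :=
    integrableOn_strip_of_continuousOn hc MeasurableSet.univ fun t ht x _ hx =>
      h0 t ht x (hx.resolve_left ht.2.not_gt)
  rcases hα2.eq_or_lt with rfl | h2
  · simp only [rieszPotential, if_pos (sub_self (2 : ℝ))]
    exact hint.mono_set (prod_mono_right (subset_univ _))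
  · simp only [rieszPotential, if_neg (sub_pos.2 h2).ne']
    exact integrableOn_strip_integral_smul
      (locallyIntegrable_rieszKernel hd (sub_pos.2 h2)) hint h0 hK

/-- The field is glued from two integrable ones along the moving sphere: the explicit linear field
inside and the convolution outside. -/
lemma integrableOn_strip_ballPotentialGrad (hd : 0 < d) {α m R : ℝ} (hα : 0 < α) (hα2 : α ≤ 2)
    (hm : 1 < m) (hR : 0 < R) {t₀ T : ℝ} (ht₀ : 0 < t₀) (x₀ : 𝔼) {K : Set 𝔼} (hK : IsCompact K) :
    IntegrableOn (fun p : ℝ × 𝔼 => (barenblattConst d α m / p.1) •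
      ballPotentialGrad α m (R * p.1 ^ selfSimExponent d α m) (p.2 - x₀)) (Ioo t₀ T ×ˢ K) := by
  have hpos : ∀ t ∈ Icc t₀ T, 0 < t := fun t ht => ht₀.trans_le ht.1
  have hg := integrableOn_strip_ballPowerGrad (m := m) (T := T) hd hα hα2 hR ht₀ x₀
  have h1 : IntegrableOn (fun p : ℝ × 𝔼 => (barenblattConst d α m / p.1) •
      rieszPotentialVec (2 - α) (ballPowerGrad α (R * p.1 ^ selfSimExponent d α m)) (p.2 - x₀))
      (Ioo t₀ T ×ˢ K) := by
    rcases hα2.eq_or_lt with rfl | h2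
    · simp only [rieszPotentialVec, if_pos (sub_self (2 : ℝ))]
      exact hg.mono_set (prod_mono_right (subset_univ _))
    · have h := integrableOn_strip_integral_smul (locallyIntegrable_rieszKernel hd (sub_pos.2 h2))
        hg (M := R * T ^ selfSimExponent d α m + ‖x₀‖) (fun t ht y hy => ?_) hK
      · refine h.congr_fun (fun p _ => ?_) (measurableSet_Ioo.prod hK.measurableSet)
        simp only [rieszPotentialVec, if_neg (sub_pos.2 h2).ne']
        rw [← integral_smul]
        congr 1
        ext1 z
        rw [smul_comm, show p.2 + z - x₀ = p.2 - x₀ + z by abel]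
      · have ht0 := ht₀.trans ht.1
        have e1 : ‖y‖ ≤ ‖y - x₀‖ + ‖x₀‖ := by
          have := norm_add_le (y - x₀) x₀; rwa [sub_add_cancel] at this
        have e2 : t ^ selfSimExponent d α m ≤ T ^ selfSimExponent d α m :=
          Real.rpow_le_rpow ht0.le ht.2.le (selfSimExponent_pos hd hα hm).le
        simp only
        rw [ballPowerGrad_eq_zero α (by nlinarith), smul_zero]
  have h2 : IntegrableOn (fun p : ℝ × 𝔼 => (barenblattConst d α m / p.1) •
      (-(selfSimExponent d α m / barenblattConst d α m)) • (p.2 - x₀)) (Ioo t₀ T ×ˢ K) := by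
    have : ContinuousOn (fun p : ℝ × 𝔼 => (barenblattConst d α m / p.1) •
      (-(selfSimExponent d α m / barenblattConst d α m)) • (p.2 - x₀)) (Icc t₀ T ×ˢ K) :=
      (continuousOn_const.div continuousOn_fst fun p hp => (hpos _ hp.1).ne').smul (by fun_prop)
    exact (this.integrableOn_compact (isCompact_Icc.prod hK)).mono_set
      (prod_mono_left Ioo_subset_Icc_self)
  have hS : MeasurableSet {p : ℝ × 𝔼 | ‖p.2 - x₀‖ < R * p.1 ^ selfSimExponent d α m} :=
    measurableSet_lt (by fun_prop) (by fun_prop)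
  refine (((show Integrable _ _ from h2).indicator hS).add
    ((show Integrable _ _ from h1).indicator hS.compl)).congr (ae_of_all _ fun p => ?_)
  simp only [Pi.add_apply]
  by_cases hp : ‖p.2 - x₀‖ < R * p.1 ^ selfSimExponent d α m
  · simp [indicator, ballPotentialGrad, hp]
  · simp [indicator, ballPotentialGrad, hp]

/-! ### Transport along the flow and the weak formulation -/

/-- Under `x = x₀ + t^λ y` the Jacobian `t^{dλ}` cancels the amplitude `t^{-dλ}`: the flow carries
the mass of the profile unchanged. -/
lemma integral_barenblatt_mul {α m R : ℝ} {t : ℝ} (ht : 0 < t) (x₀ : 𝔼) (f : 𝔼 → ℝ) :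
    ∫ x, barenblatt d α m R t (x - x₀) * f x =
      ∫ y, barenblattProfile d α m R y * f (x₀ + t ^ selfSimExponent d α m • y) := by
  have hs : 0 < t ^ selfSimExponent d α m := by positivity
  have h := Measure.integral_comp_smul_of_nonneg (volume : Measure 𝔼)
    (fun x => barenblatt d α m R t x * f (x₀ + x)) (t ^ selfSimExponent d α m) (hR := hs.le)
  rw [finrank_euclideanSpace_fin, smul_eq_mul] at h
  have h2 : ∫ x, barenblatt d α m R t (x - x₀) * f x = ∫ x, barenblatt d α m R t x * f (x₀ + x) := by
    rw [← integral_add_left_eq_self (fun x => barenblatt d α m R t (x - x₀) * f x) x₀]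
    simp
  rw [h2, ← mul_inv_cancel_left₀ (pow_pos hs d).ne' (∫ x, barenblatt d α m R t x * f (x₀ + x)), ← h,
    ← integral_const_mul]
  refine integral_congr_ae (ae_of_all _ fun y => ?_)
  simp only
  have h3 : t ^ (-selfSimExponent d α m) • t ^ selfSimExponent d α m • y = y := by
    rw [smul_smul, ← Real.rpow_add ht]; simp
  have h4 : (t ^ selfSimExponent d α m) ^ d * t ^ (-((d : ℝ) * selfSimExponent d α m)) = 1 := by
    rw [← Real.rpow_natCast, ← Real.rpow_mul ht.le, ← Real.rpow_add ht]
    simp [mul_comm]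
  rw [barenblatt_eq d α m R ht, h3, ← mul_assoc, ← mul_assoc, h4, one_mul]

/-- Differentiability data of a test function. -/
lemma IsTestFunction.exists_derivative {t₀ T : ℝ} (hT : t₀ < T) {φ : ℝ → 𝔼 → ℝ}
    (hφ : IsTestFunction t₀ T φ) : ∃ (t₁ : ℝ) (D : ℝ × 𝔼 → (ℝ × 𝔼 →L[ℝ] ℝ)),
      t₀ < t₁ ∧ t₁ < T ∧ ContinuousOn D (Icc t₀ t₁ ×ˢ univ) ∧
      ContinuousOn (fun p : ℝ × 𝔼 => φ p.1 p.2) (Icc t₀ t₁ ×ˢ univ) ∧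
      (∀ t ∈ Ioo t₀ T, ∀ x, HasFDerivAt (fun p : ℝ × 𝔼 => φ p.1 p.2) (D (t, x)) (t, x)) ∧
      (∀ t ∈ Ioo t₀ T, t₁ < t → ∀ x, D (t, x) = 0) ∧ ∀ x, φ t₁ x = 0 := by
  obtain ⟨hcd, -, δ, hδ, hvan⟩ := hφ
  -- The first entry puts `t₁` in the range where `φ` vanishes; the second keeps `t₁ > t₀` even if
  -- `δ` exceeds `T - t₀`.
  set t₁ := max (T - δ / 2) ((t₀ + T) / 2) with ht₁
  have h1 : t₀ < t₁ := lt_of_lt_of_le (by linarith) (le_max_right _ _)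
  have h2 : t₁ < T := max_lt (by linarith) (by linarith)
  have h3 : T - δ < t₁ := lt_of_lt_of_le (by linarith) (le_max_left _ _)
  have hsub : Icc t₀ t₁ ×ˢ (univ : Set 𝔼) ⊆ Ico t₀ T ×ˢ univ :=
    prod_mono_left fun t ht => ⟨ht.1, ht.2.trans_lt h2⟩
  have hU : UniqueDiffOn ℝ (Ico t₀ T ×ˢ (univ : Set 𝔼)) := (uniqueDiffOn_Ico t₀ T).prod
    uniqueDiffOn_univ
  have hD : ∀ t ∈ Ioo t₀ T, ∀ x, HasFDerivAt (fun p : ℝ × 𝔼 => φ p.1 p.2)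
      (fderivWithin ℝ (fun p : ℝ × 𝔼 => φ p.1 p.2) (Ico t₀ T ×ˢ univ) (t, x)) (t, x) := by
    intro t ht x
    have hn : Ico t₀ T ×ˢ (univ : Set 𝔼) ∈ 𝓝 (t, x) :=
      prod_mem_nhds (Ico_mem_nhds ht.1 ht.2) univ_mem
    have := (hcd.differentiableOn (by norm_num) (t, x) ⟨⟨ht.1.le, ht.2⟩, mem_univ _⟩)
    exact this.hasFDerivWithinAt.hasFDerivAt hn
  refine ⟨t₁, fderivWithin ℝ (fun p : ℝ × 𝔼 => φ p.1 p.2) (Ico t₀ T ×ˢ univ), h1, h2,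
    (hcd.continuousOn_fderivWithin hU (by norm_num)).mono hsub, hcd.continuousOn.mono hsub, hD,
    fun t ht htt x => ?_, fun x => hvan t₁ ⟨h1.le, h2⟩ h3 x⟩
  refine (hD t ht x).unique ((hasFDerivAt_const (0 : ℝ) (t, x)).congr_of_eventuallyEq ?_)
  have hn : Ioo t₁ T ×ˢ (univ : Set 𝔼) ∈ 𝓝 (t, x) :=
    prod_mem_nhds (Ioo_mem_nhds htt ht.2) univ_mem
  filter_upwards [hn] with p hp
  exact hvan p.1 ⟨(h1.trans hp.1.1).le, hp.1.2⟩ (h3.trans hp.1.1) p.2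

/-- The weak formulation along the self-similar flow. -/
lemma integral_barenblatt_transport (hd : 0 < d) {α m R : ℝ} (hα : 0 < α) (hm : 1 < m)
    (hR : 0 < R) {t₀ T : ℝ} (ht₀ : 0 < t₀) (x₀ : 𝔼) {φ : ℝ → 𝔼 → ℝ} {t₁ : ℝ}
    {D : ℝ × 𝔼 → (ℝ × 𝔼 →L[ℝ] ℝ)} (h01 : t₀ < t₁) (h1T : t₁ < T)
    (hDc : ContinuousOn D (Icc t₀ t₁ ×ˢ univ))
    (hφc : ContinuousOn (fun p : ℝ × 𝔼 => φ p.1 p.2) (Icc t₀ t₁ ×ˢ univ))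
    (hD : ∀ t ∈ Ioo t₀ T, ∀ x, HasFDerivAt (fun p : ℝ × 𝔼 => φ p.1 p.2) (D (t, x)) (t, x))
    (hD0 : ∀ t ∈ Ioo t₀ T, t₁ < t → ∀ x, D (t, x) = 0) (hφ0 : ∀ x, φ t₁ x = 0) :
    ∫ p in Ioo t₀ T ×ˢ (univ : Set 𝔼), barenblatt d α m R p.1 (p.2 - x₀) *
      D p (1, (selfSimExponent d α m / p.1) • (p.2 - x₀)) =
    -∫ x, barenblatt d α m R t₀ (x - x₀) * φ t₀ x := by
  set l := selfSimExponent d α m with hl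
  have hl0 : 0 < l := selfSimExponent_pos hd hα hm
  have hpos : ∀ t ∈ Icc t₀ t₁, 0 < t := fun t ht => ht₀.trans_le ht.1
  have hm' : (volume : Measure (ℝ × 𝔼)).restrict (Ioo t₀ T ×ˢ univ) =
      (volume.restrict (Ioo t₀ T)).prod volume := by
    rw [Measure.volume_eq_prod, ← Measure.prod_restrict, Measure.restrict_univ]
  have hI1 : IntegrableOn (fun p : ℝ × 𝔼 => barenblatt d α m R p.1 (p.2 - x₀) *
      D p (1, (l / p.1) • (p.2 - x₀))) (Ioo t₀ T ×ˢ univ) := by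
    refine integrableOn_strip_of_continuousOn (t₁ := t₁) (N := R * T ^ l + ‖x₀‖) ?_ .univ ?_
    · refine (continuousOn_barenblatt hα hm R x₀ hpos).mul (hDc.clm_apply ?_)
      exact continuousOn_const.prodMk ((continuousOn_const.div continuousOn_fst
        fun p hp => (hpos _ hp.1).ne').smul (by fun_prop))
    · rintro t ht x - (h | h)
      · simp [hD0 t ht h x]
      · simp only
        rw [barenblatt_eq_zero_of_lt_norm hd hα hm hR (ht₀.trans ht.1) ht.2.le h, zero_mul]
  have hpath : ContinuousOn (fun p : ℝ × 𝔼 => (p.1, x₀ + p.1 ^ l • p.2)) (Icc t₀ t₁ ×ˢ univ) :=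
    continuousOn_fst.prodMk (continuousOn_const.add
      ((continuousOn_rpow_fst l hpos univ).smul continuousOn_snd))
  have hmaps : MapsTo (fun p : ℝ × 𝔼 => (p.1, x₀ + p.1 ^ l • p.2)) (Icc t₀ t₁ ×ˢ univ)
      (Icc t₀ t₁ ×ˢ univ) := fun p hp => ⟨hp.1, mem_univ _⟩
  have hDcont : ContinuousOn (fun p : ℝ × 𝔼 => D (p.1, x₀ + p.1 ^ l • p.2)
      (1, (l * p.1 ^ (l - 1)) • p.2)) (Icc t₀ t₁ ×ˢ univ) :=
    (hDc.comp hpath hmaps).clm_apply (continuousOn_const.prodMk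
      ((continuousOn_const.mul (continuousOn_rpow_fst (l - 1) hpos univ)).smul continuousOn_snd))
  have hI2 : IntegrableOn (fun p : ℝ × 𝔼 => barenblattProfile d α m R p.2 *
      D (p.1, x₀ + p.1 ^ l • p.2) (1, (l * p.1 ^ (l - 1)) • p.2)) (Ioo t₀ T ×ˢ univ) := by
    refine integrableOn_strip_of_continuousOn (t₁ := t₁) (N := R) ?_ .univ ?_
    · exact ((continuous_barenblattProfile hα hm R).comp continuous_snd).continuousOn.mul hDcont
    · rintro t ht x - (h | h)
      · simp [hD0 t ht h]
      · simp only
        rw [barenblattProfile_eq_zero hα hm hR h.le, zero_mul]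
  -- The integrand is the time derivative of `φ` along a flow line, and `φ` vanishes at `t₁`.
  have hFTC : ∀ y : 𝔼, ∫ t in Ioo t₀ T, D (t, x₀ + t ^ l • y) (1, (l * t ^ (l - 1)) • y) =
      -φ t₀ (x₀ + t₀ ^ l • y) := by
    intro y
    have hsec : ContinuousOn (fun t : ℝ => (t, y)) (Icc t₀ t₁) := by fun_prop
    have hsecm : MapsTo (fun t : ℝ => (t, y)) (Icc t₀ t₁) (Icc t₀ t₁ ×ˢ univ) :=
      fun t ht => ⟨ht, mem_univ _⟩
    have hz : ∫ t in Ioo t₀ T, D (t, x₀ + t ^ l • y) (1, (l * t ^ (l - 1)) • y) =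
        ∫ t in Ioc t₀ t₁, D (t, x₀ + t ^ l • y) (1, (l * t ^ (l - 1)) • y) := by
      refine setIntegral_eq_of_subset_of_forall_sdiff_eq_zero measurableSet_Ioo
        (fun t ht => ⟨ht.1, ht.2.trans_lt h1T⟩) fun t ht => ?_
      have : t₁ < t := by
        by_contra hc
        exact ht.2 ⟨ht.1.1, not_lt.1 hc⟩
      rw [hD0 t ht.1 this]
      rfl
    rw [hz, ← intervalIntegral.integral_of_le h01.le,
      intervalIntegral.integral_eq_sub_of_hasDerivAt_of_le
        (f := fun t => φ t (x₀ + t ^ l • y)) h01.le]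
    · rw [hφ0, zero_sub]
    · exact (hφc.comp hpath hmaps).comp hsec hsecm
    · intro t ht
      have ht0 : 0 < t := ht₀.trans ht.1
      have h2 : HasDerivAt (fun t : ℝ => (t, x₀ + t ^ l • y)) (1, (l * t ^ (l - 1)) • y) t :=
        (hasDerivAt_id t).prodMk
          (((Real.hasDerivAt_rpow_const (Or.inl ht0.ne')).smul_const y).const_add x₀)
      exact (hD t ⟨ht.1, ht.2.trans h1T⟩ (x₀ + t ^ l • y)).comp_hasDerivAt t h2
    · refine ContinuousOn.intervalIntegrable ?_
      rw [uIcc_of_le h01.le]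
      exact hDcont.comp hsec hsecm
  calc _ = ∫ t in Ioo t₀ T, ∫ x, barenblatt d α m R t (x - x₀) *
        D (t, x) (1, (l / t) • (x - x₀)) := by
        rw [hm']
        rw [IntegrableOn, hm'] at hI1
        exact integral_prod _ hI1
    _ = ∫ t in Ioo t₀ T, ∫ y, barenblattProfile d α m R y *
        D (t, x₀ + t ^ l • y) (1, (l * t ^ (l - 1)) • y) := by
        refine setIntegral_congr_fun measurableSet_Ioo fun t ht => ?_
        have ht0 : 0 < t := ht₀.trans ht.1
        rw [integral_barenblatt_mul ht0 x₀ fun x => D (t, x) (1, (l / t) • (x - x₀))]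
        refine integral_congr_ae (ae_of_all _ fun y => ?_)
        simp only [add_sub_cancel_left, ← hl]
        -- The velocity `(λ/t)(x - x₀)` at `x = x₀ + t^λ y` is `λ t^{λ-1} y`.
        rw [smul_smul, Real.rpow_sub_one ht0.ne', mul_div_assoc', div_mul_eq_mul_div]
    _ = ∫ y, ∫ t in Ioo t₀ T, barenblattProfile d α m R y *
        D (t, x₀ + t ^ l • y) (1, (l * t ^ (l - 1)) • y) := by
        rw [IntegrableOn, hm'] at hI2
        exact integral_integral_swap hI2
    _ = ∫ y, -(barenblattProfile d α m R y * φ t₀ (x₀ + t₀ ^ l • y)) := by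
        refine integral_congr_ae (ae_of_all _ fun y => ?_)
        simp only
        rw [integral_const_mul, hFTC, mul_neg]
    _ = _ := by rw [integral_neg, integral_barenblatt_mul ht₀ x₀]

/-- By `huV` the flux is explicit everywhere, so the weak identity is that of the continuity
equation with velocity `(λ/t)(x - x₀)`. -/
lemma isWeakSolution_barenblatt (hd : 0 < d) {α m R : ℝ} (hα : 0 < α) (hα2 : α ≤ 2) (hm : 1 < m)
    (hR : 0 < R) {t₀ T : ℝ} (ht₀ : 0 < t₀) (hT : t₀ < T) (x₀ : 𝔼) :
    IsWeakSolution α m t₀ T (fun t x => barenblatt d α m R t (x - x₀))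
      (fun x => barenblatt d α m R t₀ (x - x₀)) := by
  set V : ℝ → 𝔼 → 𝔼 := fun t x => (barenblattConst d α m / t) •
      ballPotentialGrad α m (R * t ^ selfSimExponent d α m) (x - x₀) with hV
  have hpos : ∀ t ∈ Icc t₀ T, 0 < t := fun t ht => ht₀.trans_le ht.1
  have huc := continuousOn_barenblatt (d := d) hα hm R x₀ hpos
  have hu0 : ∀ t ∈ Ioo t₀ T, ∀ x : 𝔼, R * T ^ selfSimExponent d α m + ‖x₀‖ < ‖x‖ →
      barenblatt d α m R t (x - x₀) = 0 := fun t ht x hx =>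
    barenblatt_eq_zero_of_lt_norm hd hα hm hR (ht₀.trans ht.1) ht.2.le hx
  have huV : ∀ t, 0 < t → ∀ x : 𝔼, barenblatt d α m R t (x - x₀) • V t x =
      barenblatt d α m R t (x - x₀) • (-(selfSimExponent d α m / t)) • (x - x₀) := fun t ht x =>
    smul_ballPotentialGrad hd hα hm t _ fun h => barenblatt_eq_zero hα hm hR ht h
  refine ⟨?_, ?_, V, ?_, fun K hK => ⟨?_, ?_⟩, ?_, fun φ hφ => ?_⟩
  · exact integrableOn_strip_of_continuousOn huc .univ fun t ht x _ hx =>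
      hu0 t ht x (hx.resolve_left ht.2.not_gt)
  · refine Continuous.locallyIntegrable ?_
    simp only [barenblatt_eq d α m R ht₀]
    exact continuous_const.mul ((continuous_barenblattProfile hα hm R).comp (by fun_prop))
  · refine (ae_restrict_mem measurableSet_Ioo).mono fun t ht => ?_
    have ht0 := ht₀.trans ht.1
    simp only [abs_barenblatt_rpow hd hα hm R ht0]
    exact isFracGradient_ballPower hd hα hα2 hm (by positivity) _ x₀
  · exact integrableOn_strip_rieszPotential hd hα hα2 hm hR ht₀ x₀ hK
  · exact integrableOn_strip_ballPotentialGrad hd hα hα2 hm hR ht₀ x₀ hK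
  · have h : IntegrableOn (fun p : ℝ × 𝔼 => barenblatt d α m R p.1 (p.2 - x₀) •
        (-(selfSimExponent d α m / p.1)) • (p.2 - x₀)) (Ioo t₀ T ×ˢ univ) := by
      refine integrableOn_strip_of_continuousOn (t₁ := T)
        (N := R * T ^ selfSimExponent d α m + ‖x₀‖) ?_ .univ fun t ht x _ hx => ?_
      · exact huc.smul ((continuousOn_const.div continuousOn_fst
          fun p hp => (hpos _ hp.1).ne').neg.smul (by fun_prop))
      · simp only
        rw [hu0 t ht x (hx.resolve_left ht.2.not_gt), zero_smul]
    exact h.congr_fun (fun p hp => (huV p.1 (ht₀.trans hp.1.1) p.2).symm)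
      (measurableSet_Ioo.prod .univ)
  · obtain ⟨t₁, D, h01, h1T, hDc, hφc, hD, hD0, hφ0⟩ := hφ.exists_derivative hT
    rw [← sub_neg_eq_add, sub_eq_zero,
      ← integral_barenblatt_transport hd hα hm hR ht₀ x₀ h01 h1T hDc hφc hD hD0 hφ0]
    refine setIntegral_congr_fun (measurableSet_Ioo.prod .univ) fun p hp => ?_
    obtain ⟨t, x⟩ := p
    have ht0 : 0 < t := ht₀.trans hp.1.1
    have hDp := hD t hp.1 x
    have e1 : deriv (fun s => φ s x) t = D (t, x) (1, 0) := by
      have h2 : HasDerivAt (fun s : ℝ => (s, x)) (1, 0) t :=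
        (hasDerivAt_id t).prodMk (hasDerivAt_const t x)
      exact (hDp.comp_hasDerivAt t h2).deriv
    have e2 : ∀ v : 𝔼, inner ℝ v (gradient (φ t) x) = D (t, x) (0, v) := by
      intro v
      have h2 : HasFDerivAt (fun y : 𝔼 => (t, y)) (ContinuousLinearMap.inr ℝ ℝ 𝔼) x :=
        hasFDerivAt_prodMk_right t x
      have h3 : fderiv ℝ (φ t) x = (D (t, x)).comp (ContinuousLinearMap.inr ℝ ℝ 𝔼) :=
        (hDp.comp x h2).fderiv
      rw [real_inner_comm, gradient, InnerProductSpace.toDual_symm_apply, h3]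
      rfl
    simp only
    rw [e1, mul_sub, ← real_inner_smul_left, huV t ht0 x, e2]
    have e3 : ((1 : ℝ), (selfSimExponent d α m / t) • (x - x₀)) =
        ((1 : ℝ), (0 : 𝔼)) + ((0 : ℝ), (selfSimExponent d α m / t) • (x - x₀)) := by simp
    have e4 : ((0 : ℝ), barenblatt d α m R t (x - x₀) •
        (-(selfSimExponent d α m / t)) • (x - x₀)) = (-barenblatt d α m R t (x - x₀)) •
        ((0 : ℝ), (selfSimExponent d α m / t) • (x - x₀)) := by
      simp
    rw [e3, e4, map_add, map_smul, smul_eq_mul]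
    ring

/-! ### The equation pointwise off the free boundary -/

lemma differentiableAt_barenblattProfile (hd : 0 < d) {α m R : ℝ} (hα : 0 < α) (hm : 1 < m) {z : 𝔼}
    (hz : ‖z‖ < R) : DifferentiableAt ℝ (barenblattProfile d α m R) z := by
  have hs : 0 < R ^ 2 - ‖z‖ ^ 2 := by have := norm_nonneg z; nlinarith
  have hk := barenblattConst_pos hd hα hm
  have h1 : DifferentiableAt ℝ (fun z : 𝔼 =>
      (barenblattConst d α m * (R ^ 2 - ‖z‖ ^ 2) ^ (α / 2)) ^ (1 / (m - 1))) z := by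
    have h2 : DifferentiableAt ℝ (fun z : 𝔼 => R ^ 2 - ‖z‖ ^ 2) z :=
      (differentiableAt_const _).sub (hasStrictFDerivAt_norm_sq z).hasFDerivAt.differentiableAt
    have h3 := (h2.rpow_const (p := α / 2) (Or.inl hs.ne')).const_mul (barenblattConst d α m)
    exact h3.rpow_const (Or.inl (by positivity))
  refine h1.congr_of_eventuallyEq ?_
  filter_upwards [Metric.isOpen_ball.mem_nhds (mem_ball_zero_iff.2 hz)] with y hy
  have hy' : ‖y‖ < R := mem_ball_zero_iff.1 hy
  have : 0 ≤ R ^ 2 - ‖y‖ ^ 2 := by have := norm_nonneg y; nlinarith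
  rw [barenblattProfile, max_eq_left this]

lemma sum_apply_single_mul (L : 𝔼 →L[ℝ] ℝ) (v : 𝔼) :
    ∑ i, L (EuclideanSpace.single i 1) * v i = L v := by
  conv_rhs => rw [← (EuclideanSpace.basisFun (Fin d) ℝ).sum_repr v]
  simp [map_sum, mul_comm]

lemma rieszPotential_abs_barenblatt (hd : 0 < d) {α m R : ℝ} (hα : 0 < α) (hm : 1 < m) {t : ℝ}
    (ht : 0 < t) (x₀ : 𝔼) :
    rieszPotential (2 - α) (fun z => |barenblatt d α m R t (z - x₀)| ^ (m - 1)) =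
      fun y => barenblattConst d α m / t *
        rieszPotential (2 - α) (ballPower α (R * t ^ selfSimExponent d α m)) (y - x₀) := by
  simp only [abs_barenblatt_rpow hd hα hm R ht]
  exact rieszPotential_const_mul_comp_sub _ _ _ _

lemma differentiableAt_rieszPotential_barenblatt (hd : 0 < d) {α m R : ℝ} (hα : 0 < α)
    (hα2 : α ≤ 2) (hm : 1 < m) (hR : 0 < R) {t : ℝ} (ht : 0 < t) (x₀ : 𝔼) {y : 𝔼}
    (hy : ‖y - x₀‖ ≠ R * t ^ selfSimExponent d α m) :
    DifferentiableAt ℝ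
      (rieszPotential (2 - α) (fun z => |barenblatt d α m R t (z - x₀)| ^ (m - 1))) y := by
  have hρ : 0 < R * t ^ selfSimExponent d α m := by positivity
  rw [rieszPotential_abs_barenblatt hd hα hm ht]
  have h : DifferentiableAt ℝ
      (rieszPotential (2 - α) (ballPower α (R * t ^ selfSimExponent d α m))) (y - x₀) := by
    rcases hy.lt_or_gt with h | h
    · exact (hasGradientAt_rieszPotential_ballPower hd hα hα2 hm h).differentiableAt
    · exact differentiableAt_rieszPotential_ballPower hd hα hα2 hρ h
  exact (h.comp y (differentiableAt_id.sub_const x₀)).const_mul _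

lemma gradient_rieszPotential_barenblatt (hd : 0 < d) {α m R : ℝ} (hα : 0 < α)
    (hα2 : α ≤ 2) (hm : 1 < m) {t : ℝ} (ht : 0 < t) (x₀ : 𝔼) {y : 𝔼}
    (hy : ‖y - x₀‖ < R * t ^ selfSimExponent d α m) :
    gradient (rieszPotential (2 - α) (fun z => |barenblatt d α m R t (z - x₀)| ^ (m - 1))) y =
      (-(selfSimExponent d α m / t)) • (y - x₀) := by
  rw [rieszPotential_abs_barenblatt hd hα hm ht]
  have h := (hasGradientAt_rieszPotential_ballPower hd hα hα2 hm hy).hasFDerivAt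
  have h1 : HasFDerivAt (fun y : 𝔼 => y - x₀) (ContinuousLinearMap.id ℝ 𝔼) y :=
    (hasFDerivAt_id y).sub_const x₀
  have h2 := (h.comp y h1).const_mul (barenblattConst d α m / t)
  refine HasGradientAt.gradient (hasGradientAt_iff_hasFDerivAt.2 (h2.congr_fderiv ?_))
  have hk := (barenblattConst_pos hd hα hm).ne'
  ext v
  simp only [smul_apply, ContinuousLinearMap.comp_id, InnerProductSpace.toDual_apply_apply,
    real_inner_smul_left, smul_eq_mul]
  field_simp

/-- Inside, the divergence of `-(λ/t) u (x - x₀)` is `-(λ/t)(d u + (x - x₀)·∇u)`, which is `∂_t u`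
by self-similarity. Outside, `u` vanishes in a neighbourhood and both sides are `0`. -/
lemma solvesPointwiseAt_barenblatt (hd : 0 < d) {α m R : ℝ} (hα : 0 < α) (hα2 : α ≤ 2) (hm : 1 < m)
    (hR : 0 < R) {t : ℝ} (ht : 0 < t) (x₀ : 𝔼) {x : 𝔼}
    (hx : ‖x - x₀‖ ≠ R * t ^ selfSimExponent d α m) :
    SolvesPointwiseAt α m (fun t x => barenblatt d α m R t (x - x₀)) t x := by
  set l := selfSimExponent d α m with hl
  have hρ : 0 < R * t ^ l := by positivity
  refine ⟨gradient (rieszPotential (2 - α) fun z => |barenblatt d α m R t (z - x₀)| ^ (m - 1)),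
    ?_, ?_⟩
  · have hopen : IsOpen {y : 𝔼 | ‖y - x₀‖ ≠ R * t ^ l} :=
      isOpen_ne_fun (by fun_prop) continuous_const
    filter_upwards [hopen.mem_nhds hx] with y hy
    refine ⟨Eventually.of_forall fun z => ?_,
      (differentiableAt_rieszPotential_barenblatt hd hα hα2 hm hR ht x₀ hy).hasGradientAt⟩
    simp only [abs_barenblatt_rpow hd hα hm R ht]
    exact rieszConvergesAt_ballPower hd hα hα2 hρ _ x₀ z
  rcases hx.lt_or_gt with hin | hout
  · have hz : ‖t ^ (-l) • (x - x₀)‖ < R := by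
      rw [norm_smul, Real.norm_of_nonneg (by positivity), Real.rpow_neg ht.le, ← div_eq_inv_mul,
        div_lt_iff₀ (by positivity)]
      exact hin
    have hΦ := (differentiableAt_barenblattProfile hd hα hm hz).hasFDerivAt
    set L := fderiv ℝ (barenblattProfile d α m R) (t ^ (-l) • (x - x₀)) with hL
    have h1 : HasFDerivAt (fun y : 𝔼 => y - x₀) (ContinuousLinearMap.id ℝ 𝔼) x :=
      (hasFDerivAt_id x).sub_const x₀
    have h2 := (hΦ.comp x (h1.const_smul (t ^ (-l)))).const_mul (t ^ (-((d : ℝ) * l)))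
    have h3 := h2.smul (h1.const_smul (-(l / t)))
    refine ⟨_, h3.congr_of_eventuallyEq ?_, ?_⟩
    · have hopen : IsOpen {y : 𝔼 | ‖y - x₀‖ < R * t ^ l} :=
        isOpen_lt (by fun_prop) continuous_const
      filter_upwards [hopen.mem_nhds hin] with y hy
      rw [gradient_rieszPotential_barenblatt hd hα hα2 hm ht x₀ hy, barenblatt_eq d α m R ht]
      rfl
    · have h4 : HasDerivAt (fun s : ℝ => s ^ (-l) • (x - x₀))
          ((-l * t ^ (-l - 1)) • (x - x₀)) t :=
        (Real.hasDerivAt_rpow_const (Or.inl ht.ne')).smul_const _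
      have h5 := (Real.hasDerivAt_rpow_const (x := t) (p := -((d : ℝ) * l))
        (Or.inl ht.ne')).mul (hΦ.comp_hasDerivAt t h4)
      have h6 := h5.congr_of_eventuallyEq (f₁ := fun s => barenblatt d α m R s (x - x₀)) (by
        filter_upwards [eventually_gt_nhds ht] with s hs
        exact barenblatt_eq d α m R hs _)
      refine h6.congr_deriv ?_
      have h7 := sum_apply_single_mul L (x - x₀)
      simp only [PiLp.sub_apply] at h7
      simp [Finset.sum_add_distrib, Real.rpow_sub_one ht.ne', ← h7, Finset.mul_sum]
      congr 1
      · ring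
      · exact congrArg Neg.neg (Finset.sum_congr rfl fun i _ => by ring)
  · have hopen : IsOpen {y : 𝔼 | R * t ^ l < ‖y - x₀‖} :=
      isOpen_lt continuous_const (by fun_prop)
    refine ⟨0, (hasFDerivAt_const (0 : 𝔼) x).congr_of_eventuallyEq ?_, ?_⟩
    · filter_upwards [hopen.mem_nhds hout] with y hy
      rw [barenblatt_eq_zero hα hm hR ht (le_of_lt hy), zero_smul]
    · simp only [zero_apply, PiLp.zero_apply, Finset.sum_const_zero]
      refine (hasDerivAt_const t (0 : ℝ)).congr_of_eventuallyEq ?_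
      -- The boundary moves continuously, so `x` remains outside for all times near `t`.
      have hc : ContinuousAt (fun s : ℝ => R * s ^ l) t :=
        continuousAt_const.mul (Real.continuousAt_rpow_const t l (Or.inl ht.ne'))
      filter_upwards [hc.eventually (eventually_lt_nhds hout), eventually_gt_nhds ht] with s hs hs0
      exact barenblatt_eq_zero hα hm hR hs0 hs.le

/-! ### Hölder continuity at the free boundary -/

lemma abs_rpow_sub_rpow_le {γ : ℝ} (hγ : 0 ≤ γ) (hγ1 : γ ≤ 1) {a b : ℝ} (ha : 0 ≤ a) (hb : 0 ≤ b) :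
    |a ^ γ - b ^ γ| ≤ |a - b| ^ γ := by
  wlog h : b ≤ a generalizing a b
  · rw [abs_sub_comm, abs_sub_comm a]
    exact this hb ha (le_of_not_ge h)
  have h1 : 0 ≤ a - b := sub_nonneg.2 h
  have h2 := NNReal.rpow_add_le_add_rpow ⟨a - b, h1⟩ ⟨b, hb⟩ hγ hγ1
  have h3 : (a - b + b) ^ γ ≤ (a - b) ^ γ + b ^ γ := by exact_mod_cast h2
  rw [sub_add_cancel] at h3
  rw [abs_of_nonneg (sub_nonneg.2 (Real.rpow_le_rpow hb h hγ)), abs_of_nonneg h1]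
  linarith

/-- Hölder continuity of `r_+^γ` near the origin. -/
lemma exists_holderOnWith_max_rpow {γ : ℝ} (hγ : 0 < γ) : ∃ S ∈ 𝓝 (0 : ℝ), ∃ C : ℝ≥0,
    HolderOnWith C (Real.toNNReal (min γ 1)) (fun r : ℝ => (max r 0) ^ γ) S := by
  have hmax : LipschitzWith 1 fun r : ℝ => max r 0 := LipschitzWith.id.max_const 0
  rcases le_total γ 1 with h | h
  · refine ⟨univ, univ_mem, 1, ?_⟩
    rw [min_eq_left h, holderOnWith_univ]
    have h1 : ∀ a b : ℝ, dist ((max a 0) ^ γ) ((max b 0) ^ γ) ≤ dist a b ^ γ := by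
      intro a b
      rw [Real.dist_eq, Real.dist_eq]
      refine (abs_rpow_sub_rpow_le hγ.le h (le_max_right _ _) (le_max_right _ _)).trans ?_
      refine Real.rpow_le_rpow (abs_nonneg _) ?_ hγ.le
      have := hmax.dist_le_mul a b
      simpa [Real.dist_eq] using this
    intro a b
    rw [ENNReal.coe_one, one_mul, edist_dist, edist_dist, Real.coe_toNNReal _ hγ.le,
      ENNReal.ofReal_rpow_of_nonneg dist_nonneg hγ.le]
    exact ENNReal.ofReal_le_ofReal (h1 a b)
  -- For `γ ≥ 1` the power is `C¹` at `0`, hence locally Lipschitz; a neighbourhood is needed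
  -- because it is not globally so when `γ > 1`.
  · have hcd : ContDiffAt ℝ 1 (fun r : ℝ => r ^ γ) 0 :=
      Real.contDiffAt_rpow_const_of_le (by exact_mod_cast h)
    obtain ⟨K, S, hS, hK⟩ := hcd.exists_lipschitzOnWith
    have ht : Tendsto (fun r : ℝ => max r 0) (𝓝 0) (𝓝 0) := by
      have := hmax.continuous.tendsto 0
      rwa [max_self] at this
    refine ⟨(fun r : ℝ => max r 0) ⁻¹' S, ht hS, K * 1, ?_⟩
    rw [min_eq_right h, Real.toNNReal_one, holderOnWith_one]
    exact hK.comp hmax.lipschitzOnWith (mapsTo_preimage _ _)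

/-- The time prefactor is written as a `γ`-th power, `γ = α/(2(m-1))`, and moved inside the positive
part, so that `u` becomes a function of one `C¹` quantity. -/
lemma barenblatt_eq_const_mul_max_rpow (hd : 0 < d) {α m : ℝ} (R : ℝ) (hα : 0 < α) (hm : 1 < m)
    {t : ℝ} (ht : 0 < t) (x : 𝔼) :
    barenblatt d α m R t x = barenblattConst d α m ^ (1 / (m - 1)) *
      (max (t ^ (-((d : ℝ) / ((d : ℝ) * (m - 1) + α)) / (α / (2 * (m - 1)))) *
        (R ^ 2 - ‖x‖ ^ 2 * t ^ (-(2 / ((d : ℝ) * (m - 1) + α))))) 0) ^ (α / (2 * (m - 1))) := by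
  have hk := barenblattConst_pos hd hα hm
  have hm1 : 0 < m - 1 := by linarith
  have hγ : 0 < α / (2 * (m - 1)) := by positivity
  have e1 : max (t ^ (-((d : ℝ) / ((d : ℝ) * (m - 1) + α)) / (α / (2 * (m - 1)))) *
        (R ^ 2 - ‖x‖ ^ 2 * t ^ (-(2 / ((d : ℝ) * (m - 1) + α))))) 0 =
      t ^ (-((d : ℝ) / ((d : ℝ) * (m - 1) + α)) / (α / (2 * (m - 1)))) *
        max (R ^ 2 - ‖x‖ ^ 2 * t ^ (-(2 / ((d : ℝ) * (m - 1) + α)))) 0 := by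
    rw [mul_max_of_nonneg _ _ (by positivity), mul_zero]
  rw [e1, Real.mul_rpow (by positivity) (le_max_right _ _), ← Real.rpow_mul ht.le,
    div_mul_cancel₀ _ hγ.ne', barenblatt, Real.mul_rpow hk.le (by positivity),
    ← Real.rpow_mul (le_max_right _ _)]
  have e2 : α / 2 * (1 / (m - 1)) = α / (2 * (m - 1)) := by field_simp
  rw [e2]
  ring

lemma exists_holderOnWith_barenblatt (hd : 0 < d) {α m R : ℝ} (hα : 0 < α) (hm : 1 < m) {t : ℝ}
    (ht : 0 < t) (x₀ : 𝔼) {x : 𝔼} (hx : ‖x - x₀‖ = R * t ^ selfSimExponent d α m) :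
    ∃ N ∈ 𝓝 (t, x), ∃ C : ℝ≥0, HolderOnWith C (Real.toNNReal (min (α / (2 * (m - 1))) 1))
      (fun p : ℝ × 𝔼 => barenblatt d α m R p.1 (p.2 - x₀)) N := by
  have hm1 : 0 < m - 1 := by linarith
  set γ := α / (2 * (m - 1)) with hγdef
  have hγ : 0 < γ := by positivity
  set g : ℝ × 𝔼 → ℝ := fun p => p.1 ^ (-((d : ℝ) / ((d : ℝ) * (m - 1) + α)) / γ) *
      (R ^ 2 - ‖p.2 - x₀‖ ^ 2 * p.1 ^ (-(2 / ((d : ℝ) * (m - 1) + α)))) with hg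
  -- The estimate for `r_+^γ` is available only near `r = 0`; `g` vanishes exactly on the free
  -- boundary, so points near `(t, x)` are mapped there.
  have hg0 : g (t, x) = 0 := by
    have h1 : (t ^ selfSimExponent d α m) ^ 2 * t ^ (-(2 / ((d : ℝ) * (m - 1) + α))) = 1 := by
      rw [← Real.rpow_natCast, ← Real.rpow_mul ht.le, ← Real.rpow_add ht, selfSimExponent]
      rw [show 1 / ((d : ℝ) * (m - 1) + α) * ((2 : ℕ) : ℝ) + -(2 / ((d : ℝ) * (m - 1) + α)) = 0 by
        push_cast; ring, Real.rpow_zero]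
    simp only [hg, hx]
    rw [mul_pow, mul_assoc, h1, mul_one, sub_self, mul_zero]
  have hfst (a : ℝ) : ContDiffAt ℝ 1 (fun p : ℝ × 𝔼 => p.1 ^ a) (t, x) :=
    contDiffAt_fst.rpow_const_of_ne ht.ne'
  have hgc : ContDiffAt ℝ 1 g (t, x) :=
    (hfst _).mul (contDiffAt_const.sub (((contDiffAt_snd.sub contDiffAt_const).norm_sq ℝ).mul
      (hfst _)))
  obtain ⟨K, N₁, hN₁, hK⟩ := hgc.exists_lipschitzOnWith
  obtain ⟨S, hS, C, hC⟩ := exists_holderOnWith_max_rpow hγ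
  have hpre : g ⁻¹' S ∈ 𝓝 (t, x) := hgc.continuousAt.preimage_mem_nhds (by rwa [hg0])
  have hpos : {p : ℝ × 𝔼 | 0 < p.1} ∈ 𝓝 (t, x) :=
    (isOpen_lt continuous_const continuous_fst).mem_nhds ht
  set N := N₁ ∩ (g ⁻¹' S ∩ {p : ℝ × 𝔼 | 0 < p.1}) with hN
  have hK' : HolderOnWith K 1 g N := holderOnWith_one.2 (hK.mono inter_subset_left)
  have hcomp := hC.comp hK' (fun p hp => hp.2.1)
  rw [mul_one] at hcomp
  set c : ℝ≥0 := Real.toNNReal (barenblattConst d α m ^ (1 / (m - 1))) with hc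
  have hc' : (c : ℝ) = barenblattConst d α m ^ (1 / (m - 1)) :=
    Real.coe_toNNReal _ (Real.rpow_nonneg (barenblattConst_pos hd hα hm).le _)
  refine ⟨N, inter_mem hN₁ (inter_mem hpre hpos), c * (C * K ^ ((Real.toNNReal (min γ 1) : ℝ≥0) : ℝ)),
    fun p hp q hq => ?_⟩
  have h := hcomp p hp q hq
  have e : ∀ p ∈ N, barenblatt d α m R p.1 (p.2 - x₀) = c * (max (g p) 0) ^ γ := fun p hp => by
    rw [hc', barenblatt_eq_const_mul_max_rpow hd R hα hm hp.2.2]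
  simp only
  rw [e p hp, e q hq, ← smul_eq_mul, ← smul_eq_mul, edist_smul₀, ENNReal.coe_mul, mul_assoc,
    ENNReal.smul_def, smul_eq_mul]
  have : ‖(c : ℝ)‖₊ = c := by simp
  rw [this]
  gcongr
  exact h

end

theorem theorem1 (d : ℕ) (hd : 0 < d) (α m R : ℝ) (hα : 0 < α) (hα2 : α ≤ 2) (hm : 1 < m)
    (hR : 0 < R) :
    IsProfileSolution α m (barenblattProfile d α m R) ∧
    (∀ t : ℝ, 0 < t → ∀ x : EuclideanSpace ℝ (Fin d),
      barenblatt d α m R t x =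
        t ^ (-((d : ℝ) * selfSimExponent d α m)) *
          barenblattProfile d α m R (t ^ (-selfSimExponent d α m) • x)) ∧
    (∀ t : ℝ, 0 < t → HasCompactSupport (barenblatt d α m R t)) ∧
    ∀ (x₀ : EuclideanSpace ℝ (Fin d)) (u : ℝ → EuclideanSpace ℝ (Fin d) → ℝ),
      (∀ t x, u t x = barenblatt d α m R t (x - x₀)) →
      (∀ t₀ T : ℝ, 0 < t₀ → t₀ < T → IsWeakSolution α m t₀ T u (u t₀)) ∧
      (∀ (t : ℝ) (x : EuclideanSpace ℝ (Fin d)), 0 < t →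
        ‖x - x₀‖ ≠ R * t ^ selfSimExponent d α m → SolvesPointwiseAt α m u t x) ∧
      (∀ (t : ℝ) (x : EuclideanSpace ℝ (Fin d)), 0 < t →
        ‖x - x₀‖ = R * t ^ selfSimExponent d α m →
        ∃ N ∈ 𝓝 (t, x), ∃ C : ℝ≥0,
          HolderOnWith C (Real.toNNReal (min (α / (2 * (m - 1))) 1))
            (fun p : ℝ × EuclideanSpace ℝ (Fin d) => u p.1 p.2) N) := by
  refine ⟨isProfileSolution_barenblattProfile hd hα hα2 hm hR,
    fun t ht x => barenblatt_eq d α m R ht x,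
    fun t ht => hasCompactSupport_barenblatt hα hm hR ht, fun x₀ u hu => ?_⟩
  obtain rfl : u = fun t x => barenblatt d α m R t (x - x₀) :=
    funext fun t => funext fun x => hu t x
  exact ⟨fun t₀ T ht₀ hT => isWeakSolution_barenblatt hd hα hα2 hm hR ht₀ hT x₀,
    fun t x ht hx => solvesPointwiseAt_barenblatt hd hα hα2 hm hR ht x₀ hx,
    fun t x ht hx => exists_holderOnWith_barenblatt hd hα hm ht x₀ hx⟩
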